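/- **Corollary 1.8.** Throughout $\tau,w\in\mathbb H$, $q=e^{2\pi i\tau}$, $\zeta=e^{2\pi iz}$, $\tau_2=\operatorname{Im}\tau$, $z_2=\operatorname{Im}z$, and square roots are principal. *The functions $u_k$.* Let $u(n,m)$ be the number of unimodal sequences $1\le a_1\le\dots\le a_r\le\underline{c}\ge b_1\ge\dots\ge b_s\ge1$ of size $n=c+\sum_j a_j+\sum_j b_j$ and rank $m=s-r$ (with the empty sequence being the only one of size $0$, of rank $0$), and let $U(\zeta;q)=\sum_{n\ge0,\,m\in\mathbb Z}u(n,m)\zeta^mq^n$. For $\tau$ with $U(1;q)\ne0$ define $u_k(\tau)$, $k\ge1$, by $$U(\zeta;q)=\frac{\sin(\pi z)}{\pi z}\,U(1;q)\exp\Big(2\sum_{k\ge1}u_k(\tau)\frac{(2\pi iz)^k}{k!}\Big)\qquad(z\to0).$$ *The completions.* Let $\operatorname{erf}(x)=\frac{2}{\sqrt\pi}\int_0^xe^{-t^2}dt$ and $$\vartheta(z;\tau)=i\sum_{n\in\mathbb Z}(-1)^nq^{\frac12(n+\frac12)^2}\zeta^{n+\frac12},$$ $$\widehat\psi(z;\tau,w)=i\sum_{n\in\mathbb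 Z}\operatorname{erf}\Big(-i\sqrt{\pi i(w-\tau)}\big(n+\tfrac12+\tfrac{z_2}{\tau_2}\big)\Big)(-1)^nq^{\frac12(n+\frac12)^2}\zeta^{n+\frac12},\qquad \widehat T=\vartheta+\widehat\psi,$$ $$\widehat H(z;\tau,w)=\tfrac i2\big(\zeta^{\frac12}-\zeta^{-\frac12}\big)q^{\frac18}\Big(-\zeta\,\widehat T(3z+\tau;3\tau,3w)+\zeta^{-1}\,\widehat T(3z-\tau;3\tau,3w)\Big).$$ Let $\mathcal D$ be the set of all $(\tau,w)\in\mathbb H\times\mathbb H$ with $\tau\ne w$ and $\widehat T(0;\tau,w)\ne0$. For $(\tau,w)\in\mathcal D$ expand, as real-analytic functions of $z$ near $0$ (all sums being over $(k,\ell)\in\mathbb N_0^2\setminus\{(0,0)\}$), $$\widehat T(z;\tau,w)=\widehat T(0;\tau,w)\exp\Big(-\sum\widehat g_{k,\ell}(\tau,w)\tfrac{(2\pi iz)^k}{k!}\tfrac{(2\pi i\overline z)^\ell}{\ell!}\Big),$$ $$\widehat H(z;\tau,w)=2i\sin(\pi z)\Big[\tfrac{\partial\widehat H}{\partial\zeta}\Big]_{\zeta=1}\exp\Big(-\sum\widehat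 h_{k,\ell}(\tau,w)\tfrac{(2\pi iz)^k}{k!}\tfrac{(2\pi i\overline z)^\ell}{\ell!}\Big),$$ and put $\widehat g_k=\widehat g_{k,0}$, $\widehat h_k=\widehat h_{k,0}$ for $k\ge1$. Let $\widehat G_k=G_k$, where $G_k(\tau)=-\frac{B_k}{2k}+\sum_{n\ge1}\sum_{d\mid n}d^{k-1}q^n$ for even $k\ge 2$ and $G_k=0$ for odd $k$, and let $\widehat\gamma_k=\widehat G_k-2^{k-1}\widehat g_k$. *The functions $\widehat u_k$.* For a partition $\lambda$ of $n$ in which $j$ has multiplicity $m_j$, put $f_\lambda=\prod_{j=1}^nf_j^{m_j}$, $\phi(\lambda)=\prod_{j=1}^n\frac{2^{m_j}}{j!^{m_j}m_j!}$, $\psi(\lambda)=\prod_{j=1}^n\frac{(-1)^{m_j}}{j!^{m_j}m_j!}$, and $\operatorname{Tr}_n(c,f)=\sum_{\lambda\vdash n}c(\lambda)f_\lambda$. Define recursively, for $k\ge1$ and on $\mathcal D$, $$\widehat u_k=-\frac{k!}{2}\sum_{\lambda\vdash k,\ \lambda\ne(k)}\phi(\lambda)\,\widehat u_\lambda+\frac{k!}{2}\operatorname{Tr}_k(\phi,\widehat\gamma)+k!\,\widehat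 g_1\operatorname{Tr}_{k-1}(\psi,\widehat h).$$ *Claim.* Let $k\ge1$. 1. $\widehat u_k$ transforms like a quasimodular form of weight $(k,0)$ (with trivial multiplier) under the simultaneous action of $\Gamma_0(3)$ on $\tau$ and $w$. That is: $\mathcal D$ is invariant under $(\tau,w)\mapsto\big(\frac{a\tau+b}{c\tau+d},\frac{aw+b}{cw+d}\big)$ for $\begin{pmatrix}a&b\\c&d\end{pmatrix}\in\Gamma_0(3)$, and there are $s_1,s_2\in\mathbb N_0$ and real-analytic functions $f_{n,m}:\mathcal D\to\mathbb C$ ($0\le n\le s_1$, $0\le m\le s_2$) with $f_{0,0}=\widehat u_k$ such that, for all $(\tau,w)\in\mathcal D$ and all $\begin{pmatrix}a&b\\c&d\end{pmatrix}\in\Gamma_0(3)$, $$\widehat u_k\Big(\frac{a\tau+b}{c\tau+d},\frac{aw+b}{cw+d}\Big)=(c\tau+d)^k\sum_{n=0}^{s_1}\sum_{m=0}^{s_2}f_{n,m}(\tau,w)\Big(\frac c{c\tau+d}\Big)^n\Big(\frac c{cw+d}\Big)^m.$$ 2. For every $\tau\in\mathbb H$ with $U(1;q)\neq0$ and every $\varepsilon>0$,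 $$\lim_{t\to\infty}\widehat u_k(\tau,\tau+it+\varepsilon)=u_k(\tau).$$ -/

import Mathlib

open scoped MatrixGroups Nat

noncomputable section

namespace QuasiCompletion

/-! ### Exponential Taylor coefficients -/

/-- The numbers `c k` (for `k ≥ 1`) in `F z = F 0 * exp (∑_{k ≥ 1} c k * (2 π i z) ^ k / k!)`, where `F` is
holomorphic near `0` and `F 0 ≠ 0`. -/
def expTaylorCoeff (F : ℂ → ℂ) (k : ℕ) : ℂ :=
  iteratedDeriv k (fun z : ℂ => Complex.log (F z / F 0)) 0 / (2 * Real.pi * Complex.I) ^ k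

/-! ### Unimodal sequences and their ranks -/

/-- `a₁ ≤ ⋯ ≤ a_r ≤ c ≥ b₁ ≥ ⋯ ≥ b_s` with all `a_i, b_i ≥ 1`. A sequence with `c ≥ 1` is a unimodal sequence
with marked peak `c`; `c = 0` forces `r = s = 0` and encodes the empty sequence (of size and rank zero). -/
def IsUnimodal (x : List ℕ × ℕ × List ℕ) : Prop :=
  x.1.Pairwise (· ≤ ·) ∧ x.2.2.Pairwise (· ≥ ·) ∧
    (∀ i ∈ x.1, 1 ≤ i ∧ i ≤ x.2.1) ∧ (∀ i ∈ x.2.2, 1 ≤ i ∧ i ≤ x.2.1)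

/-- The number `u(n, m)` of unimodal sequences of size `n` and rank `s - r = m`. -/
def unimodalCount (n : ℕ) (m : ℤ) : ℕ :=
  Set.ncard {x : List ℕ × ℕ × List ℕ | IsUnimodal x ∧ x.1.sum + x.2.1 + x.2.2.sum = n ∧
    (x.2.2.length : ℤ) - (x.1.length : ℤ) = m}

/-- The rank generating function `U(ζ; q) = ∑ u(n, m) ζ ^ m q ^ n`. -/
def unimodalGF (ζ q : ℂ) : ℂ :=
  ∑' p : ℕ × ℤ, (unimodalCount p.1 p.2 : ℂ) * ζ ^ p.2 * q ^ p.1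

/-- `q = exp (2 π i τ)`. -/
def qOf (τ : ℂ) : ℂ := Complex.exp (2 * Real.pi * Complex.I * τ)

/-- `sin (π z) / (π z)`, with value `1` at `z = 0`. -/
def sincPi (z : ℂ) : ℂ := if z = 0 then 1 else Complex.sin (Real.pi * z) / (Real.pi * z)

/-- The functions `u_k`, defined by
`U(exp (2 π i z); q) = sin (π z) / (π z) * U(1; q) * exp (2 * ∑_{k ≥ 1} u_k(τ) (2 π i z) ^ k / k!)`. -/
def u (k : ℕ) (τ : ℂ) : ℂ :=
  expTaylorCoeff
    (fun z => unimodalGF (Complex.exp (2 * Real.pi * Complex.I * z)) (qOf τ) / sincPi z) k / 2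

/-! ### Theta functions and completions

A function of `z` and its conjugate is written as a function of two independent variables `z`, `z'`; its value at
`z` is obtained for `z' = conj z`, and its Taylor coefficients in `z` and `conj z` are those in `z` and `z'`. -/

/-- The error function `2 / √π * ∫_0^z exp (- t ^ 2) dt` (integral along the segment from `0` to `z`). -/
def erf (z : ℂ) : ℂ :=
  2 / (Real.sqrt Real.pi : ℂ) * (z * ∫ t in (0 : ℝ)..1, Complex.exp (-(z * (t : ℂ)) ^ 2))

/-- The principal branch of the square root. -/
def csqrt (z : ℂ) : ℂ := z ^ (1 / 2 : ℂ)

/-- The Jacobi theta function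
`ϑ(z; τ) = i ∑_{n ∈ ℤ} (-1) ^ n q ^ ((n + 1/2) ^ 2 / 2) ζ ^ (n + 1/2)`. -/
def jacobiTheta (z τ : ℂ) : ℂ :=
  Complex.I * ∑' n : ℤ, (-1 : ℂ) ^ n *
    Complex.exp (Real.pi * Complex.I * ((n : ℂ) + 1 / 2) ^ 2 * τ) *
    Complex.exp (2 * Real.pi * Complex.I * ((n : ℂ) + 1 / 2) * z)

/-- The completed false theta function `i ∑_{n ∈ ℤ} erf (-i √(π i (w - τ)) (n + 1/2 + z₂ / τ₂)) (-1) ^ n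
q ^ ((n + 1/2) ^ 2 / 2) ζ ^ (n + 1/2)`, where `z₂ = Im z = (z - z') / (2 i)` and `τ₂ = Im τ`. -/
def psiHat (z z' τ w : ℂ) : ℂ :=
  Complex.I * ∑' n : ℤ,
    erf (-Complex.I * csqrt (Real.pi * Complex.I * (w - τ)) *
      ((n : ℂ) + 1 / 2 + (z - z') / (2 * Complex.I) / (τ.im : ℂ))) *
    (-1 : ℂ) ^ n *
    Complex.exp (Real.pi * Complex.I * ((n : ℂ) + 1 / 2) ^ 2 * τ) *
    Complex.exp (2 * Real.pi * Complex.I * ((n : ℂ) + 1 / 2) * z)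

/-- The completion `ϑ + ψ̂` of the partial theta function. -/
def THat (z z' τ w : ℂ) : ℂ := jacobiTheta z τ + psiHat z z' τ w

/-- The completion `Ĥ` of the false theta function `h` is `(ζ ^ (1/2) - ζ ^ (-1/2)) * K = 2 i sin (π z) * K` with
`K = i / 2 * q ^ (1/8) * (- ζ * T̂(3 z + τ; 3 τ, 3 w) + ζ⁻¹ * T̂(3 z - τ; 3 τ, 3 w))`. This is `K`; at
`z = 0` it is the derivative of `Ĥ` with respect to `ζ` at `ζ = 1`. -/
def HHatFactor (z z' τ w : ℂ) : ℂ :=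
  Complex.I / 2 * Complex.exp (2 * Real.pi * Complex.I * τ / 8) *
    (-(Complex.exp (2 * Real.pi * Complex.I * z) *
        THat (3 * z + τ) (3 * z' + (starRingEnd ℂ) τ) (3 * τ) (3 * w)) +
      Complex.exp (-(2 * Real.pi * Complex.I * z)) *
        THat (3 * z - τ) (3 * z' - (starRingEnd ℂ) τ) (3 * τ) (3 * w))

/-- `ĝ_k = ĝ_{k,0}`, where `T̂(z) = T̂(0) exp (-∑ ĝ_{k,l} (2 π i z) ^ k / k! (2 π i conj z) ^ l / l!)`: the terms
free of `conj z` are obtained by putting `z' = 0`. -/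
def gHat (k : ℕ) (τ w : ℂ) : ℂ := -expTaylorCoeff (fun z => THat z 0 τ w) k

/-- `ĥ_k = ĥ_{k,0}`, where
`Ĥ(z) = 2 i sin (π z) [∂Ĥ/∂ζ](ζ = 1) exp (-∑ ĥ_{k,l} (2 π i z) ^ k / k! (2 π i conj z) ^ l / l!)`. -/
def hHat (k : ℕ) (τ w : ℂ) : ℂ := -expTaylorCoeff (fun z => HHatFactor z 0 τ w) k

/-- The Eisenstein series `G_k(τ) = - B_k / (2 k) + ∑_{n ≥ 1} σ_{k-1}(n) q ^ n` for even `k ≥ 2`, and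
`G_k = 0` for odd `k`. They are quasimodular and serve as their own completions. -/
def G (k : ℕ) (τ : ℂ) : ℂ :=
  if Even k then
    -((bernoulli k : ℚ) : ℂ) / (2 * (k : ℂ)) +
      ∑' n : ℕ, (ArithmeticFunction.sigma (k - 1) (n + 1) : ℂ) * qOf τ ^ (n + 1)
  else 0

/-- `γ̂_k = Ĝ_k - 2 ^ (k - 1) ĝ_k` with `Ĝ_k = G_k`, for `k ≥ 1`. -/
def gammaHat (k : ℕ) (τ w : ℂ) : ℂ := G k τ - 2 ^ (k - 1) * gHat k τ w

/-! ### Partition traces -/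

/-- `f_λ = ∏_j f_j ^ m_j`, where `m_j` is the multiplicity of `j` in `λ`. -/
def partProd {n : ℕ} (f : ℕ → ℂ) (l : Nat.Partition n) : ℂ :=
  ∏ j ∈ Finset.Icc 1 n, f j ^ l.parts.count j

/-- `φ(λ) = ∏_j 2 ^ m_j / (j! ^ m_j m_j!)`. -/
def phi {n : ℕ} (l : Nat.Partition n) : ℂ :=
  ∏ j ∈ Finset.Icc 1 n,
    (2 : ℂ) ^ l.parts.count j / ((j ! : ℂ) ^ l.parts.count j * ((l.parts.count j)! : ℂ))

/-- `ψ(λ) = ∏_j (-1) ^ m_j / (j! ^ m_j m_j!)`. -/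
def psi {n : ℕ} (l : Nat.Partition n) : ℂ :=
  ∏ j ∈ Finset.Icc 1 n,
    (-1 : ℂ) ^ l.parts.count j / ((j ! : ℂ) ^ l.parts.count j * ((l.parts.count j)! : ℂ))

/-- The partition trace `Tr_n(c, f) = ∑_{λ ⊢ n} c(λ) f_λ`. -/
def partTrace (n : ℕ) (c : Nat.Partition n → ℂ) (f : ℕ → ℂ) : ℂ :=
  ∑ l : Nat.Partition n, c l * partProd f l

/-- The functions `û_k`, `k ≥ 1`, defined recursively by
`û_k = - k!/2 ∑_{λ ⊢ k, λ ≠ (k)} φ(λ) û_λ + k!/2 Tr_k(φ, γ̂) + k! ĝ_1 Tr_{k-1}(ψ, ĥ)`.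
All parts of a partition `λ ≠ (k)` of `k` lie between `1` and `k - 1`, so only those factors of `û_λ` are written
(the factor for `j = 0` has exponent zero); see `uHat_eq` for the recursion in terms of `û_λ`. -/
def uHat (k : ℕ) (τ w : ℂ) : ℂ :=
  -((k ! : ℂ) / 2) * (∑ l ∈ Finset.univ.erase (Nat.Partition.indiscrete k),
      phi l * ∏ j : Fin k, uHat j.1 τ w ^ l.parts.count j.1) +
    (k ! : ℂ) / 2 * partTrace k phi (fun j => gammaHat j τ w) +
    (k ! : ℂ) * gHat 1 τ w * partTrace (k - 1) psi (fun j => hHat j τ w)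
termination_by k
decreasing_by exact j.isLt

theorem uHat_eq (k : ℕ) (hk : 1 ≤ k) (τ w : ℂ) :
    uHat k τ w =
      -((k ! : ℂ) / 2) * (∑ l ∈ Finset.univ.erase (Nat.Partition.indiscrete k),
          phi l * partProd (fun j => uHat j τ w) l) +
        (k ! : ℂ) / 2 * partTrace k phi (fun j => gammaHat j τ w) +
        (k ! : ℂ) * gHat 1 τ w * partTrace (k - 1) psi (fun j => hHat j τ w) := by
  rw [uHat]
  congr 3
  refine Finset.sum_congr rfl fun l hl => ?_
  congr 1
  have hne : l ≠ Nat.Partition.indiscrete k := (Finset.mem_erase.mp hl).1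
  have hk0 : k ∉ l.parts := by
    intro hmem
    apply hne
    obtain ⟨t, ht⟩ := Multiset.exists_cons_of_mem hmem
    have hsum : k + t.sum = k := by
      have := l.parts_sum
      rwa [ht, Multiset.sum_cons] at this
    have ht0 : t = 0 := by
      refine Multiset.eq_zero_of_forall_notMem fun a ha => ?_
      have h1 : 0 < a := l.parts_pos (by rw [ht]; exact Multiset.mem_cons_of_mem ha)
      have h2 : a ≤ t.sum := Multiset.single_le_sum (fun _ _ => Nat.zero_le _) a ha
      omega
    apply Nat.Partition.ext
    rw [Nat.Partition.indiscrete_parts (by omega), ht, ht0]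
    rfl
  have h0 : (0 : ℕ) ∉ l.parts := fun h => (l.parts_pos h).ne' rfl
  rw [partProd, Fin.prod_univ_eq_prod_range (fun j => uHat j τ w ^ l.parts.count j) k,
    Finset.prod_range_eq_mul_Ico _ hk, Multiset.count_eq_zero_of_notMem h0, pow_zero, one_mul]
  refine Finset.prod_subset (fun j hj => ?_) (fun j hj hj' => ?_)
  · simp only [Finset.mem_Ico, Finset.mem_Icc] at *
    omega
  · simp only [Finset.mem_Ico, Finset.mem_Icc] at *
    have : j = k := by omega
    rw [this, Multiset.count_eq_zero_of_notMem hk0, pow_zero]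

/-! ### Quasimodular transformation under a simultaneous action -/

/-- `c x + d` for a matrix `(a, b; c, d)`. -/
def autFactor (γ : SL(2, ℤ)) (x : ℂ) : ℂ := ((γ 1 0 : ℤ) : ℂ) * x + ((γ 1 1 : ℤ) : ℂ)

/-- `(a x + b) / (c x + d)` for a matrix `(a, b; c, d)`. -/
def moebius (γ : SL(2, ℤ)) (x : ℂ) : ℂ :=
  (((γ 0 0 : ℤ) : ℂ) * x + ((γ 0 1 : ℤ) : ℂ)) / autFactor γ x

/-- A function `f(τ, w)`, defined on the subset `X` of `ℍ × ℍ`, transforms like a quasimodular form of weight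
`(k, l)` and multiplier `ν` on `Γ` under the simultaneous action on `τ` and `w`: `X` is invariant and there are
real-analytic functions `F n m`, `0 ≤ n ≤ s₁`, `0 ≤ m ≤ s₂`, on `X` with `F 0 0 = f` and
`f(γτ, γw) = ν_{τ,w}(γ) (cτ + d) ^ k (cw + d) ^ l ∑ F n m (τ, w) (c / (cτ + d)) ^ n (c / (cw + d)) ^ m`. -/
def TransformsQuasimodular (Γ : Subgroup SL(2, ℤ)) (ν : ℂ → ℂ → SL(2, ℤ) → ℂ) (k l : ℤ)
    (X : Set (ℂ × ℂ)) (f : ℂ → ℂ → ℂ) : Prop :=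
  (∀ γ ∈ Γ, ∀ p ∈ X, (moebius γ p.1, moebius γ p.2) ∈ X) ∧
  ∃ (s₁ s₂ : ℕ) (F : ℕ → ℕ → ℂ → ℂ → ℂ),
    (∀ n ≤ s₁, ∀ m ≤ s₂, AnalyticOnNhd ℝ (fun p : ℂ × ℂ => F n m p.1 p.2) X) ∧
    (∀ p ∈ X, F 0 0 p.1 p.2 = f p.1 p.2) ∧
    ∀ γ ∈ Γ, ∀ p ∈ X,
      f (moebius γ p.1) (moebius γ p.2) =
        ν p.1 p.2 γ * autFactor γ p.1 ^ k * autFactor γ p.2 ^ l *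
          ∑ n ∈ Finset.range (s₁ + 1), ∑ m ∈ Finset.range (s₂ + 1),
            F n m p.1 p.2 * (((γ 1 0 : ℤ) : ℂ) / autFactor γ p.1) ^ n *
              (((γ 1 0 : ℤ) : ℂ) / autFactor γ p.2) ^ m

/-- The set of `(τ, w) ∈ ℍ × ℍ` with `τ ≠ w` at which the functions `ĝ_k` are defined, that is,
`T̂(0; τ, w) ≠ 0`. (The normalizing factor in the definition of `ĥ_k` has no zeros.) -/
def domain : Set (ℂ × ℂ) :=
  {p | 0 < p.1.im ∧ 0 < p.2.im ∧ p.1 ≠ p.2 ∧ THat 0 0 p.1 p.2 ≠ 0}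

end QuasiCompletion

end

/-! All `û_k` are packed into one generating function. Partition traces are Taylor coefficients of
exponentials, so with `x = 2πiz` the recursion reads `exp(2 ∑ û_k x^k/k!) = exp(2 ∑ γ̂_k x^k/k!) + 2
ĝ_1 x exp(-∑ ĥ_k x^k/k!)`. The right side equals `eisExp(z) T̂(2z)/T̂(0) + 4πi ĝ_1 z K(z)/K(0)`,
where `K` is `HHatFactor` and the conjugate variable is set to `0`. Both `T̂` and `K` are sums of a
theta part and an error-function part. The theta parts cancel, by a quintuple product identity
(`jacobiTheta_two_mul`) and the value of `ϑ'(0)` that it implies. What is left is `genFun`, built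
from the series `psiCore` alone (`two_mul_uHat_eq`). The factor `-i√(πi(w-τ))` has dropped out, and
`genFun` is holomorphic in `z`, `τ`, `w` and an auxiliary variable `v`, evaluated at `v = 1/(2i Im
τ)`. Real-analyticity of `û_k` follows.

Transformation. For theta series with characteristics, `ϑ` and `ψ̂` transform under all of `SL(2,
ℤ)` with multipliers `C` and `C ρ`, where `ρ² = (cτ+d)(cw+d)` (`exists_kleinLaw`). The essential
case is the inversion `psiKlein_inversion`: the operator `1 + 2(w-τ)∂_w` turns the completed series
into a unary theta series of weight `3/2` in `w`, whose inversion is classical, and the error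
satisfies a homogeneous first-order equation that is singular at `w = τ` and has only the zero
solution. For the combination of level three one conjugates `Γ_0(3)` by `diag(3, 1)` and uses that
`d ≡ ±1` mod `3` permutes the characteristics `±1/3`. The unknown multipliers cancel in `genFun`,
which acquires only `exp(3πi c z²/(cτ+d))` (`genFun_transform`). Hence `û_k` is modular of weight
`k`, except that `û_2` has one additional term.

Limit. As `w = τ + it + ε` goes to `τ + i∞ + ε`, the error functions tend to signs and `ψ̂` to a
false theta function. On the other side, `U(ζ; q) (ζq)_∞ (ζ⁻¹q)_∞` is the series `rankSeries`, whose
functional equation under `a ↦ aq`, iterated, expresses it through partial theta functions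
(`rankSeries_eq`). The part even in `z` of this expression shows that `U/(sin(πz)/(πz))` is a
constant times the limit of `genFun`; the odd part is the quintuple product identity used above.
Locally uniform convergence of logarithms carries the limit over to Taylor coefficients
(`tendsto_uHat`). -/

noncomputable section

namespace QuasiCompletion

/-! ### Osgood's lemma -/

/-- Continuous functions on open subsets of `E` that are holomorphic along all complex lines are analytic. -/
def OsgoodSpace (E : Type) [NormedAddCommGroup E] [NormedSpace ℂ E] : Prop :=
  ∀ (F : Type) [NormedAddCommGroup F] [NormedSpace ℂ F] [CompleteSpace F] (f : E → F) (U : Set E),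
    IsOpen U → ContinuousOn f U →
    (∀ y ∈ U, ∀ h : E, DifferentiableAt ℂ (fun t : ℂ => f (y + t • h)) 0) → AnalyticOnNhd ℂ f U

theorem differentiableAt_of_const_add {F : Type} [NormedAddCommGroup F] [NormedSpace ℂ F]
    {f : ℂ → F} {y : ℂ} (h : DifferentiableAt ℂ (fun t : ℂ => f (y + t)) 0) :
    DifferentiableAt ℂ f y := by
  have h2 : DifferentiableAt ℂ (fun t : ℂ => f (y + t)) (y - y) := by rwa [sub_self]
  have h3 := DifferentiableAt.fun_comp' (f := fun x : ℂ => x - y) y h2 (by fun_prop)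
  simpa using h3

theorem osgoodSpace_complex : OsgoodSpace ℂ := by
  intro F _ _ _ f U hU _ hd
  refine DifferentiableOn.analyticOnNhd (fun y hy => ?_) hU
  have h := hd y hy 1
  simp only [smul_eq_mul, mul_one] at h
  exact (differentiableAt_of_const_add h).differentiableWithinAt

/-! ### Cauchy integrals of functions with values in spaces of continuous functions. -/

section Cauchy

variable {F : Type} [NormedAddCommGroup F] [NormedSpace ℂ F] [CompleteSpace F]

/-- The Cauchy integral of `f` is a power series with values in `C(S, F)`. Evaluation at `s`
commutes with the integral, so Cauchy's formula for each `t ↦ f t s` identifies this series with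
`f`. Continuity in the supremum norm is needed only to form the integral. -/
theorem differentiableAt_of_forall_eval {S : Type} [TopologicalSpace S] [CompactSpace S]
    {f : ℂ → C(S, F)} {ρ : ℝ} (hρ : 0 < ρ) (hc : ContinuousOn f (Metric.closedBall 0 ρ))
    (hd : ∀ s, DifferentiableOn ℂ (fun t => f t s) (Metric.closedBall 0 ρ)) :
    DifferentiableAt ℂ f 0 := by
  lift ρ to NNReal using hρ.le
  have hi : CircleIntegrable f 0 ρ :=
    (hc.mono Metric.sphere_subset_closedBall).circleIntegrable ρ.2
  have hps := hasFPowerSeriesOn_cauchy_integral hi (by exact_mod_cast hρ)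
  have hps0 := hps.hasFPowerSeriesAt.differentiableAt
  refine hps0.congr_of_eventuallyEq ?_
  filter_upwards [Metric.ball_mem_nhds (0 : ℂ) hρ] with w hw
  ext s
  have h1 := Complex.two_pi_I_inv_smul_circleIntegral_sub_inv_smul_of_differentiable_on_off_countable
    (f := fun t => f t s) (c := 0) (R := ρ) (s := ∅) (w := w) Set.countable_empty hw
    ((hd s).continuousOn)
    (fun x hx => (hd s).differentiableAt (Metric.closedBall_mem_nhds_of_mem hx.1))
  rw [← h1]
  have hw' : CircleIntegrable (fun z => (z - w)⁻¹ • f z) 0 ρ := by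
    refine ContinuousOn.circleIntegrable ρ.2 ?_
    refine ContinuousOn.smul (ContinuousOn.inv₀ (f := fun z : ℂ => z - w) (by fun_prop) ?_)
      (hc.mono Metric.sphere_subset_closedBall)
    intro x hx h0
    rw [sub_eq_zero] at h0
    subst h0
    simp at hx hw
    linarith
  have h2 := (ContinuousMap.evalCLM ℂ s : C(S, F) →L[ℂ] F).intervalIntegral_comp_comm
    (μ := MeasureTheory.volume) hw'.out
  rw [circleIntegral, circleIntegral]
  simp only [ContinuousMap.coe_smul, Pi.smul_apply]
  exact congrArg _ h2

/-- Integration of a product over a circle, as a bounded bilinear map. -/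
def circlePairing (c : ℂ) (r : ℝ) (hr : 0 ≤ r) :
    C(Metric.sphere c r, ℂ) →L[ℂ] C(Metric.sphere c r, F) →L[ℂ] F :=
  LinearMap.mkContinuous₂
    (LinearMap.mk₂ ℂ (fun p q => ∫ θ in (0 : ℝ)..2 * Real.pi, deriv (circleMap c r) θ •
      (p ⟨circleMap c r θ, circleMap_mem_sphere c hr θ⟩ •
        q ⟨circleMap c r θ, circleMap_mem_sphere c hr θ⟩))
      (by
        intro p₁ p₂ q
        rw [← intervalIntegral.integral_add]
        · simp only [ContinuousMap.add_apply, add_smul, smul_add]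
        all_goals
          refine Continuous.intervalIntegrable ?_ _ _
          simp only [deriv_circleMap]
          fun_prop)
      (by
        intro a p q
        rw [← intervalIntegral.integral_smul]
        simp only [ContinuousMap.smul_apply, smul_assoc]
        simp only [smul_comm a])
      (by
        intro p q₁ q₂
        rw [← intervalIntegral.integral_add]
        · simp only [ContinuousMap.add_apply, smul_add]
        all_goals
          refine Continuous.intervalIntegrable ?_ _ _
          simp only [deriv_circleMap]
          fun_prop)
      (by
        intro a p q
        rw [← intervalIntegral.integral_smul]
        simp only [ContinuousMap.smul_apply]
        simp only [smul_comm a])) (r * (2 * Real.pi))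
    (by
      intro p q
      simp only [LinearMap.mk₂_apply]
      refine (intervalIntegral.norm_integral_le_of_norm_le_const
        (C := r * (‖p‖ * ‖q‖)) fun θ _ => ?_).trans ?_
      · rw [norm_smul, norm_smul]
        have : ‖deriv (circleMap c r) θ‖ = r := by
          simp [deriv_circleMap, abs_of_nonneg hr]
        rw [this]
        gcongr
        · exact p.norm_coe_le_norm _
        · exact q.norm_coe_le_norm _
      · rw [sub_zero, abs_of_pos Real.two_pi_pos]
        exact le_of_eq (by ring))

theorem circlePairing_apply (c : ℂ) (r : ℝ) (hr : 0 ≤ r) (p : C(Metric.sphere c r, ℂ))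
    (q : C(Metric.sphere c r, F)) :
    circlePairing c r hr p q = ∫ θ in (0 : ℝ)..2 * Real.pi, deriv (circleMap c r) θ •
      (p ⟨circleMap c r θ, circleMap_mem_sphere c hr θ⟩ •
        q ⟨circleMap c r θ, circleMap_mem_sphere c hr θ⟩) := rfl

end Cauchy

/-- The function `s ↦ (s - x)⁻¹` on a circle, depending on `x`. -/
theorem exists_analytic_resolvent (c : ℂ) (r : ℝ) :
    ∃ R : ℂ → C(Metric.sphere c r, ℂ), AnalyticOnNhd ℂ R (Metric.ball c r) ∧
      ∀ x ∈ Metric.ball c r, ∀ s, R x s = ((s : ℂ) - x)⁻¹ := by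
  let i : C(Metric.sphere c r, ℂ) := ⟨fun s => (s : ℂ), by fun_prop⟩
  have key : ∀ x ∈ Metric.ball c r, ∃ V : (C(Metric.sphere c r, ℂ))ˣ,
      (V : C(Metric.sphere c r, ℂ)) = i - x • 1 ∧
        ∀ s, (↑V⁻¹ : C(Metric.sphere c r, ℂ)) s = ((s : ℂ) - x)⁻¹ := by
    intro x hx
    have hne : ∀ s : Metric.sphere c r, (s : ℂ) - x ≠ 0 := by
      intro s h0
      rw [sub_eq_zero] at h0
      have := s.2
      rw [h0] at this
      simp [dist_eq_norm] at this hx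
      linarith
    refine ⟨⟨i - x • 1, ⟨fun s => ((s : ℂ) - x)⁻¹, ?_⟩, ?_, ?_⟩, rfl, fun s => rfl⟩
    · exact Continuous.inv₀ (by fun_prop) hne
    · ext s
      simp [i, hne s]
    · ext s
      simp [i, hne s]
  -- The continuous functions on the circle form a Banach algebra, in which inversion is analytic at
  -- units.
  refine ⟨fun x => Ring.inverse (i - x • 1), fun x hx => ?_, fun x hx s => ?_⟩
  · obtain ⟨V, hV, -⟩ := key x hx
    have h1 : AnalyticAt ℂ (Ring.inverse : C(Metric.sphere c r, ℂ) → _) (i - x • 1) := by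
      rw [← hV]; exact analyticAt_inverse V
    exact AnalyticAt.fun_comp h1 (by fun_prop)
  · obtain ⟨V, hV, hs⟩ := key x hx
    simp only
    rw [← hV, Ring.inverse_unit, hs]

/-- Cauchy's formula in the first variable writes `f (x, y)` as a bounded bilinear pairing of the
resolvent `R x` with the restriction `Y y` of `f (·, y)` to a circle. The induction hypothesis is
applied to `Y`, which takes values in a Banach space of continuous functions; this is why
`OsgoodSpace` allows arbitrary complete targets. -/
theorem OsgoodSpace.prod {E : Type} [NormedAddCommGroup E] [NormedSpace ℂ E] (hE : OsgoodSpace E) :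
    OsgoodSpace (ℂ × E) := by
  intro F _ _ _ f U hU hc hd
  rintro ⟨x₀, y₀⟩ hxy
  obtain ⟨ε, hε, hball⟩ := Metric.isOpen_iff.mp hU _ hxy
  set r := ε / 2 with hr
  have hr0 : 0 < r := by positivity
  have hsub : ∀ x ∈ Metric.closedBall x₀ r, ∀ y ∈ Metric.ball y₀ r, (x, y) ∈ U := by
    intro x hx y hy
    apply hball
    rw [Metric.mem_ball, Prod.dist_eq, max_lt_iff]
    simp only [Metric.mem_closedBall, Metric.mem_ball] at hx hy
    constructor <;> dsimp only <;> linarith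
  have hsub' : ∀ (s : Metric.sphere x₀ r), ∀ y ∈ Metric.ball y₀ r, ((s : ℂ), y) ∈ U :=
    fun s y hy => hsub _ (Metric.sphere_subset_closedBall s.2) y hy
  -- Currying yields continuity of `y ↦ f (·, y)` in the supremum norm.
  let g : C(Metric.ball y₀ r, C(Metric.sphere x₀ r, F)) :=
    ContinuousMap.curry ⟨fun p => f ((p.2 : ℂ), (p.1 : E)), by
      refine hc.comp_continuous (by fun_prop) ?_
      rintro ⟨y, s⟩
      exact hsub' s _ y.2⟩
  classical
  let Y : E → C(Metric.sphere x₀ r, F) := fun y => if h : y ∈ Metric.ball y₀ r then g ⟨y, h⟩ else 0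
  have hY : ∀ y ∈ Metric.ball y₀ r, ∀ s, Y y s = f ((s : ℂ), y) := by
    intro y hy s
    simp only [Y, hy, dif_pos, g]
    rfl
  have hYc : ContinuousOn Y (Metric.ball y₀ r) := by
    rw [continuousOn_iff_continuous_domRestrict]
    have : (Metric.ball y₀ r).domRestrict Y = g := by
      ext y s
      exact hY y y.2 s
    rw [this]
    exact g.continuous
  have hYa : AnalyticOnNhd ℂ Y (Metric.ball y₀ r) := by
    refine hE _ Y _ Metric.isOpen_ball hYc fun y hy h => ?_
    have hW : IsOpen {t : ℂ | y + t • h ∈ Metric.ball y₀ r} :=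
      Metric.isOpen_ball.preimage (by fun_prop)
    obtain ⟨ρ, hρ, hρW⟩ := Metric.isOpen_iff.mp hW 0 (by simpa using hy)
    have hsubW : ∀ t ∈ Metric.closedBall (0 : ℂ) (ρ / 2), y + t • h ∈ Metric.ball y₀ r := by
      intro t ht
      exact hρW (Metric.closedBall_subset_ball (by linarith) ht)
    refine differentiableAt_of_forall_eval (ρ := ρ / 2) (by positivity) ?_ ?_
    · exact hYc.comp (by fun_prop) hsubW
    · intro s
      have h1 : DifferentiableOn ℂ (fun t : ℂ => f ((s : ℂ), y + t • h))
          (Metric.closedBall (0 : ℂ) (ρ / 2)) := by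
        intro t ht
        have h2 := hd ((s : ℂ), y + t • h) (hsub' s _ (hsubW t ht)) (0, h)
        refine (differentiableAt_of_const_add ?_).differentiableWithinAt
        convert h2 using 3 with u
        simp [add_assoc, ← add_smul]
      exact h1.congr fun t ht => hY _ (hsubW t ht) s
  obtain ⟨R, hRa, hR⟩ := exists_analytic_resolvent x₀ r
  have hmem : ∀ᶠ p : ℂ × E in nhds (x₀, y₀), p.1 ∈ Metric.ball x₀ r ∧ p.2 ∈ Metric.ball y₀ r := by
    rw [nhds_prod_eq]
    exact Filter.prod_mem_prod (Metric.ball_mem_nhds x₀ hr0) (Metric.ball_mem_nhds y₀ hr0)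
  have hfin : AnalyticAt ℂ (fun p : ℂ × E => (2 * Real.pi * Complex.I : ℂ)⁻¹ •
      circlePairing x₀ r hr0.le (R p.1) (Y p.2)) (x₀, y₀) := by
    refine AnalyticAt.const_smul ?_
    have hB := ContinuousLinearMap.analyticAt_bilinear
      (circlePairing (F := F) x₀ r hr0.le) (R x₀, Y y₀)
    exact AnalyticAt.comp₂ (f := fun q : ℂ × E => R q.1) (g := fun q : ℂ × E => Y q.2)
      (h := fun q => circlePairing x₀ r hr0.le q.1 q.2) (x := (x₀, y₀)) hB
      ((hRa x₀ (Metric.mem_ball_self hr0)).fun_comp analyticAt_fst)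
      ((hYa y₀ (Metric.mem_ball_self hr0)).fun_comp analyticAt_snd)
  refine hfin.congr ?_
  filter_upwards [hmem] with p hp
  obtain ⟨x, y⟩ := p
  obtain ⟨hx, hy⟩ := hp
  have hdx : ∀ x ∈ Metric.closedBall x₀ r, DifferentiableAt ℂ (fun t : ℂ => f (t, y)) x := by
    intro x hx
    have h2 := hd (x, y) (hsub x hx y hy) (1, 0)
    refine differentiableAt_of_const_add ?_
    convert h2 using 3 with u
    simp
  have h1 := Complex.two_pi_I_inv_smul_circleIntegral_sub_inv_smul_of_differentiable_on_off_countable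
    (f := fun t => f (t, y)) (c := x₀) (R := r) (s := ∅) (w := x) Set.countable_empty hx
    (fun t ht => (hdx t ht).continuousAt.continuousWithinAt)
    (fun t ht => hdx t (Metric.ball_subset_closedBall ht.1))
  rw [← h1, circlePairing_apply, circleIntegral]
  simp only [hR x hx, hY y hy]

/-- A sum of analytic functions, dominated by a summable series, is analytic. -/
theorem OsgoodSpace.analyticOnNhd_tsum {E : Type} [NormedAddCommGroup E] [NormedSpace ℂ E]
    (hE : OsgoodSpace E) {ι : Type} {f : ι → E → ℂ} {U : Set E} (hU : IsOpen U)
    (hf : ∀ i, AnalyticOnNhd ℂ (f i) U)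
    (hb : ∀ y ∈ U, ∃ u : ι → ℝ, Summable u ∧ ∀ᶠ y' in nhds y, ∀ i, ‖f i y'‖ ≤ u i) :
    AnalyticOnNhd ℂ (fun y => ∑' i, f i y) U := by
  have key : ∀ y ∈ U, ∃ V, IsOpen V ∧ y ∈ V ∧ V ⊆ U ∧ ∃ u : ι → ℝ, Summable u ∧
      ∀ i, ∀ y' ∈ V, ‖f i y'‖ ≤ u i := by
    intro y hy
    obtain ⟨u, hu, hev⟩ := hb y hy
    obtain ⟨V, hV, hVo, hyV⟩ := mem_nhds_iff.mp (Filter.inter_mem hev (hU.mem_nhds hy))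
    exact ⟨V, hVo, hyV, fun x hx => (hV hx).2, u, hu, fun i y' hy' => (hV hy').1 i⟩
  refine hE _ _ U hU ?_ ?_
  · intro y hy
    obtain ⟨V, hVo, hyV, hVU, u, hu, hbd⟩ := key y hy
    have := continuousOn_tsum (fun i => ((hf i).mono hVU).continuousOn) hu hbd
    exact (this.continuousAt (hVo.mem_nhds hyV)).continuousWithinAt
  · intro y hy h
    obtain ⟨V, hVo, hyV, hVU, u, hu, hbd⟩ := key y hy
    have hW : IsOpen {t : ℂ | y + t • h ∈ V} := hVo.preimage (by fun_prop)
    have h1 := Complex.differentiableOn_tsum_of_summable_norm (F := fun i (t : ℂ) => f i (y + t • h)) hu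
      (fun i t ht => by
        have h2 := (hf i _ (hVU ht)).differentiableAt
        exact (DifferentiableAt.comp t h2 (by fun_prop)).differentiableWithinAt) hW
      (fun i t ht => hbd i _ ht)
    exact h1.differentiableAt (hW.mem_nhds (by simpa using hyV))

/-! ### Taylor coefficients depending on parameters -/

theorem analyticAt_deriv_fst {E : Type} [NormedAddCommGroup E] [NormedSpace ℂ E]
    {f : ℂ × E → ℂ} {x : ℂ × E} (hf : AnalyticAt ℂ f x) :
    AnalyticAt ℂ (fun p : ℂ × E => deriv (fun z => f (z, p.2)) p.1) x := by
  have h1 : AnalyticAt ℂ (fun p => fderiv ℂ f p ((1 : ℂ), (0 : E))) x :=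
    (((ContinuousLinearMap.apply ℂ ℂ ((1 : ℂ), (0 : E))).analyticAt _).comp hf.fderiv)
  refine h1.congr ?_
  filter_upwards [hf.eventually_analyticAt] with p hp
  have h2 := hp.differentiableAt.hasFDerivAt
  have h3 : HasDerivAt (fun z : ℂ => (z, p.2)) ((1 : ℂ), (0 : E)) p.1 :=
    (hasDerivAt_id p.1).prodMk (hasDerivAt_const _ _)
  exact (h2.comp_hasDerivAt p.1 h3).deriv.symm

theorem analyticAt_iteratedDeriv_fst {E : Type} [NormedAddCommGroup E] [NormedSpace ℂ E]
    {f : ℂ × E → ℂ} {x : ℂ × E} (hf : AnalyticAt ℂ f x) (k : ℕ) :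
    AnalyticAt ℂ (fun p : ℂ × E => iteratedDeriv k (fun z => f (z, p.2)) p.1) x := by
  induction k with
  | zero => simpa using hf
  | succ k ih =>
    simp only [iteratedDeriv_succ]
    exact analyticAt_deriv_fst ih

/-- Normalizing by the value at `z = 0` places the argument of the logarithm at `1`, so the
logarithm is jointly analytic near `(0, p₀)`, and so are its `z`-derivatives. -/
theorem analyticAt_expTaylorCoeff {E : Type} [NormedAddCommGroup E] [NormedSpace ℂ E]
    {f : ℂ × E → ℂ} {p₀ : E} (hf : AnalyticAt ℂ f (0, p₀)) (h0 : f (0, p₀) ≠ 0) (k : ℕ) :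
    AnalyticAt ℂ (fun p : E => expTaylorCoeff (fun z => f (z, p)) k) p₀ := by
  have hsec : AnalyticAt ℂ (fun p : E => ((0 : ℂ), p)) p₀ :=
    analyticAt_const.prod analyticAt_id
  have hf0 : AnalyticAt ℂ (fun p : ℂ × E => f (0, p.2)) (0, p₀) :=
    AnalyticAt.fun_comp (f := fun p : ℂ × E => ((0 : ℂ), p.2)) hf
      (analyticAt_const.prod analyticAt_snd)
  have h1 : AnalyticAt ℂ (fun p : ℂ × E => Complex.log (f p / f (0, p.2))) (0, p₀) := by
    refine AnalyticAt.clog (hf.div hf0 h0) ?_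
    simp [div_self h0]
  have h2 := (analyticAt_iteratedDeriv_fst h1 k).fun_comp (f := fun p : E => ((0 : ℂ), p)) hsec
  simp only [expTaylorCoeff]
  exact h2.div_const

/-! ### Partition traces as Taylor coefficients of exponentials -/

/-- `∏_j f_j ^ m_j / (j! ^ m_j m_j!)`, where `m_j` is the multiplicity of `j` in `s`. -/
def expWeight (N : ℕ) (f : ℕ → ℂ) (s : Multiset ℕ) : ℂ :=
  ∏ j ∈ Finset.Icc 1 N, f j ^ s.count j / ((j ! : ℂ) ^ s.count j * ((s.count j)! : ℂ))

/-- The coefficient of `x ^ n` in `exp (∑_j f_j x ^ j / j!)`. -/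
def expTrace (n : ℕ) (f : ℕ → ℂ) : ℂ := ∑ l : Nat.Partition n, expWeight n f l.parts

theorem partTrace_phi (n : ℕ) (f : ℕ → ℂ) : partTrace n phi f = expTrace n (fun j => 2 * f j) := by
  refine Finset.sum_congr rfl fun l _ => ?_
  rw [phi, partProd, expWeight, ← Finset.prod_mul_distrib]
  refine Finset.prod_congr rfl fun j _ => ?_
  rw [mul_pow]; ring

theorem partTrace_psi (n : ℕ) (f : ℕ → ℂ) : partTrace n psi f = expTrace n (fun j => -f j) := by
  refine Finset.sum_congr rfl fun l _ => ?_
  rw [psi, partProd, expWeight, ← Finset.prod_mul_distrib]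
  refine Finset.prod_congr rfl fun j _ => ?_
  rw [neg_pow (f j)]; ring

theorem expWeight_cons {N : ℕ} (f : ℕ → ℂ) (s : Multiset ℕ) {j : ℕ} (hj : j ∈ Finset.Icc 1 N) :
    ((s.count j + 1 : ℕ) : ℂ) * expWeight N f (j ::ₘ s) = f j / (j ! : ℂ) * expWeight N f s := by
  rw [expWeight, expWeight, ← Finset.mul_prod_erase _ _ hj, ← Finset.mul_prod_erase _ _ hj]
  have h1 : ∏ x ∈ (Finset.Icc 1 N).erase j, f x ^ (j ::ₘ s).count x /
      ((x ! : ℂ) ^ (j ::ₘ s).count x * (((j ::ₘ s).count x)! : ℂ)) =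
      ∏ x ∈ (Finset.Icc 1 N).erase j, f x ^ s.count x / ((x ! : ℂ) ^ s.count x * ((s.count x)! : ℂ)) := by
    refine Finset.prod_congr rfl fun x hx => ?_
    rw [Multiset.count_cons_of_ne (Finset.ne_of_mem_erase hx)]
  rw [h1, Multiset.count_cons_self, Nat.factorial_succ]
  have h2 : ((s.count j + 1 : ℕ) : ℂ) ≠ 0 := by exact_mod_cast Nat.succ_ne_zero (s.count j)
  have h3 : ((s.count j)! : ℂ) ≠ 0 := by exact_mod_cast Nat.factorial_ne_zero _
  have h4 : (j ! : ℂ) ≠ 0 := by exact_mod_cast Nat.factorial_ne_zero _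
  rw [Nat.cast_mul]
  field_simp
  ring

theorem expWeight_of_le {n N : ℕ} (h : n ≤ N) (f : ℕ → ℂ) {s : Multiset ℕ} (hs : ∀ i ∈ s, i ≤ n) :
    expWeight N f s = expWeight n f s := by
  refine (Finset.prod_subset (Finset.Icc_subset_Icc_right h) fun j hj hj' => ?_).symm
  have : j ∉ s := by
    intro hm
    have := hs j hm
    simp only [Finset.mem_Icc] at hj hj'
    omega
  rw [Multiset.count_eq_zero_of_notMem this]
  simp

theorem partition_le {n : ℕ} (l : Nat.Partition n) {i : ℕ} (hi : i ∈ l.parts) : i ≤ n := by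
  have := Multiset.single_le_sum (fun _ _ => Nat.zero_le _) i hi
  rwa [l.parts_sum] at this

theorem sum_count_mul {n : ℕ} (l : Nat.Partition n) :
    ∑ j ∈ Finset.Icc 1 n, l.parts.count j * j = n := by
  conv_rhs => rw [← l.parts_sum]
  rw [Finset.sum_multiset_count]
  refine (Finset.sum_subset (fun j hj => ?_) fun j _ hj => ?_).symm
  · rw [Multiset.mem_toFinset] at hj
    rw [Finset.mem_Icc]
    exact ⟨l.parts_pos hj, partition_le l hj⟩
  · rw [Multiset.mem_toFinset] at hj
    rw [Multiset.count_eq_zero_of_notMem hj, zero_mul]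

/-- Deleting one part `j` is a bijection from the partitions of `n` containing `j` to the partitions
of `n - j`, and the weight `m_j` turns `1/m_j!` into `1/(m_j - 1)!`. This is `f_j ∂/∂f_j` acting on
the exponential. -/
theorem sum_count_mul_expWeight (n : ℕ) (f : ℕ → ℂ) {j : ℕ} (hj : j ∈ Finset.Icc 1 n) :
    ∑ l : Nat.Partition n, (l.parts.count j : ℂ) * expWeight n f l.parts =
      f j / (j ! : ℂ) * expTrace (n - j) f := by
  have hj' := Finset.mem_Icc.mp hj
  rw [expTrace, Finset.mul_sum,
    ← Finset.sum_filter_of_ne (p := fun l : Nat.Partition n => j ∈ l.parts)]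
  · refine Finset.sum_bij' (fun l hl => ⟨l.parts.erase j, fun {i} hi => l.parts_pos (Multiset.mem_of_mem_erase hi), ?_⟩)
      (fun m _ => ⟨j ::ₘ m.parts, fun {i} hi => ?_, ?_⟩) ?_ ?_ ?_ ?_ ?_
    · have h1 := Multiset.cons_erase (Finset.mem_filter.mp hl).2
      have h2 := l.parts_sum
      rw [← h1, Multiset.sum_cons] at h2
      omega
    · rcases Multiset.mem_cons.mp hi with rfl | h
      · exact hj'.1
      · exact m.parts_pos h
    · rw [Multiset.sum_cons, m.parts_sum]; omega
    · intro l hl; exact Finset.mem_univ _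
    · intro m _; simp
    · intro l hl
      apply Nat.Partition.ext
      exact Multiset.cons_erase (Finset.mem_filter.mp hl).2
    · intro m _
      apply Nat.Partition.ext
      exact Multiset.erase_cons_head _ _
    · intro l hl
      have h1 := Multiset.cons_erase (Finset.mem_filter.mp hl).2
      have h2 := expWeight_cons f (l.parts.erase j) hj
      rw [h1] at h2
      have h3 : (l.parts.erase j).count j + 1 = l.parts.count j := by
        conv_rhs => rw [← h1, Multiset.count_cons_self]
      rw [h3] at h2
      rw [h2]
      congr 1
      refine expWeight_of_le (Nat.sub_le _ _) f fun i hi => ?_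
      have h4 := l.parts_sum
      rw [← h1, Multiset.sum_cons] at h4
      have h5 := Multiset.single_le_sum (fun _ _ => Nat.zero_le _) i hi
      omega
  · intro l _ hne
    by_contra hmem
    rw [Multiset.count_eq_zero_of_notMem hmem] at hne
    simp at hne

/-- The coefficient form of `x (exp P)' = x P' exp P`, obtained from `n = ∑ j m_j`. -/
theorem expTrace_recursion (n : ℕ) (f : ℕ → ℂ) :
    (n : ℂ) * expTrace n f =
      ∑ j ∈ Finset.Icc 1 n, (j : ℂ) * (f j / (j ! : ℂ)) * expTrace (n - j) f := by
  calc (n : ℂ) * expTrace n f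
      = ∑ l : Nat.Partition n, ∑ j ∈ Finset.Icc 1 n,
          (j : ℂ) * ((l.parts.count j : ℂ) * expWeight n f l.parts) := by
        rw [expTrace, Finset.mul_sum]
        refine Finset.sum_congr rfl fun l _ => ?_
        have h := congrArg (Nat.cast : ℕ → ℂ) (sum_count_mul l)
        push_cast at h
        rw [← h, Finset.sum_mul]
        exact Finset.sum_congr rfl fun j _ => by ring
    _ = _ := by
        rw [Finset.sum_comm]
        refine Finset.sum_congr rfl fun j hj => ?_
        rw [← Finset.mul_sum, sum_count_mul_expWeight n f hj, mul_assoc]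

theorem expTrace_zero (f : ℕ → ℂ) : expTrace 0 f = 1 := by
  simp [expTrace, expWeight]

theorem expTrace_recursion_succ (n : ℕ) (f : ℕ → ℂ) :
    ((n + 1 : ℕ) : ℂ) * expTrace (n + 1) f =
      ∑ i ∈ Finset.range (n + 1), f (i + 1) / (i ! : ℂ) * expTrace (n - i) f := by
  rw [expTrace_recursion, ← Finset.Ico_add_one_right_eq_Icc, Finset.sum_Ico_eq_sum_range]
  refine Finset.sum_congr (by simp) fun i _ => ?_
  have h1 : ((i : ℂ) + 1) ≠ 0 := by exact_mod_cast Nat.succ_ne_zero i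
  have h2 : (i ! : ℂ) ≠ 0 := by exact_mod_cast Nat.factorial_ne_zero i
  rw [add_comm 1 i, Nat.factorial_succ, Nat.add_sub_add_right]
  push_cast
  field_simp

/-- The recursion is triangular: the trace at `n + 1` contains `f (n + 1)` linearly with nonzero
coefficient, and otherwise only values of smaller index. -/
theorem expTrace_injective {f g : ℕ → ℂ} (h : ∀ k, 1 ≤ k → expTrace k f = expTrace k g) :
    ∀ k, 1 ≤ k → f k = g k := by
  intro k
  induction k using Nat.strong_induction_on with
  | _ k ih =>
    intro hk
    obtain ⟨n, rfl⟩ : ∃ n, k = n + 1 := ⟨k - 1, by omega⟩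
    have hall : ∀ k, expTrace k f = expTrace k g := by
      intro k
      rcases Nat.eq_zero_or_pos k with rfl | hk
      · rw [expTrace_zero, expTrace_zero]
      · exact h k hk
    have h1 := expTrace_recursion_succ n f
    rw [hall, expTrace_recursion_succ n g, Finset.sum_range_succ, Finset.sum_range_succ] at h1
    have h2 : ∑ i ∈ Finset.range n, g (i + 1) / (i ! : ℂ) * expTrace (n - i) g =
        ∑ i ∈ Finset.range n, f (i + 1) / (i ! : ℂ) * expTrace (n - i) f := by
      refine Finset.sum_congr rfl fun i hi => ?_
      have := Finset.mem_range.mp hi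
      rw [ih (i + 1) (by omega) (by omega), hall]
    rw [h2, add_right_inj, Nat.sub_self, expTrace_zero, expTrace_zero, mul_one, mul_one] at h1
    have h3 : (n ! : ℂ) ≠ 0 := by exact_mod_cast Nat.factorial_ne_zero n
    field_simp at h1
    exact h1.symm

theorem phi_indiscrete {k : ℕ} (hk : 1 ≤ k) : phi (Nat.Partition.indiscrete k) = 2 / (k ! : ℂ) := by
  rw [phi, Nat.Partition.indiscrete_parts (by omega),
    Finset.prod_eq_single_of_mem k (by simp [hk]) ?_]
  · simp
  · intro j _ hj
    simp [hj]

theorem partProd_indiscrete {k : ℕ} (hk : 1 ≤ k) (f : ℕ → ℂ) :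
    partProd f (Nat.Partition.indiscrete k) = f k := by
  rw [partProd, Nat.Partition.indiscrete_parts (by omega),
    Finset.prod_eq_single_of_mem k (by simp [hk]) ?_]
  · simp
  · intro j _ hj
    simp [hj]

/-- The partition `(k)` contributes `2 û_k / k!` to `Tr_k(φ, û)`, exactly the term missing from the
sum in the recursion. -/
theorem expTrace_uHat {k : ℕ} (hk : 1 ≤ k) (τ w : ℂ) :
    expTrace k (fun j => 2 * uHat j τ w) =
      expTrace k (fun j => 2 * gammaHat j τ w) +
        2 * gHat 1 τ w * expTrace (k - 1) (fun j => -hHat j τ w) := by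
  rw [← partTrace_phi, ← partTrace_phi, ← partTrace_psi]
  have h1 : partTrace k phi (fun j => uHat j τ w) =
      2 / (k ! : ℂ) * uHat k τ w + ∑ l ∈ Finset.univ.erase (Nat.Partition.indiscrete k),
          phi l * partProd (fun j => uHat j τ w) l := by
    rw [partTrace, ← Finset.add_sum_erase _ _ (Finset.mem_univ (Nat.Partition.indiscrete k)),
      phi_indiscrete hk, partProd_indiscrete hk]
  have h3 : (k ! : ℂ) ≠ 0 := by exact_mod_cast Nat.factorial_ne_zero k
  rw [h1, uHat_eq k hk]
  field_simp
  ring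

/-! ### Calculus of exponential Taylor coefficients -/

theorem eventually_exp_log {F : ℂ → ℂ} (hF : ContinuousAt F 0) (h0 : F 0 ≠ 0) :
    ∀ᶠ z in nhds 0, F z / F 0 ∈ Complex.slitPlane := by
  have : ContinuousAt (fun z => F z / F 0) 0 := hF.div_const _
  refine this (Complex.isOpen_slitPlane.mem_nhds ?_)
  simp [div_self h0]

theorem analyticAt_log_div {F : ℂ → ℂ} (hF : AnalyticAt ℂ F 0) (h0 : F 0 ≠ 0) :
    AnalyticAt ℂ (fun z => Complex.log (F z / F 0)) 0 :=
  hF.div_const.clog (by simp [div_self h0])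

theorem expTaylorCoeff_congr {F H : ℂ → ℂ} (h : F =ᶠ[nhds 0] H) (k : ℕ) :
    expTaylorCoeff F k = expTaylorCoeff H k := by
  rw [expTaylorCoeff, expTaylorCoeff]
  congr 1
  refine Filter.EventuallyEq.iteratedDeriv_eq k ?_
  filter_upwards [h] with z hz
  rw [hz, h.eq_of_nhds]

theorem expTaylorCoeff_const_mul (F : ℂ → ℂ) {c : ℂ} (hc : c ≠ 0) (k : ℕ) :
    expTaylorCoeff (fun z => c * F z) k = expTaylorCoeff F k := by
  simp only [expTaylorCoeff, mul_div_mul_left _ _ hc]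

/-- Near `0` the difference `Q z - Q 0` has norm below `1 < π`, so the principal logarithm undoes
the exponential. The constant `Q 0` disappears since `k ≥ 1`. -/
theorem expTaylorCoeff_exp {Q : ℂ → ℂ} (hQ : ContinuousAt Q 0) {k : ℕ} (hk : 1 ≤ k) :
    expTaylorCoeff (fun z => Complex.exp (Q z)) k =
      iteratedDeriv k Q 0 / (2 * Real.pi * Complex.I) ^ k := by
  rw [expTaylorCoeff]
  congr 1
  have h1 : (fun z => Complex.log (Complex.exp (Q z) / Complex.exp (Q 0))) =ᶠ[nhds 0]
      fun z => -Q 0 + Q z := by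
    have h2 : ∀ᶠ z in nhds (0 : ℂ), Q z - Q 0 ∈ Metric.ball (0 : ℂ) 1 := by
      have : ContinuousAt (fun z => Q z - Q 0) 0 := hQ.sub continuousAt_const
      refine this (Metric.isOpen_ball.mem_nhds ?_)
      simp
    filter_upwards [h2] with z hz
    rw [← Complex.exp_sub, Complex.log_exp]
    · ring
    all_goals
      rw [mem_ball_zero_iff] at hz
      have h3 := (Complex.abs_im_le_norm (Q z - Q 0)).trans hz.le
      rw [abs_le] at h3
      linarith [Real.pi_gt_three]
  rw [h1.iteratedDeriv_eq k]
  obtain ⟨n, rfl⟩ : ∃ n, k = n + 1 := ⟨k - 1, by omega⟩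
  rw [iteratedDeriv_succ', iteratedDeriv_succ']
  congr 1
  ext z
  rw [deriv_const_add]

theorem expTaylorCoeff_mul {F H : ℂ → ℂ} (hF : AnalyticAt ℂ F 0) (hF0 : F 0 ≠ 0)
    (hH : AnalyticAt ℂ H 0) (hH0 : H 0 ≠ 0) {k : ℕ} (hk : 1 ≤ k) :
    expTaylorCoeff (fun z => F z * H z) k = expTaylorCoeff F k + expTaylorCoeff H k := by
  have hLF := analyticAt_log_div hF hF0
  have hLH := analyticAt_log_div hH hH0
  have h1 : (fun z => F z * H z) =ᶠ[nhds 0] fun z => (F 0 * H 0) *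
      Complex.exp (Complex.log (F z / F 0) + Complex.log (H z / H 0)) := by
    filter_upwards [eventually_exp_log hF.continuousAt hF0, eventually_exp_log hH.continuousAt hH0]
      with z hz1 hz2
    rw [Complex.exp_add, Complex.exp_log (Complex.slitPlane_ne_zero hz1),
      Complex.exp_log (Complex.slitPlane_ne_zero hz2)]
    field_simp
  rw [expTaylorCoeff_congr h1, expTaylorCoeff_const_mul _ (mul_ne_zero hF0 hH0),
    expTaylorCoeff_exp (Q := fun z => Complex.log (F z / F 0) + Complex.log (H z / H 0))
      (hLF.continuousAt.add hLH.continuousAt) hk, expTaylorCoeff, expTaylorCoeff, ← add_div]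
  congr 1
  exact iteratedDeriv_fun_add hLF.contDiffAt hLH.contDiffAt

theorem iteratedDeriv_comp_mul_left (f : ℂ → ℂ) (c : ℂ) (k : ℕ) :
    iteratedDeriv k (fun z => f (c * z)) = fun z => c ^ k * iteratedDeriv k f (c * z) := by
  induction k with
  | zero => simp
  | succ k ih =>
    ext z
    rw [iteratedDeriv_succ, ih, deriv_const_mul_field, deriv_comp_mul_left (f := iteratedDeriv k f), iteratedDeriv_succ,
      smul_eq_mul]
    ring

theorem expTaylorCoeff_comp_mul (F : ℂ → ℂ) (c : ℂ) (k : ℕ) :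
    expTaylorCoeff (fun z => F (c * z)) k = c ^ k * expTaylorCoeff F k := by
  rw [expTaylorCoeff, expTaylorCoeff, mul_zero,
    iteratedDeriv_comp_mul_left (fun z => Complex.log (F z / F 0))]
  simp only [mul_zero]
  rw [mul_div_assoc]

/-- The Taylor coefficients of `F / F 0` are the partition traces of the exponential Taylor coefficients. -/
theorem expTrace_expTaylorCoeff {F : ℂ → ℂ} (hF : AnalyticAt ℂ F 0) (h0 : F 0 ≠ 0) (n : ℕ) :
    expTrace n (expTaylorCoeff F) =
      iteratedDeriv n F 0 / (F 0 * n ! * (2 * Real.pi * Complex.I) ^ n) := by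
  set L : ℂ → ℂ := fun z => Complex.log (F z / F 0) with hL
  have hLa : AnalyticAt ℂ L 0 := analyticAt_log_div hF h0
  -- Leibniz' rule applied to `F' = L' F` gives the same recursion as `expTrace_recursion_succ`.
  have hd : deriv F =ᶠ[nhds 0] deriv L * F := by
    filter_upwards [eventually_exp_log hF.continuousAt h0, hF.eventually_analyticAt] with z hz hzF
    have h1 : deriv L z = (deriv F z / F 0) / (F z / F 0) :=
      ((hzF.differentiableAt.hasDerivAt.div_const (F 0)).clog hz).deriv
    have h2 : F z ≠ 0 := by
      intro h
      apply Complex.slitPlane_ne_zero hz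
      rw [h, zero_div]
    rw [Pi.mul_apply, h1]
    field_simp
  have hrec : ∀ n, iteratedDeriv (n + 1) F 0 = ∑ i ∈ Finset.range (n + 1),
      (n.choose i : ℂ) * iteratedDeriv (i + 1) L 0 * iteratedDeriv (n - i) F 0 := by
    intro n
    rw [iteratedDeriv_succ', hd.iteratedDeriv_eq, iteratedDeriv_mul hLa.deriv.contDiffAt hF.contDiffAt]
    simp only [iteratedDeriv_succ']
  have hpi : (2 * Real.pi * Complex.I : ℂ) ≠ 0 := Complex.two_pi_I_ne_zero
  induction n using Nat.strong_induction_on with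
  | _ n ih =>
    rcases n with _ | n
    · simp [expTrace_zero, h0]
    · have h1 := expTrace_recursion_succ n (expTaylorCoeff F)
      have hn : ((n + 1 : ℕ) : ℂ) ≠ 0 := by exact_mod_cast Nat.succ_ne_zero n
      apply mul_left_cancel₀ hn
      rw [h1, hrec, Finset.sum_div, Finset.mul_sum]
      refine Finset.sum_congr rfl fun i hi => ?_
      have hi' : i ≤ n := by have := Finset.mem_range.mp hi; omega
      rw [ih (n - i) (by omega), expTaylorCoeff]
      have h2 : (n.choose i : ℂ) * (i ! : ℂ) * ((n - i)! : ℂ) = (n ! : ℂ) := by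
        exact_mod_cast Nat.choose_mul_factorial_mul_factorial hi'
      have h3 : (i ! : ℂ) ≠ 0 := by exact_mod_cast Nat.factorial_ne_zero i
      have h4 : ((n - i)! : ℂ) ≠ 0 := by exact_mod_cast Nat.factorial_ne_zero _
      have h5 : (n ! : ℂ) ≠ 0 := by exact_mod_cast Nat.factorial_ne_zero _
      have h6 : (2 * Real.pi * Complex.I : ℂ) ^ (n + 1) =
          (2 * Real.pi * Complex.I) ^ (i + 1) * (2 * Real.pi * Complex.I) ^ (n - i) := by
        rw [← pow_add]; congr 1; omega
      rw [h6, Nat.factorial_succ, Nat.cast_mul]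
      have h7 : (n.choose i : ℂ) = (n ! : ℂ) / ((i ! : ℂ) * ((n - i)! : ℂ)) := by
        rw [← h2]; field_simp
      rw [h7]
      field_simp
      exact mul_comm _ _

/-! ### Infinite products -/

/-- `∏_{k ≥ 0} (1 - x q ^ k)`. -/
def poch (q x : ℂ) : ℂ := ∏' k : ℕ, (1 - x * q ^ k)

section Poch

variable {q : ℂ}

theorem summable_norm_mul_pow (hq : ‖q‖ < 1) (x : ℂ) : Summable fun k : ℕ => ‖-(x * q ^ k)‖ := by
  simp only [norm_neg, norm_mul, norm_pow]
  exact (summable_geometric_of_lt_one (norm_nonneg _) hq).mul_left _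

theorem multipliable_poch (hq : ‖q‖ < 1) (x : ℂ) : Multipliable fun k : ℕ => (1 - x * q ^ k) := by
  simpa only [sub_eq_add_neg] using multipliable_one_add_of_summable (summable_norm_mul_pow hq x)

theorem poch_eq_mul (hq : ‖q‖ < 1) (x : ℂ) : poch q x = (1 - x) * poch q (x * q) := by
  have h : Multipliable fun k : ℕ => (1 - x * q ^ (k + 1)) := by
    simpa only [pow_succ', mul_assoc] using multipliable_poch hq (x * q)
  have h2 := tprod_eq_zero_mul' (f := fun k : ℕ => (1 - x * q ^ k)) h
  rw [poch, h2, pow_zero, mul_one, poch]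
  congr 1
  exact tprod_congr fun k => by rw [pow_succ', mul_assoc]

theorem poch_ne_zero (hq : ‖q‖ < 1) {x : ℂ} (hx : ∀ k : ℕ, x * q ^ k ≠ 1) : poch q x ≠ 0 := by
  have := tprod_one_add_ne_zero_of_summable (f := fun k : ℕ => -(x * q ^ k))
    (fun k => by rw [← sub_eq_add_neg, sub_ne_zero]; exact (hx k).symm) (summable_norm_mul_pow hq x)
  simpa only [poch, sub_eq_add_neg] using this

/-- Passes to the limit in `|∏ (1 + u_k) - 1| ≤ exp (∑ |u_k|) - 1`, summing a geometric series. -/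
theorem norm_poch_sub_one_le (hq : ‖q‖ < 1) (x : ℂ) :
    ‖poch q x - 1‖ ≤ Real.exp (‖x‖ / (1 - ‖q‖)) - 1 := by
  have h1 := (multipliable_poch hq x).hasProd.tendsto_prod_nat
  have h2 := ((h1.sub_const 1).norm)
  refine le_of_tendsto h2 (Filter.Eventually.of_forall fun n => ?_)
  have h3 := Finset.norm_prod_one_add_sub_one_le (Finset.range n) (fun k : ℕ => -(x * q ^ k))
  simp only [← sub_eq_add_neg] at h3
  refine h3.trans ?_
  gcongr
  have h4 : ∑ i ∈ Finset.range n, ‖-(x * q ^ i)‖ ≤ ∑' i : ℕ, ‖-(x * q ^ i)‖ :=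
    (summable_norm_mul_pow hq x).sum_le_tsum _ (fun _ _ => norm_nonneg _)
  refine h4.trans (le_of_eq ?_)
  simp only [norm_neg, norm_mul, norm_pow]
  rw [tsum_mul_left, tsum_geometric_of_lt_one (norm_nonneg _) hq, div_eq_mul_inv]

theorem norm_poch_le (hq : ‖q‖ < 1) (x : ℂ) : ‖poch q x‖ ≤ Real.exp (‖x‖ / (1 - ‖q‖)) := by
  have h1 := norm_poch_sub_one_le hq x
  have h2 : ‖poch q x‖ ≤ ‖poch q x - 1‖ + ‖(1 : ℂ)‖ := by
    simpa using norm_add_le (poch q x - 1) 1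
  rw [norm_one] at h2
  linarith

theorem tendsto_poch_one (hq : ‖q‖ < 1) {u : ℕ → ℂ} (hu : Filter.Tendsto u Filter.atTop (nhds 0)) :
    Filter.Tendsto (fun n => poch q (u n)) Filter.atTop (nhds 1) := by
  rw [tendsto_iff_norm_sub_tendsto_zero]
  have h : Filter.Tendsto (fun n => Real.exp (‖u n‖ / (1 - ‖q‖)) - 1) Filter.atTop (nhds 0) := by
    have h1 := ((Real.continuous_exp.tendsto _).comp ((hu.norm).div_const (1 - ‖q‖))).sub_const 1
    simpa using h1
  exact squeeze_zero (fun _ => norm_nonneg _) (fun n => norm_poch_sub_one_le hq _) h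

theorem tendsto_mul_pow_zero (hq : ‖q‖ < 1) (x : ℂ) (m : ℕ) :
    Filter.Tendsto (fun n : ℕ => x * q ^ (n + m)) Filter.atTop (nhds 0) := by
  have h1 := (Filter.tendsto_add_atTop_iff_nat m).mpr
    (tendsto_pow_atTop_nhds_zero_of_norm_lt_one hq)
  simpa using h1.const_mul x

/-- `(a q; q)_∞ (a⁻¹; q)_∞`. -/
def thetaProd (q a : ℂ) : ℂ := poch q (a * q) * poch q a⁻¹

/-- The shift `a ↦ a q` removes the factor `1 - a q` from the first product and adds `1 - (a q)⁻¹`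
to the second. -/
theorem thetaProd_mul (hq : ‖q‖ < 1) (hq0 : q ≠ 0) {a : ℂ} (ha : a ≠ 0) :
    a * q * thetaProd q (a * q) = -thetaProd q a := by
  rw [thetaProd, thetaProd, poch_eq_mul hq (a * q), poch_eq_mul hq (a * q)⁻¹]
  have h1 : (a * q)⁻¹ * q = a⁻¹ := by field_simp
  rw [h1]
  field_simp
  ring

/-! ### Triangular numbers -/

/-- The triangular number `n (n + 1) / 2`. -/
def tri (n : ℕ) : ℕ := n * (n + 1) / 2

theorem two_mul_tri (n : ℕ) : 2 * tri n = n * (n + 1) :=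
  Nat.mul_div_cancel' (Nat.even_mul_succ_self n).two_dvd

theorem tri_succ (n : ℕ) : tri (n + 1) = tri n + (n + 1) := by
  have h1 := two_mul_tri n
  have h2 := two_mul_tri (n + 1)
  nlinarith

theorem thetaProd_mul_pow (hq : ‖q‖ < 1) (hq0 : q ≠ 0) {a : ℂ} (ha : a ≠ 0) (n : ℕ) :
    a ^ n * q ^ tri n * thetaProd q (a * q ^ n) = (-1) ^ n * thetaProd q a := by
  induction n with
  | zero => simp [tri]
  | succ n ih =>
    have h := thetaProd_mul hq hq0 (a := a * q ^ n) (mul_ne_zero ha (pow_ne_zero _ hq0))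
    have h2 : a * q ^ (n + 1) = a * q ^ n * q := by ring
    rw [h2, tri_succ]
    calc a ^ (n + 1) * q ^ (tri n + (n + 1)) * thetaProd q (a * q ^ n * q)
        = a ^ n * q ^ tri n * (a * q ^ n * q * thetaProd q (a * q ^ n * q)) := by ring
      _ = -(a ^ n * q ^ tri n * thetaProd q (a * q ^ n)) := by rw [h]; ring
      _ = _ := by rw [ih]; ring

/-! ### A functional equation for `∑ q ^ n (a q ^ (n + 1))_∞ (q ^ (n + 1) / a)_∞` -/

/-- `∑_n q ^ n (a q ^ (n + 1); q)_∞ (q ^ (n + 1) / a; q)_∞`. -/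
def rankSeries (q a : ℂ) : ℂ :=
  ∑' n : ℕ, q ^ n * (poch q (a * q ^ (n + 1)) * poch q (a⁻¹ * q ^ (n + 1)))

theorem norm_mul_pow_le (hq : ‖q‖ < 1) (a : ℂ) (n : ℕ) : ‖a * q ^ n‖ ≤ ‖a‖ := by
  rw [norm_mul, norm_pow]
  exact mul_le_of_le_one_right (norm_nonneg _) (pow_le_one₀ (norm_nonneg _) hq.le)

theorem norm_poch_mul_pow_le (hq : ‖q‖ < 1) (a : ℂ) (n : ℕ) :
    ‖poch q (a * q ^ n)‖ ≤ Real.exp (‖a‖ / (1 - ‖q‖)) := by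
  refine (norm_poch_le hq _).trans ?_
  have : 0 < 1 - ‖q‖ := by linarith
  gcongr
  exact norm_mul_pow_le hq a n

theorem summable_pow_mul_poch (hq : ‖q‖ < 1) (a b : ℂ) (i j m : ℕ) :
    Summable fun n : ℕ => q ^ (n * (m + 1)) * (poch q (a * q ^ (n + i)) * poch q (b * q ^ (n + j))) := by
  refine Summable.of_norm_bounded (g := fun n : ℕ => ‖q‖ ^ n *
    (Real.exp (‖a‖ / (1 - ‖q‖)) * Real.exp (‖b‖ / (1 - ‖q‖))))
    ((summable_geometric_of_lt_one (norm_nonneg _) hq).mul_right _) fun n => ?_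
  rw [norm_mul, norm_mul, norm_pow]
  gcongr ?_ * (?_ * ?_)
  · exact pow_le_pow_of_le_one (norm_nonneg _) hq.le (Nat.le_mul_of_pos_right _ (Nat.succ_pos _))
  · exact norm_poch_mul_pow_le hq a _
  · exact norm_poch_mul_pow_le hq b _

/-- Three linear relations in two unknown sums `S₁ = ∑ q^n M_n` and `S₂ = ∑ q^(2n) M_n`: the series
at `a` is `S₁ - a q S₂`, the series at `a q` is `S₁ - a⁻¹ S₂`, and a telescoping sum gives `1 -
thetaProd q a = (a q + a⁻¹) S₁ - q S₂`. Eliminating `S₁` and `S₂` leaves the equation. -/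
theorem rankSeries_functional (hq : ‖q‖ < 1) (hq0 : q ≠ 0) {a : ℂ} (ha : a ≠ 0) :
    rankSeries q a = a ^ 4 * q ^ 2 * rankSeries q (a * q) +
      (a - a ^ 3 * q) * (1 - thetaProd q a) := by
  set M : ℕ → ℂ := fun n => poch q (a * q ^ (n + 2)) * poch q (a⁻¹ * q ^ (n + 1)) with hM
  have hs1 : Summable fun n => q ^ n * M n := by
    simpa using summable_pow_mul_poch hq a a⁻¹ 2 1 0
  have hs2 : Summable fun n => q ^ (n * 2) * M n := by
    simpa using summable_pow_mul_poch hq a a⁻¹ 2 1 1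
  have hA : ∀ n, poch q (a * q ^ (n + 1)) = (1 - a * q ^ (n + 1)) * poch q (a * q ^ (n + 2)) := by
    intro n
    rw [poch_eq_mul hq, mul_assoc, ← pow_succ]
  have hB : ∀ n, poch q (a⁻¹ * q ^ n) = (1 - a⁻¹ * q ^ n) * poch q (a⁻¹ * q ^ (n + 1)) := by
    intro n
    rw [poch_eq_mul hq, mul_assoc, ← pow_succ]
  have e1 : rankSeries q a = ∑' n, q ^ n * M n - a * q * ∑' n, q ^ (n * 2) * M n := by
    rw [rankSeries, ← tsum_mul_left, ← hs1.tsum_sub (hs2.mul_left _)]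
    refine tsum_congr fun n => ?_
    rw [hA]; simp only [hM]; ring
  have e2 : rankSeries q (a * q) = ∑' n, q ^ n * M n - a⁻¹ * ∑' n, q ^ (n * 2) * M n := by
    rw [rankSeries, ← tsum_mul_left, ← hs1.tsum_sub (hs2.mul_left _)]
    refine tsum_congr fun n => ?_
    have h1 : a * q * q ^ (n + 1) = a * q ^ (n + 2) := by ring
    have h2 : (a * q)⁻¹ * q ^ (n + 1) = a⁻¹ * q ^ n := by
      rw [mul_inv, pow_succ]; field_simp
    rw [h1, h2, hB]; simp only [hM]; ring
  have e3 : 1 - thetaProd q a =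
      (a * q + a⁻¹) * ∑' n, q ^ n * M n - q * ∑' n, q ^ (n * 2) * M n := by
    -- The telescoping sequence: it starts at `thetaProd q a` and tends to `1`.
    set W : ℕ → ℂ := fun n => poch q (a * q ^ (n + 1)) * poch q (a⁻¹ * q ^ n) with hW
    have h1 : ∀ n, W (n + 1) - W n = (a * q + a⁻¹) * (q ^ n * M n) - q * (q ^ (n * 2) * M n) := by
      intro n
      simp only [hW]
      rw [hA n, hB n]; simp only [hM]
      have : a⁻¹ * a = 1 := inv_mul_cancel₀ ha
      linear_combination (-(q ^ (2 * n + 1)) * (poch q (a * q ^ (n + 2)) * poch q (a⁻¹ * q ^ (n + 1)))) * this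
    have h2 : Summable fun n => W (n + 1) - W n := by
      simp only [h1]
      exact (hs1.mul_left _).sub (hs2.mul_left _)
    have h3 := h2.hasSum.tendsto_sum_nat
    simp only [Finset.sum_range_sub] at h3
    have h4 : Filter.Tendsto (fun n => W n - W 0) Filter.atTop (nhds (1 * 1 - W 0)) := by
      refine Filter.Tendsto.sub_const (Filter.Tendsto.mul ?_ ?_) _
      · exact tendsto_poch_one hq (tendsto_mul_pow_zero hq a 1)
      · exact tendsto_poch_one hq (tendsto_mul_pow_zero hq a⁻¹ 0)
    have h5 := tendsto_nhds_unique h4 h3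
    rw [← tsum_mul_left, ← tsum_mul_left, ← (hs1.mul_left _).tsum_sub (hs2.mul_left _)]
    rw [← tsum_congr h1, ← h5]
    simp [hW, thetaProd]
  rw [e1, e2, e3]
  field_simp
  ring

theorem rankSeries_iterate (hq : ‖q‖ < 1) (hq0 : q ≠ 0) {a : ℂ} (ha : a ≠ 0) (N : ℕ) :
    rankSeries q a = ∑ n ∈ Finset.range N, (a ^ (4 * n) * q ^ (2 * n ^ 2)) *
      ((a * q ^ n - (a * q ^ n) ^ 3 * q) * (1 - thetaProd q (a * q ^ n))) +
      a ^ (4 * N) * q ^ (2 * N ^ 2) * rankSeries q (a * q ^ N) := by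
  induction N with
  | zero => simp
  | succ N ih =>
    rw [Finset.sum_range_succ, ih, rankSeries_functional hq hq0 (a := a * q ^ N)
      (mul_ne_zero ha (pow_ne_zero _ hq0))]
    have h2 : a * q ^ (N + 1) = a * q ^ N * q := by ring
    rw [h2]
    ring

/-- A bound for `(q ^ (n + 1) / (a q ^ N); q)_∞`. -/
theorem norm_poch_inv_le (hq : ‖q‖ < 1) (hq0 : q ≠ 0) {a : ℂ} (ha : a ≠ 0) (N n : ℕ) :
    ‖poch q ((a * q ^ N)⁻¹ * q ^ (n + 1))‖ ≤
      Real.exp (‖a⁻¹‖ / (1 - ‖q‖)) * ∏ j ∈ Finset.range N, (1 + ‖a⁻¹‖ / ‖q‖ ^ j) := by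
  induction N generalizing n with
  | zero => simpa using norm_poch_mul_pow_le hq a⁻¹ (n + 1)
  | succ N ih =>
    have hstep : (a * q ^ (N + 1))⁻¹ * q ^ (n + 1) = (a * q ^ N)⁻¹ * q ^ n := by
      rw [pow_succ, pow_succ]; field_simp
    have hpos : 0 ≤ ∏ j ∈ Finset.range N, (1 + ‖a⁻¹‖ / ‖q‖ ^ j) :=
      Finset.prod_nonneg fun j _ => by positivity
    have hfac : 1 ≤ 1 + ‖a⁻¹‖ / ‖q‖ ^ N := by
      have : 0 ≤ ‖a⁻¹‖ / ‖q‖ ^ N := by positivity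
      linarith
    rw [hstep, Finset.prod_range_succ, ← mul_assoc]
    rcases n with _ | n
    · have h1 : (a * q ^ N)⁻¹ * q ^ 0 = (a * q ^ N)⁻¹ := by simp
      have h2 := ih 0
      rw [zero_add, pow_one] at h2
      rw [h1, poch_eq_mul hq, norm_mul, mul_comm]
      refine mul_le_mul h2 ?_ (norm_nonneg _) (by positivity)
      refine (norm_sub_le _ _).trans (le_of_eq ?_)
      rw [norm_one, norm_inv, norm_mul, norm_pow, norm_inv]
      field_simp
    · exact (ih n).trans (le_mul_of_one_le_right (by positivity) hfac)

/-- The factors with `(a q^N)⁻¹` let the series grow at most like `∏_{j<N} (1 + |a⁻¹|/|q|^j)`,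
roughly `|q|^(-N²/2)`. The prefactor `q^(2N²)` dominates this, as the ratio test shows. -/
theorem tendsto_rankSeries_remainder (hq : ‖q‖ < 1) (hq0 : q ≠ 0) {a : ℂ} (ha : a ≠ 0) :
    Filter.Tendsto (fun N : ℕ => a ^ (4 * N) * q ^ (2 * N ^ 2) * rankSeries q (a * q ^ N))
      Filter.atTop (nhds 0) := by
  have hqn : 0 < ‖q‖ := norm_pos_iff.mpr hq0
  have han : 0 < ‖a‖ := norm_pos_iff.mpr ha
  set R : ℕ → ℝ := fun N => ‖a‖ ^ (4 * N) * ‖q‖ ^ (2 * N ^ 2) *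
    ∏ j ∈ Finset.range N, (1 + ‖a⁻¹‖ / ‖q‖ ^ j) with hR
  have hRpos : ∀ N, 0 < R N := fun N => by
    have : 0 < ∏ j ∈ Finset.range N, (1 + ‖a⁻¹‖ / ‖q‖ ^ j) :=
      Finset.prod_pos fun j _ => by positivity
    positivity
  have hRlim : Filter.Tendsto R Filter.atTop (nhds 0) := by
    refine Summable.tendsto_atTop_zero (summable_of_ratio_test_tendsto_lt_one (l := 0) one_pos
      (Filter.Eventually.of_forall fun N => (hRpos N).ne') ?_)
    have hratio : ∀ N, ‖R (N + 1)‖ / ‖R N‖ =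
        ‖a‖ ^ 4 * ‖q‖ ^ 2 * ((‖q‖ ^ N) ^ 3 * (‖q‖ ^ N + ‖a⁻¹‖)) := by
      intro N
      rw [Real.norm_of_nonneg (hRpos _).le, Real.norm_of_nonneg (hRpos _).le,
        div_eq_iff (hRpos N).ne']
      simp only [hR, Finset.prod_range_succ]
      field_simp
      ring
    simp only [hratio]
    have h1 : Filter.Tendsto (fun N => ‖q‖ ^ N) Filter.atTop (nhds 0) :=
      tendsto_pow_atTop_nhds_zero_of_lt_one hqn.le hq
    have h2 := (((h1.pow 3).mul (h1.add_const ‖a⁻¹‖))).const_mul (‖a‖ ^ 4 * ‖q‖ ^ 2)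
    simpa using h2
  set K : ℝ := Real.exp (‖a‖ / (1 - ‖q‖)) * Real.exp (‖a⁻¹‖ / (1 - ‖q‖)) * (1 - ‖q‖)⁻¹ with hK
  refine squeeze_zero_norm (a := fun N => K * R N) (fun N => ?_) (by simpa using hRlim.const_mul K)
  have hbound : ‖rankSeries q (a * q ^ N)‖ ≤
      K * ∏ j ∈ Finset.range N, (1 + ‖a⁻¹‖ / ‖q‖ ^ j) := by
    have hg := ((hasSum_geometric_of_lt_one hqn.le hq).mul_right
      (Real.exp (‖a‖ / (1 - ‖q‖)) * (Real.exp (‖a⁻¹‖ / (1 - ‖q‖)) *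
        ∏ j ∈ Finset.range N, (1 + ‖a⁻¹‖ / ‖q‖ ^ j))))
    refine (tsum_of_norm_bounded hg fun n => ?_).trans (le_of_eq ?_)
    · rw [norm_mul, norm_mul, norm_pow]
      gcongr ?_ * (?_ * ?_)
      · have h1 : a * q ^ N * q ^ (n + 1) = a * q ^ (N + n + 1) := by ring
        rw [h1]
        exact norm_poch_mul_pow_le hq a _
      · exact norm_poch_inv_le hq hq0 ha N n
    · rw [hK]; ring
  rw [norm_mul, norm_mul, norm_pow, norm_pow]
  calc ‖a‖ ^ (4 * N) * ‖q‖ ^ (2 * N ^ 2) * ‖rankSeries q (a * q ^ N)‖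
      ≤ ‖a‖ ^ (4 * N) * ‖q‖ ^ (2 * N ^ 2) * (K * ∏ j ∈ Finset.range N, (1 + ‖a⁻¹‖ / ‖q‖ ^ j)) := by
        gcongr
    _ = K * R N := by rw [hR]; ring

theorem summable_pow_mul_pow_tri (hq : ‖q‖ < 1) (hq0 : q ≠ 0) (b : ℂ) :
    Summable fun n : ℕ => b ^ n * q ^ tri n := by
  rcases eq_or_ne b 0 with rfl | hb
  · refine summable_of_ne_finset_zero (s := {0}) fun n hn => ?_
    rw [Finset.mem_singleton] at hn
    rw [zero_pow hn, zero_mul]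
  refine summable_of_ratio_test_tendsto_lt_one (l := 0) one_pos
    (Filter.Eventually.of_forall fun n => mul_ne_zero (pow_ne_zero _ hb) (pow_ne_zero _ hq0)) ?_
  have : ∀ n : ℕ, ‖b ^ (n + 1) * q ^ tri (n + 1)‖ / ‖b ^ n * q ^ tri n‖ = ‖b * q ^ (n + 1)‖ := by
    intro n
    rw [← norm_div, tri_succ]
    congr 1
    field_simp
    ring
  simp only [this]
  simpa using (tendsto_mul_pow_zero hq b 1).norm

theorem tri_two_mul (n : ℕ) : tri (2 * n) = 2 * n ^ 2 + n := by
  have := two_mul_tri (2 * n); nlinarith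

theorem tri_two_mul_add_one (n : ℕ) : tri (2 * n + 1) = 2 * n ^ 2 + 3 * n + 1 := by
  have := two_mul_tri (2 * n + 1); nlinarith

theorem summable_rank_first (hq : ‖q‖ < 1) (hq0 : q ≠ 0) (a : ℂ) :
    Summable fun n : ℕ => (-1 : ℂ) ^ n * a ^ (3 * n) * q ^ (n ^ 2 + tri n) *
      (1 - a ^ 2 * q ^ (2 * n + 1)) := by
  have hb : ∀ n : ℕ, ‖(-1 : ℂ) ^ n * a ^ (3 * n) * q ^ (n ^ 2 + tri n) * (1 - a ^ 2 * q ^ (2 * n + 1))‖ ≤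
      ‖(a ^ 3) ^ n * q ^ tri n‖ * (1 + ‖a ^ 2‖) := by
    intro n
    rw [pow_add, pow_mul]
    have h1 : (-1 : ℂ) ^ n * (a ^ 3) ^ n * (q ^ n ^ 2 * q ^ tri n) * (1 - a ^ 2 * q ^ (2 * n + 1)) =
        ((a ^ 3) ^ n * q ^ tri n) * ((-1) ^ n * q ^ n ^ 2 * (1 - a ^ 2 * q ^ (2 * n + 1))) := by ring
    rw [h1, norm_mul]
    gcongr
    rw [norm_mul, norm_mul, norm_pow, norm_pow, norm_neg, norm_one, one_pow, one_mul]
    have h2 : ‖q‖ ^ n ^ 2 ≤ 1 := pow_le_one₀ (norm_nonneg _) hq.le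
    have h3 : ‖1 - a ^ 2 * q ^ (2 * n + 1)‖ ≤ 1 + ‖a ^ 2‖ := by
      refine (norm_sub_le _ _).trans ?_
      rw [norm_one]
      gcongr
      exact norm_mul_pow_le hq _ _
    calc ‖q‖ ^ n ^ 2 * ‖1 - a ^ 2 * q ^ (2 * n + 1)‖ ≤ 1 * (1 + ‖a ^ 2‖) := by gcongr
      _ = _ := one_mul _
  exact Summable.of_norm_bounded
    ((summable_pow_mul_pow_tri hq hq0 (a ^ 3)).norm.mul_right _) hb

theorem summable_rank_second (hq : ‖q‖ < 1) (hq0 : q ≠ 0) (a : ℂ) :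
    Summable fun n : ℕ => (-1 : ℂ) ^ n * a ^ (2 * n + 1) * q ^ tri n := by
  have := (summable_pow_mul_pow_tri hq hq0 (-a ^ 2)).mul_left a
  refine this.congr fun n => ?_
  rw [neg_pow, ← pow_mul]; ring

/-- The rank series as a combination of a partial and a false theta function. -/
theorem rankSeries_eq (hq : ‖q‖ < 1) (hq0 : q ≠ 0) {a : ℂ} (ha : a ≠ 0) :
    rankSeries q a =
      -(a * thetaProd q a) * ∑' n : ℕ, (-1 : ℂ) ^ n * a ^ (3 * n) * q ^ (n ^ 2 + tri n) *
        (1 - a ^ 2 * q ^ (2 * n + 1)) +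
      ∑' n : ℕ, (-1 : ℂ) ^ n * a ^ (2 * n + 1) * q ^ tri n := by
  have hs1 := summable_rank_first hq hq0 a
  have hs2 := summable_rank_second hq hq0 a
  set t : ℕ → ℂ := fun m => (-1 : ℂ) ^ m * a ^ (2 * m + 1) * q ^ tri m with ht
  have hpair : HasSum (fun n => t (2 * n) + t (2 * n + 1)) (∑' n, t n) := by
    have he : Summable fun n => t (2 * n) :=
      hs2.comp_injective (mul_right_injective₀ (two_ne_zero' ℕ))
    have ho : Summable fun n => t (2 * n + 1) :=
      hs2.comp_injective ((add_left_injective 1).comp (mul_right_injective₀ (two_ne_zero' ℕ)))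
    rw [← tsum_even_add_odd he ho]
    exact he.hasSum.add ho.hasSum
  -- By `thetaProd_mul_pow` the product at `a q^n` is a monomial times the product at `a`. Each
  -- summand of the iteration thus splits into `a * thetaProd q a` times a term of the first series
  -- and two consecutive terms of the second.
  have hterm : ∀ n : ℕ, (a ^ (4 * n) * q ^ (2 * n ^ 2)) *
      ((a * q ^ n - (a * q ^ n) ^ 3 * q) * (1 - thetaProd q (a * q ^ n))) =
      -(a * thetaProd q a) * ((-1 : ℂ) ^ n * a ^ (3 * n) * q ^ (n ^ 2 + tri n) *
        (1 - a ^ 2 * q ^ (2 * n + 1))) + (t (2 * n) + t (2 * n + 1)) := by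
    intro n
    have h1 := thetaProd_mul_pow hq hq0 ha n
    have h2 : q ^ (2 * n ^ 2) * q ^ n = q ^ (n ^ 2 + tri n) * q ^ tri n := by
      rw [← pow_add, ← pow_add]
      congr 1
      have := two_mul_tri n
      nlinarith
    simp only [ht, tri_two_mul, tri_two_mul_add_one]
    have h3 : a ^ (4 * n) = a ^ (3 * n) * a ^ n := by rw [← pow_add]; congr 1; omega
    have h4 : ((-1 : ℂ) ^ (2 * n)) = 1 := by rw [pow_mul]; simp
    rw [pow_succ (-1 : ℂ), h4]
    have h5 : a ^ (4 * n) * q ^ (2 * n ^ 2) *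
        ((a * q ^ n - (a * q ^ n) ^ 3 * q) * (1 - thetaProd q (a * q ^ n))) =
        a ^ (4 * n) * q ^ (2 * n ^ 2) * (a * q ^ n - (a * q ^ n) ^ 3 * q) -
        a * (1 - a ^ 2 * q ^ (2 * n + 1)) * a ^ (4 * n) * (q ^ (2 * n ^ 2) * q ^ n) *
          thetaProd q (a * q ^ n) := by ring
    rw [h5, h2, h3]
    have h6 : a * (1 - a ^ 2 * q ^ (2 * n + 1)) * (a ^ (3 * n) * a ^ n) *
        (q ^ (n ^ 2 + tri n) * q ^ tri n) * thetaProd q (a * q ^ n) =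
        a * (1 - a ^ 2 * q ^ (2 * n + 1)) * a ^ (3 * n) * q ^ (n ^ 2 + tri n) *
          ((-1) ^ n * thetaProd q a) := by rw [← h1]; ring
    rw [h6]
    ring
  have hsum := ((hs1.hasSum.mul_left (-(a * thetaProd q a))).add hpair).tendsto_sum_nat
  have hlim := hsum.add (tendsto_rankSeries_remainder hq hq0 ha)
  rw [add_zero] at hlim
  refine tendsto_nhds_unique (tendsto_const_nhds (x := rankSeries q a)) (hlim.congr fun N => ?_)
  rw [rankSeries_iterate hq hq0 ha N]
  congr 1
  exact Finset.sum_congr rfl fun n _ => (hterm n).symm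

end Poch

/-! ### The Jacobi triple product -/

/-- `(q; q)_n`. -/
def qFactorial (q : ℂ) (n : ℕ) : ℂ := ∏ j ∈ Finset.range n, (1 - q ^ (j + 1))

/-- `1 / (q; q)_m`, extended by zero to negative `m`. -/
def qFactorialInv (q : ℂ) (m : ℤ) : ℂ := if m < 0 then 0 else (qFactorial q m.toNat)⁻¹

section Triple

variable {q : ℂ}

theorem one_sub_pow_ne_zero (hq : ‖q‖ < 1) (n : ℕ) : 1 - q ^ (n + 1) ≠ 0 := by
  rw [sub_ne_zero]
  intro h
  have h1 : ‖q ^ (n + 1)‖ < 1 := by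
    rw [norm_pow]; exact pow_lt_one₀ (norm_nonneg _) hq (Nat.succ_ne_zero _)
  rw [← h, norm_one] at h1
  exact lt_irrefl _ h1

theorem qFactorial_ne_zero (hq : ‖q‖ < 1) (n : ℕ) : qFactorial q n ≠ 0 :=
  Finset.prod_ne_zero_iff.mpr fun j _ => one_sub_pow_ne_zero hq j

/-- With the extension by zero this holds for all integers; at `m = 0` both sides vanish.
Recurrences in the summation index thus need no boundary cases. -/
theorem qFactorialInv_sub_one (hq : ‖q‖ < 1) (m : ℤ) :
    qFactorialInv q (m - 1) = (1 - q ^ m) * qFactorialInv q m := by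
  rcases lt_trichotomy m 0 with h | rfl | h
  · simp [qFactorialInv, h, show m - 1 < 0 by omega]
  · simp [qFactorialInv]
  · obtain ⟨n, rfl⟩ : ∃ n : ℕ, m = n + 1 := ⟨(m - 1).toNat, by omega⟩
    have h1 := one_sub_pow_ne_zero hq n
    have h2 := qFactorial_ne_zero hq n
    have e1 : qFactorialInv q ((n : ℤ) + 1 - 1) = (qFactorial q n)⁻¹ := by
      simp [qFactorialInv]
    have e2 : qFactorialInv q ((n : ℤ) + 1) = (qFactorial q (n + 1))⁻¹ := by
      have : ¬ ((n : ℤ) + 1 < 0) := by omega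
      rw [qFactorialInv, if_neg this]; rfl
    have e3 : q ^ ((n : ℤ) + 1) = q ^ (n + 1) := by exact_mod_cast zpow_natCast q (n + 1)
    have e4 : qFactorial q (n + 1) = qFactorial q n * (1 - q ^ (n + 1)) := Finset.prod_range_succ _ _
    rw [e1, e2, e3, e4]
    field_simp

/-- The triangular number `k (k + 1) / 2` of an integer. -/
def triInt (k : ℤ) : ℤ := k * (k + 1) / 2

theorem two_mul_triInt (k : ℤ) : 2 * triInt k = k * (k + 1) :=
  Int.mul_ediv_cancel' (Int.even_mul_succ_self k).two_dvd

theorem triInt_sub_one (k : ℤ) : triInt (k - 1) = triInt k - k := by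
  have h1 := two_mul_triInt k
  have h2 := two_mul_triInt (k - 1)
  nlinarith

theorem triInt_add_one (k : ℤ) : triInt (k + 1) = triInt k + k + 1 := by
  have h1 := two_mul_triInt k
  have h2 := two_mul_triInt (k + 1)
  nlinarith

/-- The coefficients in the finite form of the triple product identity. -/
def tripleCoeff (q : ℂ) (n : ℕ) (k : ℤ) : ℂ :=
  (-1) ^ k * q ^ triInt k * (qFactorial q (2 * n) * (qFactorialInv q (n + k) * qFactorialInv q (n - k)))

/-- The Pascal rule that encodes multiplication of the Laurent polynomial by `(1 - a q^(n+1)) (1 -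
a⁻¹ q^n)`. -/
theorem tripleCoeff_succ (hq : ‖q‖ < 1) (hq0 : q ≠ 0) (n : ℕ) (k : ℤ) :
    tripleCoeff q (n + 1) k = (1 + q ^ (2 * n + 1)) * tripleCoeff q n k -
      q ^ (n + 1) * tripleCoeff q n (k - 1) - q ^ n * tripleCoeff q n (k + 1) := by
  have f1 : qFactorial q (2 * (n + 1)) =
      qFactorial q (2 * n) * (1 - q ^ (2 * n + 1)) * (1 - q ^ (2 * n + 2)) := by
    rw [show 2 * (n + 1) = 2 * n + 1 + 1 by ring, qFactorial, Finset.prod_range_succ,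
      Finset.prod_range_succ, ← qFactorial]
  have g1 := qFactorialInv_sub_one hq (n + 1 + k)
  have g2 := qFactorialInv_sub_one hq (n + k)
  have g3 := qFactorialInv_sub_one hq (n + 1 - k)
  have g4 := qFactorialInv_sub_one hq (n - k)
  rw [show (n : ℤ) + 1 + k - 1 = n + k by ring] at g1
  rw [show (n : ℤ) + 1 - k - 1 = n - k by ring] at g3
  have p1 : q ^ ((n : ℤ) + 1 + k) = q ^ (n : ℤ) * q * q ^ k := by
    rw [zpow_add₀ hq0, zpow_add₀ hq0, zpow_one]
  have p2 : q ^ ((n : ℤ) + k) = q ^ (n : ℤ) * q ^ k := zpow_add₀ hq0 _ _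
  have p3 : q ^ ((n : ℤ) + 1 - k) = q ^ (n : ℤ) * q * (q ^ k)⁻¹ := by
    rw [zpow_sub₀ hq0, zpow_add₀ hq0, zpow_one, div_eq_mul_inv]
  have p4 : q ^ ((n : ℤ) - k) = q ^ (n : ℤ) * (q ^ k)⁻¹ := by
    rw [zpow_sub₀ hq0, div_eq_mul_inv]
  have hk : q ^ k ≠ 0 := zpow_ne_zero _ hq0
  have t1 : q ^ (triInt (k - 1)) = q ^ triInt k * (q ^ k)⁻¹ := by
    rw [triInt_sub_one, zpow_sub₀ hq0, div_eq_mul_inv]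
  have t2 : q ^ (triInt (k + 1)) = q ^ triInt k * q ^ k * q := by
    rw [triInt_add_one, zpow_add₀ hq0, zpow_add₀ hq0, zpow_one]
  have s1 : (-1 : ℂ) ^ (k - 1) = -(-1) ^ k := by
    rw [zpow_sub₀ (by norm_num), zpow_one]; ring
  have s2 : (-1 : ℂ) ^ (k + 1) = -(-1) ^ k := by
    rw [zpow_add₀ (by norm_num), zpow_one]; ring
  simp only [tripleCoeff]
  rw [f1, t1, t2, s1, s2]
  push_cast
  rw [show (n : ℤ) + (k - 1) = n + k - 1 by ring, show (n : ℤ) - (k - 1) = n + 1 - k by ring,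
    show (n : ℤ) + (k + 1) = n + 1 + k by ring, show (n : ℤ) - (k + 1) = n - k - 1 by ring,
    g2, g4, g1, g3, p1, p2, p3, p4, zpow_natCast]
  field_simp
  ring

theorem hasSum_finite_triple (hq : ‖q‖ < 1) (hq0 : q ≠ 0) {a : ℂ} (ha : a ≠ 0) (n : ℕ) :
    HasSum (fun k : ℤ => a ^ k * tripleCoeff q n k)
      (∏ j ∈ Finset.range n, ((1 - a * q * q ^ j) * (1 - a⁻¹ * q ^ j))) := by
  induction n with
  | zero =>
    have : (fun k : ℤ => a ^ k * tripleCoeff q 0 k) = fun k => if k = 0 then 1 else 0 := by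
      ext k
      split_ifs with h
      · subst h; simp [tripleCoeff, triInt, qFactorialInv, qFactorial]
      · rcases lt_or_gt_of_ne h with h | h
        · simp [tripleCoeff, qFactorialInv, h]
        · simp [tripleCoeff, qFactorialInv, h]
    rw [this]
    simpa using hasSum_ite_eq (0 : ℤ) (1 : ℂ)
  | succ n ih =>
    have h1 := ((Equiv.subRight (1 : ℤ)).hasSum_iff).mpr ih
    have h2 := ((Equiv.addRight (1 : ℤ)).hasSum_iff).mpr ih
    have h := ((ih.mul_left (1 + q ^ (2 * n + 1))).sub (h1.mul_left (a * q ^ (n + 1)))).sub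
      (h2.mul_left (a⁻¹ * q ^ n))
    rw [Finset.prod_range_succ]
    have hf : (fun k : ℤ => a ^ k * tripleCoeff q (n + 1) k) = fun k =>
        (1 + q ^ (2 * n + 1)) * (a ^ k * tripleCoeff q n k) -
          a * q ^ (n + 1) * (a ^ (k - 1) * tripleCoeff q n (k - 1)) -
          a⁻¹ * q ^ n * (a ^ (k + 1) * tripleCoeff q n (k + 1)) := by
      ext k
      rw [tripleCoeff_succ hq hq0, zpow_sub₀ ha, zpow_add₀ ha, zpow_one]
      field_simp
    have hs : (1 - a * q * q ^ n) * (1 - a⁻¹ * q ^ n) =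
        1 + q ^ (2 * n + 1) - a * q ^ (n + 1) - a⁻¹ * q ^ n := by
      field_simp
      ring
    rw [hf, hs, mul_sub, mul_sub, mul_comm _ (1 + _), mul_comm _ (a * _), mul_comm _ (a⁻¹ * _)]
    exact h

theorem tendsto_qFactorial (hq : ‖q‖ < 1) :
    Filter.Tendsto (qFactorial q) Filter.atTop (nhds (poch q q)) := by
  have := (multipliable_poch hq q).hasProd.tendsto_prod_nat
  refine this.congr fun n => ?_
  exact Finset.prod_congr rfl fun j _ => by rw [pow_succ']

theorem poch_self_ne_zero (hq : ‖q‖ < 1) : poch q q ≠ 0 := by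
  refine poch_ne_zero hq fun k h => ?_
  have := one_sub_pow_ne_zero hq k
  rw [pow_succ', h, sub_self] at this
  exact this rfl

theorem tendsto_qFactorialInv (hq : ‖q‖ < 1) {m : ℕ → ℤ}
    (hm : Filter.Tendsto m Filter.atTop Filter.atTop) :
    Filter.Tendsto (fun n => qFactorialInv q (m n)) Filter.atTop (nhds (poch q q)⁻¹) := by
  have h1 : Filter.Tendsto (fun n => (m n).toNat) Filter.atTop Filter.atTop := by
    rw [Filter.tendsto_atTop] at hm ⊢
    intro b
    filter_upwards [hm b] with n hn
    omega
  have h2 := ((tendsto_qFactorial hq).comp h1).inv₀ (poch_self_ne_zero hq)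
  refine h2.congr' ?_
  filter_upwards [hm.eventually_ge_atTop 0] with n hn
  simp [qFactorialInv, not_lt.mpr hn]

theorem exists_bound_qFactorialInv (hq : ‖q‖ < 1) : ∃ C : ℝ, 0 ≤ C ∧ ∀ m, ‖qFactorialInv q m‖ ≤ C := by
  have h := ((tendsto_qFactorial hq).inv₀ (poch_self_ne_zero hq)).norm.bddAbove_range
  obtain ⟨C, hC⟩ := h
  have hC' : ∀ n, ‖(qFactorial q n)⁻¹‖ ≤ C := fun n => hC ⟨n, rfl⟩
  have hC0 : 0 ≤ C := (norm_nonneg _).trans (hC' 0)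
  refine ⟨C, hC0, fun m => ?_⟩
  rw [qFactorialInv]
  split_ifs
  · simpa using hC0
  · exact hC' _

theorem exists_bound_qFactorial (hq : ‖q‖ < 1) : ∃ C : ℝ, 0 ≤ C ∧ ∀ m, ‖qFactorial q m‖ ≤ C := by
  obtain ⟨C, hC⟩ := (tendsto_qFactorial hq).norm.bddAbove_range
  have hC' : ∀ n, ‖qFactorial q n‖ ≤ C := fun n => hC ⟨n, rfl⟩
  exact ⟨C, (norm_nonneg _).trans (hC' 0), hC'⟩

/-- Jacobi's triple product identity. -/
theorem tsum_triple (hq : ‖q‖ < 1) (hq0 : q ≠ 0) {a : ℂ} (ha : a ≠ 0)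
    (hsum : Summable fun k : ℤ => ‖a ^ k * q ^ triInt k‖) :
    ∑' k : ℤ, (-1) ^ k * (a ^ k * q ^ triInt k) = poch q q * thetaProd q a := by
  obtain ⟨C, hC0, hC⟩ := exists_bound_qFactorialInv hq
  obtain ⟨D, hD0, hD⟩ := exists_bound_qFactorial hq
  have hQ := poch_self_ne_zero hq
  -- Dominated convergence in the finite identity: the finite products and their inverses are
  -- bounded uniformly in `n` and `k`, and tend to `(q; q)_∞` and its inverse.
  have hlim : Filter.Tendsto (fun n : ℕ => ∑' k : ℤ, a ^ k * tripleCoeff q n k) Filter.atTop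
      (nhds (∑' k : ℤ, a ^ k * ((-1) ^ k * q ^ triInt k *
        (poch q q * ((poch q q)⁻¹ * (poch q q)⁻¹))))) := by
    refine tendsto_tsum_of_dominated_convergence (bound := fun k => ‖a ^ k * q ^ triInt k‖ * (D * (C * C)))
      (hsum.mul_right _) (fun k => ?_) (Filter.Eventually.of_forall fun n k => ?_)
    · refine Filter.Tendsto.const_mul _ (Filter.Tendsto.const_mul _ (Filter.Tendsto.mul ?_
        (Filter.Tendsto.mul ?_ ?_)))
      · exact (tendsto_qFactorial hq).comp (Filter.tendsto_id.const_mul_atTop' two_pos)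
      · exact tendsto_qFactorialInv hq (Filter.tendsto_atTop_add_const_right _ _ tendsto_natCast_atTop_atTop)
      · simp only [sub_eq_add_neg]
        exact tendsto_qFactorialInv hq (Filter.tendsto_atTop_add_const_right _ _ tendsto_natCast_atTop_atTop)
    · have h1 : a ^ k * tripleCoeff q n k = (a ^ k * q ^ triInt k) * ((-1) ^ k *
          (qFactorial q (2 * n) * (qFactorialInv q (n + k) * qFactorialInv q (n - k)))) := by
        rw [tripleCoeff]; ring
      rw [h1, norm_mul]
      gcongr
      rw [norm_mul, norm_zpow, norm_neg, norm_one, one_zpow, one_mul, norm_mul, norm_mul]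
      gcongr
      · exact hD _
      · exact hC _
      · exact hC _
  have hprod : Filter.Tendsto (fun n : ℕ => ∑' k : ℤ, a ^ k * tripleCoeff q n k) Filter.atTop
      (nhds (thetaProd q a)) := by
    have h1 := ((multipliable_poch hq (a * q)).hasProd.tendsto_prod_nat).mul
      ((multipliable_poch hq a⁻¹).hasProd.tendsto_prod_nat)
    refine h1.congr fun n => ?_
    rw [(hasSum_finite_triple hq hq0 ha n).tsum_eq, Finset.prod_mul_distrib]
  have h2 := tendsto_nhds_unique hprod hlim
  rw [h2, ← tsum_mul_left]
  refine tsum_congr fun k => ?_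
  field_simp

end Triple

/-! ### The rank generating function of unimodal sequences -/

/-- Nondecreasing lists with entries in `{1, …, c}`. -/
abbrev BoundedList (c : ℕ) : Type :=
  {l : List ℕ // l.Pairwise (· ≤ ·) ∧ ∀ i ∈ l, 1 ≤ i ∧ i ≤ c}

/-- A sorted list is determined by its multiset of entries, so comparing multiplicities suffices. -/
theorem filter_append_replicate {c : ℕ} {l : List ℕ} (hl : l.Pairwise (· ≤ ·))
    (hb : ∀ i ∈ l, 1 ≤ i ∧ i ≤ c + 1) :
    l.filter (· ≤ c) ++ List.replicate (l.count (c + 1)) (c + 1) = l := by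
  refine List.Perm.eq_of_pairwise (le := (· ≤ ·)) (fun a b _ _ h1 h2 => le_antisymm h1 h2) ?_ hl ?_
  · refine List.pairwise_append.mpr ⟨hl.filter _, List.pairwise_replicate.mpr (Or.inr le_rfl), ?_⟩
    intro a ha b hb'
    have h1 : a ≤ c := by simpa using (List.mem_filter.mp ha).2
    have h2 := List.eq_of_mem_replicate hb'
    omega
  · rw [List.perm_iff_count]
    intro a
    rw [List.count_append, List.count_replicate]
    by_cases h : a ≤ c
    · rw [List.count_filter (by simpa using h), if_neg (by simp; omega), add_zero]
    · have h1 : List.count a (l.filter (· ≤ c)) = 0 := by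
        rw [List.count_eq_zero]
        intro hmem
        exact h (by simpa using (List.mem_filter.mp hmem).2)
      rw [h1, zero_add]
      by_cases h2 : c + 1 = a
      · simp [h2]
      · rw [if_neg (by simpa using h2), eq_comm, List.count_eq_zero]
        intro hmem
        have := hb a hmem
        omega

/-- Splitting off the entries equal to `c + 1`. -/
def boundedListSuccEquiv (c : ℕ) : BoundedList c × ℕ ≃ BoundedList (c + 1) where
  toFun p := ⟨p.1.1 ++ List.replicate p.2 (c + 1), by
    refine ⟨List.pairwise_append.mpr ⟨p.1.2.1, List.pairwise_replicate.mpr (Or.inr le_rfl), ?_⟩, ?_⟩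
    · intro a ha b hb
      have h1 := p.1.2.2 a ha
      have h2 := List.eq_of_mem_replicate hb
      omega
    · intro i hi
      rcases List.mem_append.mp hi with h | h
      · have := p.1.2.2 i h
        omega
      · have := List.eq_of_mem_replicate h
        omega⟩
  invFun l := (⟨l.1.filter (· ≤ c), l.2.1.filter _, fun i hi => by
    have h1 := List.mem_filter.mp hi
    exact ⟨(l.2.2 i h1.1).1, by simpa using h1.2⟩⟩, l.1.count (c + 1))
  left_inv := by
    rintro ⟨⟨l, hl, hb⟩, m⟩
    have h1 : l.filter (· ≤ c) = l := List.filter_eq_self.mpr fun a ha => by simpa using (hb a ha).2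
    have h2 : (List.replicate m (c + 1)).filter (· ≤ c) = [] := by
      rw [List.filter_eq_nil_iff]
      intro a ha
      have := List.eq_of_mem_replicate ha
      simp [this]
    have h3 : l.count (c + 1) = 0 := by
      rw [List.count_eq_zero]
      intro hmem
      have := hb _ hmem
      omega
    simp [h1, h3]
  right_inv := by
    rintro ⟨l, hl, hb⟩
    exact Subtype.ext (filter_append_replicate hl hb)

/-- `∏_{j = 1}^c 1 / (1 - y q ^ j)`. -/
def boundedProd {𝕜 : Type} [NormedField 𝕜] (y q : 𝕜) (c : ℕ) : 𝕜 :=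
  ∏ j ∈ Finset.range c, (1 - y * q ^ (j + 1))⁻¹

theorem norm_mul_pow_succ_lt {𝕜 : Type} [NormedField 𝕜] {y q : 𝕜} (hq : ‖q‖ < 1) (hy : ‖y * q‖ < 1)
    (c : ℕ) : ‖y * q ^ (c + 1)‖ < 1 := by
  rw [pow_succ', ← mul_assoc, norm_mul, norm_pow]
  exact (mul_le_of_le_one_right (norm_nonneg _) (pow_le_one₀ (norm_nonneg _) hq.le)).trans_lt hy

theorem hasSum_mul_of_summable_norm {𝕜 : Type} [NormedField 𝕜] [CompleteSpace 𝕜] {ι κ : Type}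
    {f : ι → 𝕜} {g : κ → 𝕜} {s t : 𝕜} (hf : HasSum f s) (hg : HasSum g t)
    (hfn : Summable fun i => ‖f i‖) (hgn : Summable fun i => ‖g i‖) :
    (Summable fun p : ι × κ => ‖f p.1 * g p.2‖) ∧ HasSum (fun p : ι × κ => f p.1 * g p.2) (s * t) := by
  have h := Summable.mul_norm hfn hgn
  exact ⟨h, hf.mul hg h.of_norm⟩

/-- Splitting off the entries equal to `c + 1` contributes the geometric series `1/(1 - y q^(c+1))`.
The field is general because the real case serves to bound the complex one. -/
theorem hasSum_boundedList {𝕜 : Type} [NormedField 𝕜] [CompleteSpace 𝕜] {y q : 𝕜}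
    (hq : ‖q‖ < 1) (hy : ‖y * q‖ < 1) (c : ℕ) :
    (Summable fun l : BoundedList c => ‖y ^ l.1.length * q ^ l.1.sum‖) ∧
      HasSum (fun l : BoundedList c => y ^ l.1.length * q ^ l.1.sum) (boundedProd y q c) := by
  induction c with
  | zero =>
    have hu : ∀ l : BoundedList 0, l = ⟨[], by simp⟩ := by
      rintro ⟨l, hl, hb⟩
      rcases l with _ | ⟨a, l⟩
      · rfl
      · have := hb a (by simp)
        omega
    have : Unique (BoundedList 0) := ⟨⟨⟨[], by simp⟩⟩, hu⟩
    refine ⟨(hasSum_fintype _).summable, ?_⟩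
    have := hasSum_fintype (fun l : BoundedList 0 => y ^ l.1.length * q ^ l.1.sum)
    rw [Fintype.sum_unique] at this
    rw [hu default] at this
    simpa [boundedProd] using this
  | succ c ih =>
    obtain ⟨ih1, ih2⟩ := ih
    have hlt := norm_mul_pow_succ_lt hq hy c
    have hg := hasSum_geometric_of_norm_lt_one hlt
    have hgn : Summable fun n : ℕ => ‖(y * q ^ (c + 1)) ^ n‖ := by
      simpa only [norm_pow] using summable_geometric_of_lt_one (norm_nonneg _) hlt
    have hterm : ∀ p : BoundedList c × ℕ,
        y ^ (boundedListSuccEquiv c p).1.length * q ^ (boundedListSuccEquiv c p).1.sum =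
          (y ^ p.1.1.length * q ^ p.1.1.sum) * (y * q ^ (c + 1)) ^ p.2 := by
      rintro ⟨l, m⟩
      simp only [boundedListSuccEquiv, Equiv.coe_fn_mk, List.length_append, List.length_replicate,
        List.sum_append, List.sum_replicate, smul_eq_mul, pow_add, mul_pow]
      rw [mul_comm m (c + 1), pow_mul]
      ring
    obtain ⟨hsn, hm⟩ := hasSum_mul_of_summable_norm ih2 hg ih1 hgn
    constructor
    · rw [← (boundedListSuccEquiv c).summable_iff]
      exact hsn.congr fun p => by rw [Function.comp_apply, hterm]
    · rw [boundedProd, Finset.prod_range_succ, ← boundedProd, ← (boundedListSuccEquiv c).hasSum_iff]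
      refine hm.congr_fun fun p => ?_
      rw [Function.comp_apply, hterm]

theorem poch_mul_boundedProd {q : ℂ} (hq : ‖q‖ < 1) {y : ℂ} (hy : ‖y * q‖ < 1) (c : ℕ) :
    poch q (y * q) * boundedProd y q c = poch q (y * q ^ (c + 1)) := by
  induction c with
  | zero => simp [boundedProd]
  | succ c ih =>
    have h : 1 - y * q ^ (c + 1) ≠ 0 := by
      rw [sub_ne_zero]
      intro h
      have := norm_mul_pow_succ_lt hq hy c
      rw [← h, norm_one] at this
      exact lt_irrefl _ this
    rw [boundedProd, Finset.prod_range_succ, ← boundedProd, ← mul_assoc, ih, poch_eq_mul hq,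
      mul_assoc y, ← pow_succ]
    field_simp

theorem poch_mul_ne_zero {q : ℂ} (hq : ‖q‖ < 1) {y : ℂ} (hy : ‖y * q‖ < 1) : poch q (y * q) ≠ 0 := by
  refine poch_ne_zero hq fun k h => ?_
  have := norm_mul_pow_succ_lt hq hy k
  rw [pow_succ', ← mul_assoc, h, norm_one] at this
  exact lt_irrefl _ this

/-- The finite product is a quotient of two infinite products; the denominator is fixed and nonzero,
and the numerator is bounded in `c`. -/
theorem exists_bound_boundedProd {y q : ℝ} (hq : ‖q‖ < 1) (hy : ‖y * q‖ < 1) :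
    ∃ C : ℝ, ∀ c, ‖boundedProd y q c‖ ≤ C := by
  have hq' : ‖(q : ℂ)‖ < 1 := by rwa [Complex.norm_real]
  have hy' : ‖(y : ℂ) * (q : ℂ)‖ < 1 := by rwa [← Complex.ofReal_mul, Complex.norm_real]
  have hne := poch_mul_ne_zero hq' hy'
  refine ⟨Real.exp (‖(y : ℂ)‖ / (1 - ‖(q : ℂ)‖)) / ‖poch (q : ℂ) (y * q)‖, fun c => ?_⟩
  rw [le_div_iff₀ (norm_pos_iff.mpr hne), mul_comm]
  have h1 : ‖boundedProd y q c‖ = ‖boundedProd (y : ℂ) (q : ℂ) c‖ := by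
    rw [← Complex.norm_real]
    congr 1
    simp [boundedProd]
  rw [h1, ← norm_mul, poch_mul_boundedProd hq' hy']
  exact norm_poch_mul_pow_le hq' _ _

/-- Unimodal sequences, given by their peak and the two tails. -/
def unimodalEquiv : {x : List ℕ × ℕ × List ℕ // IsUnimodal x} ≃
    Σ c : ℕ, BoundedList c × BoundedList c where
  toFun x := ⟨x.1.2.1, ⟨x.1.1, x.2.1, x.2.2.2.1⟩, ⟨x.1.2.2.reverse, by
    refine ⟨List.pairwise_reverse.mpr x.2.2.1, fun i hi => x.2.2.2.2 i (List.mem_reverse.mp hi)⟩⟩⟩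
  invFun s := ⟨(s.2.1.1, s.1, s.2.2.1.reverse), s.2.1.2.1, List.pairwise_reverse.mpr s.2.2.2.1,
    s.2.1.2.2, fun i hi => s.2.2.2.2 i (List.mem_reverse.mp hi)⟩
  left_inv := by
    rintro ⟨⟨l, c, l'⟩, h⟩
    simp
  right_inv := by
    rintro ⟨c, ⟨l, h⟩, ⟨l', h'⟩⟩
    simp

/-- The contribution `ζ ^ rank q ^ size` of a triple. -/
def unimodalTerm {𝕜 : Type} [NormedField 𝕜] (ζ q : 𝕜) (s : Σ c : ℕ, BoundedList c × BoundedList c) : 𝕜 :=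
  q ^ s.1 * ((ζ⁻¹ ^ s.2.1.1.length * q ^ s.2.1.1.sum) * (ζ ^ s.2.2.1.length * q ^ s.2.2.1.sum))

theorem hasSum_unimodalTerm_fiber {𝕜 : Type} [NormedField 𝕜] [CompleteSpace 𝕜] {ζ q : 𝕜}
    (hq : ‖q‖ < 1) (h1 : ‖ζ * q‖ < 1) (h2 : ‖ζ⁻¹ * q‖ < 1) (c : ℕ) :
    HasSum (fun p : BoundedList c × BoundedList c => unimodalTerm ζ q ⟨c, p⟩)
      (q ^ c * (boundedProd ζ⁻¹ q c * boundedProd ζ q c)) := by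
  obtain ⟨a1, a2⟩ := hasSum_boundedList hq h2 c
  obtain ⟨b1, b2⟩ := hasSum_boundedList hq h1 c
  obtain ⟨hsn, hm⟩ := hasSum_mul_of_summable_norm a2 b2 a1 b1
  exact hm.mul_left _

/-- The norm of a term is the term for the real parameters `‖ζ‖`, `‖q‖`. Its sum over a fixed peak
`c` is known in closed form and is at most a constant times `‖q‖^c`. -/
theorem summable_unimodalTerm {ζ q : ℂ} (hq : ‖q‖ < 1) (h1 : ‖ζ * q‖ < 1) (h2 : ‖ζ⁻¹ * q‖ < 1) :
    Summable (unimodalTerm ζ q) := by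
  refine Summable.of_norm ?_
  have hn : ∀ s, ‖unimodalTerm ζ q s‖ = unimodalTerm (‖ζ‖ : ℝ) ‖q‖ s := by
    intro s
    simp only [unimodalTerm, norm_mul, norm_pow, norm_inv]
  have hq' : ‖(‖q‖ : ℝ)‖ < 1 := by simpa using hq
  have h1' : ‖(‖ζ‖ * ‖q‖ : ℝ)‖ < 1 := by simpa using h1
  have h2' : ‖(‖ζ‖⁻¹ * ‖q‖ : ℝ)‖ < 1 := by simpa using h2
  simp only [hn]
  rw [summable_sigma_of_nonneg fun s => by rw [← hn]; exact norm_nonneg _]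
  refine ⟨fun c => (hasSum_unimodalTerm_fiber hq' h1' h2' c).summable, ?_⟩
  simp only [fun c => (hasSum_unimodalTerm_fiber hq' h1' h2' c).tsum_eq]
  obtain ⟨C, hC⟩ := exists_bound_boundedProd hq' h1'
  obtain ⟨D, hD⟩ := exists_bound_boundedProd hq' h2'
  refine Summable.of_norm_bounded (g := fun c : ℕ => ‖q‖ ^ c * (D * C))
    ((summable_geometric_of_lt_one (norm_nonneg _) hq).mul_right _) fun c => ?_
  have hC0 : 0 ≤ C := (norm_nonneg _).trans (hC 0)
  have hD0 : 0 ≤ D := (norm_nonneg _).trans (hD 0)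
  rw [norm_mul, norm_mul, norm_pow, norm_norm]
  gcongr
  · exact hD c
  · exact hC c

/-- One absolutely convergent sum over all unimodal sequences, grouped by size and rank on one side
and by peak on the other. The peak `c = 0` yields the empty sequence. -/
theorem unimodalGF_eq_tsum {ζ q : ℂ} (hζ : ζ ≠ 0) (hq : ‖q‖ < 1) (h1 : ‖ζ * q‖ < 1)
    (h2 : ‖ζ⁻¹ * q‖ < 1) :
    unimodalGF ζ q = ∑' c : ℕ, q ^ c * (boundedProd ζ⁻¹ q c * boundedProd ζ q c) := by
  have hs := summable_unimodalTerm hq h1 h2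
  have hs' : HasSum (fun x => unimodalTerm ζ q (unimodalEquiv x)) (∑' s, unimodalTerm ζ q s) :=
    (unimodalEquiv.hasSum_iff).mpr hs.hasSum
  have hfib := hs'.tsum_fiberwise (fun x => (x.1.1.sum + x.1.2.1 + x.1.2.2.sum,
    (x.1.2.2.length : ℤ) - (x.1.1.length : ℤ)))
  have e1 : ∑' s, unimodalTerm ζ q s = unimodalGF ζ q := by
    rw [unimodalGF, ← hfib.tsum_eq]
    refine tsum_congr fun p => ?_
    have hc : ∀ b : ((fun x : {x : List ℕ × ℕ × List ℕ // IsUnimodal x} =>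
        (x.1.1.sum + x.1.2.1 + x.1.2.2.sum, (x.1.2.2.length : ℤ) - (x.1.1.length : ℤ))) ⁻¹' {p}),
        unimodalTerm ζ q (unimodalEquiv b) = ζ ^ p.2 * q ^ p.1 := by
      rintro ⟨⟨⟨l, c, l'⟩, hx⟩, rfl⟩
      simp only [unimodalTerm, unimodalEquiv, Equiv.coe_fn_mk, List.length_reverse, List.sum_reverse]
      rw [zpow_sub₀ hζ, zpow_natCast, zpow_natCast, pow_add, pow_add, inv_pow]
      field_simp
    -- Finiteness of the fibre is not needed: the constant sum and the cardinality share the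
    -- convention of being zero on infinite sets.
    rw [tsum_congr hc, tsum_const, nsmul_eq_mul, mul_assoc]
    congr 2
    rw [unimodalCount, Nat.card_coe_set_eq, ← Set.ncard_image_of_injective _ Subtype.val_injective]
    congr 1
    ext x
    simp only [Set.mem_image, Set.mem_preimage, Set.mem_singleton_iff, Subtype.exists,
      exists_and_right, exists_eq_right, Set.mem_ofPred_eq]
    constructor
    · rintro ⟨hx, rfl⟩
      exact ⟨hx, rfl, rfl⟩
    · rintro ⟨hx, ha, hb⟩
      exact ⟨hx, Prod.ext ha hb⟩
  rw [← e1, hs.tsum_sigma' fun c => (hasSum_unimodalTerm_fiber hq h1 h2 c).summable]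
  exact tsum_congr fun c => (hasSum_unimodalTerm_fiber hq h1 h2 c).tsum_eq

theorem unimodalGF_mul_poch {ζ q : ℂ} (hζ : ζ ≠ 0) (hq : ‖q‖ < 1) (h1 : ‖ζ * q‖ < 1)
    (h2 : ‖ζ⁻¹ * q‖ < 1) :
    unimodalGF ζ q * (poch q (ζ * q) * poch q (ζ⁻¹ * q)) = rankSeries q ζ := by
  rw [unimodalGF_eq_tsum hζ hq h1 h2, ← tsum_mul_right, rankSeries]
  refine tsum_congr fun c => ?_
  rw [← poch_mul_boundedProd hq h1, ← poch_mul_boundedProd hq h2]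
  ring

/-! ### The function `sin (π z) / (π z)` and Bernoulli numbers -/

theorem sincPi_eq_dslope (z : ℂ) : sincPi z = dslope Complex.sin 0 (Real.pi * z) := by
  rw [sincPi]
  split_ifs with h
  · simp [h]
  · have hpi : (Real.pi : ℂ) ≠ 0 := by exact_mod_cast Real.pi_ne_zero
    rw [dslope_of_ne _ (mul_ne_zero hpi h), slope_def_field]
    simp

theorem analyticAt_sincPi (z : ℂ) : AnalyticAt ℂ sincPi z := by
  have h : Differentiable ℂ (dslope Complex.sin 0) := by
    have := (Complex.differentiableOn_dslope (f := Complex.sin) (s := Set.univ) (c := 0)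
      Filter.univ_mem).mpr Complex.differentiable_sin.differentiableOn
    exact differentiableOn_univ.mp this
  have h2 : sincPi = fun z => dslope Complex.sin 0 (Real.pi * z) := funext sincPi_eq_dslope
  rw [h2]
  exact (h.analyticAt _).fun_comp (by fun_prop)

theorem sincPi_zero : sincPi 0 = 1 := if_pos rfl

theorem sincPi_mul (z : ℂ) : sincPi z * (Real.pi * z) = Complex.sin (Real.pi * z) := by
  rw [sincPi]
  split_ifs with h
  · simp [h]
  · have hpi : (Real.pi : ℂ) ≠ 0 := by exact_mod_cast Real.pi_ne_zero
    field_simp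

/-- The binomial recurrence of the Bernoulli numbers is triangular with nonzero diagonal, so it has
one solution. -/
theorem sum_choose_unique {b : ℕ → ℂ}
    (h : ∀ n, ∑ i ∈ Finset.range n, (n.choose i : ℂ) * b i = if n = 1 then 1 else 0) (n : ℕ) :
    b n = bernoulli n := by
  induction n using Nat.strong_induction_on with
  | _ n ih =>
    have h1 := h (n + 1)
    have h2 : ∑ i ∈ Finset.range (n + 1), ((n + 1).choose i : ℂ) * ((bernoulli i : ℚ) : ℂ) =
        if n + 1 = 1 then 1 else 0 := by
      have := congrArg (Rat.cast : ℚ → ℂ) (sum_bernoulli (n + 1))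
      push_cast at this
      rw [this]
      by_cases h : n = 0 <;> simp [h]
    rw [← h2, Finset.sum_range_succ, Finset.sum_range_succ,
      Finset.sum_congr rfl fun i hi => by rw [ih i (Finset.mem_range.mp hi)], add_right_inj] at h1
    have h3 : ((n + 1).choose n : ℂ) ≠ 0 := by
      exact_mod_cast (Nat.choose_pos (Nat.le_succ n)).ne'
    exact mul_left_cancel₀ h3 h1

theorem iteratedDeriv_id_mul {f : ℂ → ℂ} (hf : AnalyticAt ℂ f 0) {n : ℕ} (hn : 1 ≤ n) :
    iteratedDeriv n (fun z => z * f z) 0 = n * iteratedDeriv (n - 1) f 0 := by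
  have h := iteratedDeriv_fun_mul (n := n) (f := fun z : ℂ => z) (g := f) (x := 0)
    contDiffAt_id hf.contDiffAt
  rw [h, Finset.sum_eq_single 1]
  · simp
  · intro i _ hi
    rcases Nat.eq_zero_or_pos i with rfl | h0
    · simp
    · obtain ⟨j, rfl⟩ : ∃ j, i = j + 2 := ⟨i - 2, by omega⟩
      have : iteratedDeriv (j + 2) (fun z : ℂ => z) 0 = 0 := by
        rw [iteratedDeriv_succ']
        simp [iteratedDeriv_const]
      rw [this]; ring
  · intro h1
    simp at h1
    omega

theorem iteratedDeriv_exp_sub_one (c : ℂ) (j : ℕ) :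
    iteratedDeriv j (fun z : ℂ => Complex.exp (c * z) - 1) 0 = if j = 0 then 0 else c ^ j := by
  rcases j with _ | j
  · simp
  · have h1 : deriv (fun z : ℂ => Complex.exp (c * z) - 1) = deriv (fun z => Complex.exp (c * z)) := by
      ext z; rw [deriv_sub_const]
    rw [iteratedDeriv_succ', h1, ← iteratedDeriv_succ', iteratedDeriv_comp_mul_left,
      if_neg (Nat.succ_ne_zero j), iteratedDeriv_eq_iterate, Complex.iter_deriv_exp]
    simp

/-- The function `β(z) = z (log sinc)'(z) + 1 - πiz` equals `πz cot(πz) - πiz = x/(e^x - 1)` with `x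
= 2πiz`, the generating function of the Bernoulli numbers. The summand `-πiz` accounts for the extra
`1/2` at `k = 1`. -/
theorem expTaylorCoeff_sincPi {k : ℕ} (hk : 1 ≤ k) :
    expTaylorCoeff sincPi k = (((bernoulli k : ℚ) : ℂ) + if k = 1 then 1 / 2 else 0) / k := by
  have hS := analyticAt_sincPi 0
  have hS0 : sincPi 0 ≠ 0 := by rw [sincPi_zero]; exact one_ne_zero
  have hpi : (2 * Real.pi * Complex.I : ℂ) ≠ 0 := Complex.two_pi_I_ne_zero
  set L : ℂ → ℂ := fun z => Complex.log (sincPi z / sincPi 0) with hL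
  have hLa : AnalyticAt ℂ L 0 := analyticAt_log_div hS hS0
  set β : ℂ → ℂ := fun z => z * deriv L z + (1 - Real.pi * Complex.I * z) with hβ
  have hβa : AnalyticAt ℂ β 0 := by
    have := hLa.deriv
    fun_prop
  have hprod : (fun z => β z * (Complex.exp (2 * Real.pi * Complex.I * z) - 1)) =ᶠ[nhds 0]
      fun z => 2 * Real.pi * Complex.I * z := by
    filter_upwards [eventually_exp_log hS.continuousAt hS0] with z hz
    have hSz : sincPi z ≠ 0 := by
      intro h
      apply Complex.slitPlane_ne_zero hz
      rw [h, zero_div]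
    have hd := (analyticAt_sincPi z).differentiableAt.hasDerivAt
    have h1 : deriv L z = deriv sincPi z / sincPi z := by
      have : deriv L z = (deriv sincPi z / sincPi 0) / (sincPi z / sincPi 0) :=
        ((hd.div_const (sincPi 0)).clog hz).deriv
      rw [this]
      field_simp
    have h2 : deriv sincPi z * (Real.pi * z) + sincPi z * Real.pi =
        Complex.cos (Real.pi * z) * Real.pi := by
      have e1 : HasDerivAt (fun z : ℂ => (Real.pi : ℂ) * z) (Real.pi : ℂ) z := by
        simpa using (hasDerivAt_id z).const_mul (Real.pi : ℂ)
      have e2 := hd.mul e1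
      have e3 : (sincPi * fun z : ℂ => (Real.pi : ℂ) * z) = fun z => Complex.sin (Real.pi * z) := by
        ext w; exact sincPi_mul w
      rw [e3] at e2
      exact e2.unique e1.csin
    have hpi' : (Real.pi : ℂ) ≠ 0 := by exact_mod_cast Real.pi_ne_zero
    have h3 : deriv sincPi z * z + sincPi z = Complex.cos (Real.pi * z) := by
      apply mul_right_cancel₀ hpi'
      rw [← h2]; ring
    have h4 : Complex.exp (2 * Real.pi * Complex.I * z) - 1 =
        Complex.exp (Real.pi * z * Complex.I) * (2 * Complex.I * Complex.sin (Real.pi * z)) := by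
      rw [Complex.sin, show 2 * Real.pi * Complex.I * z =
        Real.pi * z * Complex.I + Real.pi * z * Complex.I by ring, Complex.exp_add]
      have : Complex.exp (Real.pi * z * Complex.I) * Complex.exp (-(Real.pi * z) * Complex.I) = 1 := by
        rw [← Complex.exp_add]; simp
      linear_combination (Complex.exp (Real.pi * z * Complex.I) ^ 2 -
        Complex.exp (Real.pi * z * Complex.I) * Complex.exp (-(Real.pi * z) * Complex.I)) *
          Complex.I_sq + this
    have h5 : Complex.cos (Real.pi * z) - Complex.I * Complex.sin (Real.pi * z) =
        Complex.exp (-(Real.pi * z) * Complex.I) := by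
      rw [Complex.exp_mul_I, Complex.cos_neg, Complex.sin_neg]; ring
    have h6 : Complex.exp (Real.pi * z * Complex.I) * Complex.exp (-(Real.pi * z) * Complex.I) = 1 := by
      rw [← Complex.exp_add]; simp
    simp only [hβ]
    rw [h4, h1, ← sincPi_mul]
    have h7 : z * (deriv sincPi z / sincPi z) + (1 - Real.pi * Complex.I * z) =
        Complex.exp (-(Real.pi * z) * Complex.I) / sincPi z := by
      rw [← h5, ← sincPi_mul, eq_div_iff hSz, ← h3]
      field_simp
      ring
    rw [h7, div_mul_eq_mul_div, div_eq_iff hSz]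
    linear_combination (2 * Complex.I * Real.pi * z * sincPi z) * h6
  have hb : ∀ n, iteratedDeriv n β 0 / (2 * Real.pi * Complex.I) ^ n = bernoulli n := by
    refine sum_choose_unique fun n => ?_
    have h1 := hprod.iteratedDeriv_eq n
    rw [iteratedDeriv_fun_mul hβa.contDiffAt (by fun_prop)] at h1
    simp only [iteratedDeriv_exp_sub_one] at h1
    rw [Finset.sum_range_succ, Nat.sub_self, if_pos rfl, mul_zero, add_zero] at h1
    have h2 : iteratedDeriv n (fun z : ℂ => 2 * Real.pi * Complex.I * z) 0 =
        if n = 1 then 2 * Real.pi * Complex.I else 0 := by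
      rcases n with _ | _ | n
      · simp
      · simp
      · have : deriv (fun z : ℂ => 2 * Real.pi * Complex.I * z) = fun _ => 2 * Real.pi * Complex.I := by
          ext z; simp
        rw [iteratedDeriv_succ', this]
        simp [iteratedDeriv_const]
    rw [h2] at h1
    have h3 : ∑ i ∈ Finset.range n, (n.choose i : ℂ) *
        (iteratedDeriv i β 0 / (2 * Real.pi * Complex.I) ^ i) =
        (if n = 1 then 2 * Real.pi * Complex.I else 0) / (2 * Real.pi * Complex.I) ^ n := by
      rw [← h1, Finset.sum_div]
      refine Finset.sum_congr rfl fun i hi => ?_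
      have hi' := Finset.mem_range.mp hi
      rw [if_neg (by omega)]
      have h4 : (2 * Real.pi * Complex.I : ℂ) ^ n =
          (2 * Real.pi * Complex.I) ^ i * (2 * Real.pi * Complex.I) ^ (n - i) := by
        rw [← pow_add]; congr 1; omega
      rw [h4]
      field_simp
    rw [h3]
    split_ifs with h
    · rw [h, pow_one, div_self hpi]
    · simp
  have hβk : iteratedDeriv k β 0 = k * iteratedDeriv k L 0 +
      if k = 1 then -(Real.pi * Complex.I) else 0 := by
    have e1 : iteratedDeriv k β 0 = iteratedDeriv k (fun z => z * deriv L z) 0 +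
        iteratedDeriv k (fun z : ℂ => 1 - Real.pi * Complex.I * z) 0 :=
      iteratedDeriv_fun_add (by have := hLa.deriv; exact (analyticAt_id.mul this).contDiffAt) (by fun_prop)
    rw [e1, iteratedDeriv_id_mul hLa.deriv hk, ← iteratedDeriv_succ', Nat.sub_add_cancel hk]
    congr 1
    have h1 : deriv (fun z : ℂ => 1 - Real.pi * Complex.I * z) = fun _ => -(Real.pi * Complex.I) := by
      ext z; simp
    rcases k with _ | _ | k
    · omega
    · simp [h1]
    · rw [iteratedDeriv_succ', h1]
      simp [iteratedDeriv_const]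
  have hk0 : (k : ℂ) ≠ 0 := by exact_mod_cast (by omega : k ≠ 0)
  rw [expTaylorCoeff, ← hb k, hβk]
  split_ifs with h
  · subst h
    field_simp
    ring
  · field_simp
    ring

/-! ### The logarithm of `(ζ q; q)_∞ (ζ⁻¹ q; q)_∞` -/

theorem norm_exp_two_pi_I_mul (w : ℂ) :
    ‖Complex.exp (2 * Real.pi * Complex.I * w)‖ = Real.exp (-(2 * Real.pi * w.im)) := by
  rw [Complex.norm_exp]
  congr 1
  simp

/-- The terms of the Lambert series `∑ (ζ ^ m + ζ ^ (-m)) q ^ (n m) / m`. -/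
def lambertTerm (p : ℕ × ℕ) (x : ℂ × ℂ) : ℂ :=
  (Complex.exp (2 * Real.pi * Complex.I * (((p.1 : ℂ) + 1) * ((p.2 : ℂ) + 1) * x.2 + ((p.2 : ℂ) + 1) * x.1)) +
    Complex.exp (2 * Real.pi * Complex.I * (((p.1 : ℂ) + 1) * ((p.2 : ℂ) + 1) * x.2 -
      ((p.2 : ℂ) + 1) * x.1))) / ((p.2 : ℂ) + 1)

/-- The Lambert series equal to `-log` of `(ζ q; q)_∞ (ζ⁻¹ q; q)_∞`. -/
def lambertSeries (z τ : ℂ) : ℂ := ∑' p : ℕ × ℕ, lambertTerm p (z, τ)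

theorem norm_exp_lambert_le {δ : ℝ} {z τ : ℂ} (hδ : 0 ≤ δ) (h : |z.im| + δ ≤ τ.im) (n m : ℕ) :
    ‖Complex.exp (2 * Real.pi * Complex.I * (((n : ℂ) + 1) * ((m : ℂ) + 1) * τ + ((m : ℂ) + 1) * z))‖ ≤
      Real.exp (-(2 * Real.pi * δ)) ^ n * Real.exp (-(2 * Real.pi * δ)) ^ m := by
  rw [norm_exp_two_pi_I_mul, ← Real.exp_nat_mul, ← Real.exp_nat_mul, ← Real.exp_add]
  apply Real.exp_le_exp.mpr
  have him : (((n : ℂ) + 1) * ((m : ℂ) + 1) * τ + ((m : ℂ) + 1) * z).im =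
      ((m : ℝ) + 1) * (((n : ℝ) + 1) * τ.im + z.im) := by
    simp
    ring
  rw [him]
  have h1 : -|z.im| ≤ z.im := neg_abs_le _
  have h0 : 0 ≤ |z.im| := abs_nonneg _
  have hn : (0 : ℝ) ≤ n := Nat.cast_nonneg n
  have hm : (0 : ℝ) ≤ m := Nat.cast_nonneg m
  have h2 : ((n : ℝ) + 1) * δ ≤ ((n : ℝ) + 1) * τ.im + z.im := by nlinarith
  have h3 : ((m : ℝ) + 1) * (((n : ℝ) + 1) * δ) ≤ ((m : ℝ) + 1) * (((n : ℝ) + 1) * τ.im + z.im) :=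
    mul_le_mul_of_nonneg_left h2 (by positivity)
  have h4 : ((n : ℝ) + m) * δ ≤ ((m : ℝ) + 1) * (((n : ℝ) + 1) * δ) := by
    have : 0 ≤ ((n : ℝ) * m + 1) * δ := by positivity
    nlinarith
  have h5 := mul_le_mul_of_nonneg_left (h4.trans h3) Real.two_pi_pos.le
  nlinarith

theorem norm_lambertTerm_le {δ : ℝ} {x : ℂ × ℂ} (hδ : 0 ≤ δ) (h : |x.1.im| + δ ≤ x.2.im) (p : ℕ × ℕ) :
    ‖lambertTerm p x‖ ≤
      2 * (Real.exp (-(2 * Real.pi * δ)) ^ p.1 * Real.exp (-(2 * Real.pi * δ)) ^ p.2) := by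
  have h1 := norm_exp_lambert_le hδ h p.1 p.2
  have h2 := norm_exp_lambert_le (z := -x.1) (τ := x.2) hδ (by simpa using h) p.1 p.2
  rw [mul_neg, ← sub_eq_add_neg] at h2
  rw [lambertTerm, norm_div]
  have h3 : 1 ≤ ‖(p.2 : ℂ) + 1‖ := by
    rw [show (p.2 : ℂ) + 1 = ((p.2 + 1 : ℕ) : ℂ) by push_cast; ring, Complex.norm_natCast]
    exact_mod_cast Nat.le_add_left 1 p.2
  refine (div_le_self (norm_nonneg _) h3).trans ((norm_add_le _ _).trans ?_)
  linarith

theorem summable_lambert_bound {δ : ℝ} (hδ : 0 < δ) :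
    Summable fun p : ℕ × ℕ =>
      2 * (Real.exp (-(2 * Real.pi * δ)) ^ p.1 * Real.exp (-(2 * Real.pi * δ)) ^ p.2) := by
  have hr : Real.exp (-(2 * Real.pi * δ)) < 1 := by
    rw [Real.exp_lt_one_iff]
    have := Real.pi_pos
    have : 0 < 2 * Real.pi * δ := by positivity
    linarith
  have hs := summable_geometric_of_lt_one (Real.exp_pos _).le hr
  exact (hs.mul_of_nonneg hs (fun _ => by positivity) (fun _ => by positivity)).mul_left 2

theorem isOpen_strip (δ : ℝ) : IsOpen {x : ℂ × ℂ | |x.1.im| + δ < x.2.im} :=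
  isOpen_lt (by fun_prop) (by fun_prop)

theorem lambert_locally_bounded {x : ℂ × ℂ} (hx : |x.1.im| < x.2.im) :
    ∃ u : ℕ × ℕ → ℝ, Summable u ∧ ∀ᶠ y in nhds x, ∀ p, ‖lambertTerm p y‖ ≤ u p := by
  set δ := (x.2.im - |x.1.im|) / 2 with hδ
  have hδ0 : 0 < δ := by rw [hδ]; linarith
  refine ⟨_, summable_lambert_bound hδ0, ?_⟩
  filter_upwards [(isOpen_strip δ).mem_nhds (show x ∈ {x : ℂ × ℂ | |x.1.im| + δ < x.2.im} by
    show |x.1.im| + δ < x.2.im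
    rw [hδ]; linarith)] with y hy p
  exact norm_lambertTerm_le hδ0.le (le_of_lt hy) p

theorem analyticAt_lambertTerm (p : ℕ × ℕ) (x : ℂ × ℂ) : AnalyticAt ℂ (lambertTerm p) x := by
  unfold lambertTerm
  have h1 : AnalyticAt ℂ (fun x : ℂ × ℂ => x.1) x := analyticAt_fst
  have h2 : AnalyticAt ℂ (fun x : ℂ × ℂ => x.2) x := analyticAt_snd
  have h3 : (p.2 : ℂ) + 1 ≠ 0 := by exact_mod_cast Nat.succ_ne_zero p.2
  fun_prop (disch := exact h3)

theorem analyticAt_lambertSeries {x : ℂ × ℂ} (hx : |x.1.im| < x.2.im) :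
    AnalyticAt ℂ (fun x : ℂ × ℂ => lambertSeries x.1 x.2) x := by
  have hU : IsOpen {x : ℂ × ℂ | |x.1.im| < x.2.im} := by simpa using isOpen_strip 0
  exact osgoodSpace_complex.prod.analyticOnNhd_tsum (f := lambertTerm) hU
    (fun p x _ => analyticAt_lambertTerm p x) (fun y hy => lambert_locally_bounded hy) x hx

/-- Each `log (1 - x q^n)` is expanded in its Taylor series; summability of the double series
justifies summing over `m` first. -/
theorem poch_eq_exp {q x : ℂ} (hq : ‖q‖ < 1) (hx : ‖x‖ < 1)
    (hs : Summable fun p : ℕ × ℕ => x ^ (p.2 + 1) * q ^ (p.1 * (p.2 + 1)) / ((p.2 : ℂ) + 1)) :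
    poch q x = Complex.exp (-∑' p : ℕ × ℕ, x ^ (p.2 + 1) * q ^ (p.1 * (p.2 + 1)) / ((p.2 : ℂ) + 1)) := by
  have hlt (n : ℕ) : ‖x * q ^ n‖ < 1 := by
    rw [norm_mul, norm_pow]
    exact mul_lt_one_of_nonneg_of_lt_one_left (norm_nonneg _) hx (pow_le_one₀ (norm_nonneg _) hq.le)
  have hlog (n : ℕ) : HasSum (fun m : ℕ => x ^ (m + 1) * q ^ (n * (m + 1)) / ((m : ℂ) + 1))
      (-Complex.log (1 - x * q ^ n)) := by
    have := Complex.hasSum_taylorSeries_neg_log' (hlt n)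
    simpa only [mul_pow, ← pow_mul] using this
  have h1 := hs.hasSum.prod_fiberwise hlog
  have h2 := h1.neg
  simp only [neg_neg] at h2
  rw [← h2.tsum_eq]
  refine (Complex.cexp_tsum_eq_tprod (fun n h0 => ?_) h2.summable).symm
  have : x * q ^ n = 1 := (sub_eq_zero.mp h0).symm
  have h3 := hlt n
  rw [this, norm_one] at h3
  exact lt_irrefl _ h3

theorem norm_qOf_lt_one {τ : ℂ} (hτ : 0 < τ.im) : ‖qOf τ‖ < 1 := by
  rw [qOf, norm_exp_two_pi_I_mul, Real.exp_lt_one_iff]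
  have := Real.two_pi_pos
  have : 0 < 2 * Real.pi * τ.im := by positivity
  linarith

theorem qOf_ne_zero (τ : ℂ) : qOf τ ≠ 0 := Complex.exp_ne_zero _

theorem poch_mul_poch_eq_exp {z τ : ℂ} (h : |z.im| < τ.im) :
    poch (qOf τ) (Complex.exp (2 * Real.pi * Complex.I * z) * qOf τ) *
      poch (qOf τ) ((Complex.exp (2 * Real.pi * Complex.I * z))⁻¹ * qOf τ) =
        Complex.exp (-lambertSeries z τ) := by
  have hτ : 0 < τ.im := (abs_nonneg _).trans_lt h
  have key : ∀ z : ℂ, |z.im| < τ.im →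
      (∀ p : ℕ × ℕ, (Complex.exp (2 * Real.pi * Complex.I * z) * qOf τ) ^ (p.2 + 1) *
        qOf τ ^ (p.1 * (p.2 + 1)) / ((p.2 : ℂ) + 1) = Complex.exp (2 * Real.pi * Complex.I *
          (((p.1 : ℂ) + 1) * ((p.2 : ℂ) + 1) * τ + ((p.2 : ℂ) + 1) * z)) / ((p.2 : ℂ) + 1)) ∧
      (Summable fun p : ℕ × ℕ => Complex.exp (2 * Real.pi * Complex.I *
          (((p.1 : ℂ) + 1) * ((p.2 : ℂ) + 1) * τ + ((p.2 : ℂ) + 1) * z)) / ((p.2 : ℂ) + 1)) ∧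
      ‖Complex.exp (2 * Real.pi * Complex.I * z) * qOf τ‖ < 1 := by
    intro z h
    refine ⟨fun p => ?_, ?_, ?_⟩
    · congr 1
      rw [qOf, ← Complex.exp_add, ← Complex.exp_nat_mul, ← Complex.exp_nat_mul, ← Complex.exp_add]
      congr 1
      push_cast
      ring
    · have hδ : 0 < τ.im - |z.im| := by linarith
      refine Summable.of_norm_bounded (summable_lambert_bound hδ) fun p => ?_
      have h1 := norm_exp_lambert_le (z := z) (τ := τ) hδ.le (by linarith) p.1 p.2
      have h3 : 1 ≤ ‖(p.2 : ℂ) + 1‖ := by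
        rw [show (p.2 : ℂ) + 1 = ((p.2 + 1 : ℕ) : ℂ) by push_cast; ring, Complex.norm_natCast]
        exact_mod_cast Nat.le_add_left 1 p.2
      rw [norm_div]
      refine (div_le_self (norm_nonneg _) h3).trans (h1.trans ?_)
      have : 0 ≤ Real.exp (-(2 * Real.pi * (τ.im - |z.im|))) ^ p.1 *
        Real.exp (-(2 * Real.pi * (τ.im - |z.im|))) ^ p.2 := by positivity
      linarith
    · rw [qOf, ← Complex.exp_add, ← mul_add, norm_exp_two_pi_I_mul, Real.exp_lt_one_iff]
      have h1 : 0 < (z + τ).im := by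
        rw [Complex.add_im]
        linarith [neg_abs_le z.im]
      have := Real.two_pi_pos
      have : 0 < 2 * Real.pi * (z + τ).im := by positivity
      linarith
  have hneg : (Complex.exp (2 * Real.pi * Complex.I * z))⁻¹ =
      Complex.exp (2 * Real.pi * Complex.I * -z) := by
    rw [← Complex.exp_neg, mul_neg]
  obtain ⟨h1, h2, h3⟩ := key z h
  obtain ⟨k1, k2, k3⟩ := key (-z) (by simpa using h)
  have hq := norm_qOf_lt_one hτ
  rw [hneg, poch_eq_exp hq h3 (by simpa only [h1] using h2), poch_eq_exp hq k3 (by simpa only [k1] using k2),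
    ← Complex.exp_add, ← neg_add]
  simp only [h1, k1]
  rw [← h2.tsum_add k2, lambertSeries]
  simp only [lambertTerm, add_div, mul_neg, ← sub_eq_add_neg]

/-- Termwise iterated derivatives of a locally dominated series of holomorphic functions. -/
theorem hasSum_iteratedDeriv {ι : Type*} {U : Set ℂ} (hU : IsOpen U) (k : ℕ) :
    ∀ {F : ι → ℂ → ℂ}, (∀ i, DifferentiableOn ℂ (F i) U) →
      (∀ z ∈ U, ∃ u : ι → ℝ, Summable u ∧ ∀ᶠ y in nhds z, ∀ i, ‖F i y‖ ≤ u i) →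
      ∀ z ∈ U, HasSum (fun i => iteratedDeriv k (F i) z) (iteratedDeriv k (fun y => ∑' i, F i y) z) := by
  induction k with
  | zero =>
    intro F _ hb z hz
    obtain ⟨u, hu, h⟩ := hb z hz
    simpa using (Summable.of_norm_bounded hu h.self_of_nhds).hasSum
  | succ k ih =>
    intro F hF hb z hz
    have hsum : ∀ y ∈ U, HasSum (fun i => deriv (F i) y) (deriv (fun y => ∑' i, F i y) y) := by
      intro y hy
      obtain ⟨u, hu, h⟩ := hb y hy
      obtain ⟨V, hV, hVo, hyV⟩ := eventually_nhds_iff.mp h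
      exact Complex.hasSum_deriv_of_summable_norm hu (fun i => (hF i).mono Set.inter_subset_left)
        (hU.inter hVo) (fun i w hw => hV w hw.2 i) ⟨hy, hyV⟩
    have hmain := ih (F := fun i => deriv (F i)) (fun i => (hF i).deriv hU) (fun y hy => by
      obtain ⟨u, hu, h⟩ := hb y hy
      obtain ⟨ε, hε, hball⟩ := Metric.eventually_nhds_iff_ball.mp (h.and (hU.mem_nhds hy))
      refine ⟨fun i => u i / (ε / 2), hu.div_const _, ?_⟩
      filter_upwards [Metric.ball_mem_nhds y (show 0 < ε / 2 by positivity)] with w hw i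
      have hsub : Metric.closedBall w (ε / 2) ⊆ Metric.ball y ε := by
        intro v hv
        rw [Metric.mem_ball] at hw ⊢
        rw [Metric.mem_closedBall] at hv
        linarith [dist_triangle v w y]
      refine Complex.norm_deriv_le_of_forall_mem_sphere_norm_le (by positivity) ?_ fun v hv => ?_
      · refine (DifferentiableOn.mono (hF i) fun v hv => ?_).diffContOnCl
        rw [closure_ball _ (by positivity)] at hv
        exact (hball v (hsub hv)).2
      · exact (hball v (hsub (Metric.sphere_subset_closedBall hv))).1 i) z hz
    simp only [iteratedDeriv_succ']
    have he : deriv (fun y => ∑' i, F i y) =ᶠ[nhds z] fun y => ∑' i, deriv (F i) y := by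
      filter_upwards [hU.mem_nhds hz] with y hy
      exact (hsum y hy).tsum_eq.symm
    rw [he.iteratedDeriv_eq k]
    exact hmain

theorem iteratedDeriv_lambertTerm (k : ℕ) (p : ℕ × ℕ) (τ : ℂ) :
    iteratedDeriv k (fun z => lambertTerm p (z, τ)) 0 =
      (2 * Real.pi * Complex.I) ^ k * (((p.2 : ℂ) + 1) ^ k / ((p.2 : ℂ) + 1)) * (1 + (-1) ^ k) *
        qOf τ ^ ((p.1 + 1) * (p.2 + 1)) := by
  have hm : (p.2 : ℂ) + 1 ≠ 0 := by exact_mod_cast Nat.succ_ne_zero p.2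
  have h1 : (fun z => lambertTerm p (z, τ)) = fun z =>
      qOf τ ^ ((p.1 + 1) * (p.2 + 1)) / ((p.2 : ℂ) + 1) *
        (Complex.exp ((2 * Real.pi * Complex.I * ((p.2 : ℂ) + 1)) * z) +
          Complex.exp (-(2 * Real.pi * Complex.I * ((p.2 : ℂ) + 1)) * z)) := by
    ext z
    have e : qOf τ ^ ((p.1 + 1) * (p.2 + 1)) =
        Complex.exp (2 * Real.pi * Complex.I * (((p.1 : ℂ) + 1) * ((p.2 : ℂ) + 1) * τ)) := by
      rw [qOf, ← Complex.exp_nat_mul]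
      congr 1; push_cast; ring
    have e1 : ∀ s x y : ℂ, s = x + y → Complex.exp s = Complex.exp x * Complex.exp y := by
      rintro s x y rfl
      exact Complex.exp_add x y
    rw [lambertTerm, e, div_mul_eq_mul_div, mul_add (Complex.exp _)]
    congr 2
    · exact e1 _ _ _ (by ring)
    · exact e1 _ _ _ (by ring)
  have h2 (c : ℂ) : iteratedDeriv k (fun z : ℂ => Complex.exp (c * z)) 0 = c ^ k := by
    rw [iteratedDeriv_comp_mul_left, iteratedDeriv_eq_iterate, Complex.iter_deriv_exp]
    simp
  rw [h1, iteratedDeriv_const_mul_field, iteratedDeriv_fun_add (by fun_prop) (by fun_prop), h2, h2,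
    neg_pow (2 * Real.pi * Complex.I * ((p.2 : ℂ) + 1)), mul_pow]
  field_simp

/-- Termwise differentiation produces `∑ m^(k-1) q^(nm)`, and collecting equal products `nm` gives
divisor sums. For odd `k` the contributions of `ζ^m` and `ζ^(-m)` cancel. -/
theorem iteratedDeriv_lambertSeries {k : ℕ} (hk : 1 ≤ k) {τ : ℂ} (hτ : 0 < τ.im) :
    iteratedDeriv k (fun z => lambertSeries z τ) 0 = (2 * Real.pi * Complex.I) ^ k * (1 + (-1) ^ k) *
      ∑' n : ℕ, (ArithmeticFunction.sigma (k - 1) (n + 1) : ℂ) * qOf τ ^ (n + 1) := by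
  have hU : IsOpen {z : ℂ | |z.im| < τ.im} := isOpen_lt (by fun_prop) (by fun_prop)
  have h := hasSum_iteratedDeriv hU k (F := fun p z => lambertTerm p (z, τ))
    (fun p z _ => ((analyticAt_lambertTerm p (z, τ)).differentiableAt.fun_comp' z
      (by fun_prop : DifferentiableAt ℂ (fun z : ℂ => (z, τ)) z)).differentiableWithinAt)
    (fun z hz => by
      obtain ⟨u, hu, hb⟩ := lambert_locally_bounded (x := (z, τ)) hz
      refine ⟨u, hu, ?_⟩
      have hc : ContinuousAt (fun z : ℂ => (z, τ)) z := by fun_prop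
      exact hc.eventually hb) 0 (by simpa using hτ)
  have h' : iteratedDeriv k (fun z => lambertSeries z τ) 0 = _ := h.tsum_eq.symm
  rw [h']
  simp only [iteratedDeriv_lambertTerm]
  have hq := norm_qOf_lt_one hτ
  have e1 (p : ℕ × ℕ) : (2 * Real.pi * Complex.I) ^ k * (((p.2 : ℂ) + 1) ^ k / ((p.2 : ℂ) + 1)) *
      (1 + (-1) ^ k) * qOf τ ^ ((p.1 + 1) * (p.2 + 1)) = (2 * Real.pi * Complex.I) ^ k * (1 + (-1) ^ k) *
        (((p.2 : ℂ) + 1) ^ (k - 1) * qOf τ ^ ((p.1 + 1) * (p.2 + 1))) := by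
    have hm : (p.2 : ℂ) + 1 ≠ 0 := by exact_mod_cast Nat.succ_ne_zero p.2
    obtain ⟨j, rfl⟩ : ∃ j, k = j + 1 := ⟨k - 1, by omega⟩
    rw [pow_succ ((p.2 : ℂ) + 1), mul_div_cancel_right₀ _ hm, Nat.add_sub_cancel]
    ring
  simp only [e1]
  rw [tsum_mul_left]
  congr 1
  have hs := summable_prod_mul_pow (k - 1) hq
  have e2 := tsum_prod_pow_eq_tsum_sigma (k - 1) hq
  rw [← hs.tsum_prod, tsum_pnat_eq_tsum_succ
    (f := fun e : ℕ => (ArithmeticFunction.sigma (k - 1) e : ℂ) * qOf τ ^ e)] at e2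
  rw [← e2, ← (Equiv.prodCongr Equiv.pnatEquivNat Equiv.pnatEquivNat).tsum_eq
    (fun p : ℕ × ℕ => ((p.2 : ℂ) + 1) ^ (k - 1) * qOf τ ^ ((p.1 + 1) * (p.2 + 1)))]
  refine tsum_congr fun c => ?_
  have h3 (a : ℕ+) : Equiv.pnatEquivNat a + 1 = (a : ℕ) := by
    simp [Equiv.pnatEquivNat]
  have h4 (a : ℕ+) : ((Equiv.pnatEquivNat a : ℕ) : ℂ) + 1 = (a : ℂ) := by
    exact_mod_cast h3 a
  simp only [Equiv.prodCongr_apply, Prod.map_fst, Prod.map_snd, h3, h4]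

/-- The quotient of `(ζ q; q)_∞ (ζ⁻¹ q; q)_∞` at `ζ = 1` by its value at `ζ = exp (2 π i z)`, divided by
`sin (π z) / (π z)`. -/
def eisExp (z τ : ℂ) : ℂ := Complex.exp (lambertSeries z τ - lambertSeries 0 τ) / sincPi z

/-- Multiplying by `sincPi` leaves the exponential of the Lambert series. That series supplies the
divisor sums, and removing `sincPi` again subtracts `B_k / k`, twice the constant term of `G_k`. For
odd `k` nothing remains: `B_k = 0` if `k ≥ 3`, while `B_1 = -1/2` cancels the extra `1/2`. -/
theorem expTaylorCoeff_eisExp {k : ℕ} (hk : 1 ≤ k) {τ : ℂ} (hτ : 0 < τ.im) :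
    expTaylorCoeff (fun z => eisExp z τ) k = 2 * G k τ := by
  have hM : AnalyticAt ℂ (fun z => lambertSeries z τ) 0 :=
    (analyticAt_lambertSeries (x := (0, τ)) (by simpa using hτ)).comp₂ analyticAt_id analyticAt_const
  have hS := analyticAt_sincPi 0
  have hS0 : sincPi 0 ≠ 0 := by rw [sincPi_zero]; exact one_ne_zero
  have hE : AnalyticAt ℂ (fun z => eisExp z τ) 0 := by
    unfold eisExp
    exact ((hM.sub analyticAt_const).cexp).div hS hS0
  have hE0 : eisExp 0 τ ≠ 0 := by simp [eisExp, sincPi_zero]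
  have h1 := expTaylorCoeff_mul hS hS0 hE hE0 hk
  have h2 : (fun z => sincPi z * eisExp z τ) =ᶠ[nhds 0] fun z =>
      Complex.exp (-lambertSeries 0 τ + lambertSeries z τ) := by
    filter_upwards [hS.continuousAt.eventually_ne hS0] with z hz
    rw [eisExp, mul_div_cancel₀ _ hz]
    congr 1; ring
  rw [expTaylorCoeff_congr h2, expTaylorCoeff_exp (Q := fun z => -lambertSeries 0 τ + lambertSeries z τ)
    (continuousAt_const.add hM.continuousAt) hk,
    expTaylorCoeff_sincPi hk] at h1
  have h3 : iteratedDeriv k (fun z => -lambertSeries 0 τ + lambertSeries z τ) 0 =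
      iteratedDeriv k (fun z => lambertSeries z τ) 0 := by
    rw [iteratedDeriv_const_add (by omega)]
  have hpi : (2 * Real.pi * Complex.I : ℂ) ≠ 0 := Complex.two_pi_I_ne_zero
  rw [h3, iteratedDeriv_lambertSeries hk hτ, mul_assoc, mul_div_cancel_left₀ _ (pow_ne_zero k hpi)] at h1
  have hk0 : (k : ℂ) ≠ 0 := by exact_mod_cast (by omega : k ≠ 0)
  rw [← sub_eq_iff_eq_add'] at h1
  rw [← h1, G]
  by_cases hev : Even k
  · have hk1 : k ≠ 1 := by rintro rfl; exact absurd hev (by decide)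
    rw [if_pos hev, if_neg hk1, hev.neg_one_pow]
    field_simp
    ring
  · rw [if_neg hev, (Nat.not_even_iff_odd.mp hev).neg_one_pow]
    by_cases hk1 : k = 1
    · subst hk1; norm_num
    · have : bernoulli k = 0 := by
        rw [bernoulli_eq_bernoulli'_of_ne_one hk1]
        exact bernoulli'_eq_zero_of_odd (Nat.not_even_iff_odd.mp hev) (by omega)
      rw [this, if_neg hk1]; simp

/-! ### The even part of the error function -/

/-- The entire function with `erf z = z * erfEven (z ^ 2)`. -/
def erfEven (y : ℂ) : ℂ :=
  2 / (Real.sqrt Real.pi : ℂ) * ∫ t in (0 : ℝ)..1, Complex.exp (-(y * (t : ℂ) ^ 2))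

theorem erf_eq_mul_erfEven (z : ℂ) : erf z = z * erfEven (z ^ 2) := by
  rw [erf, erfEven, mul_left_comm]
  simp only [mul_pow]

theorem norm_exp_neg_mul_sq_le (y : ℂ) {t : ℝ} (h0 : 0 ≤ t) (h1 : t ≤ 1) :
    ‖Complex.exp (-(y * (t : ℂ) ^ 2))‖ ≤ 1 + Real.exp (-y.re) := by
  have hre : (-(y * (t : ℂ) ^ 2)).re = -(y.re * t ^ 2) := by
    rw [← Complex.ofReal_pow, Complex.neg_re, Complex.re_mul_ofReal]
  rw [Complex.norm_exp, hre]
  rcases le_or_gt 0 y.re with h | h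
  · have : Real.exp (-(y.re * t ^ 2)) ≤ 1 := by
      rw [Real.exp_le_one_iff]
      have : 0 ≤ y.re * t ^ 2 := by positivity
      linarith
    linarith [Real.exp_pos (-y.re)]
  · have : Real.exp (-(y.re * t ^ 2)) ≤ Real.exp (-y.re) := by
      apply Real.exp_le_exp.mpr
      nlinarith [pow_le_one₀ (n := 2) h0 h1]
    linarith

theorem norm_erfEven_le (y : ℂ) : ‖erfEven y‖ ≤ 2 * (1 + Real.exp (-y.re)) := by
  have h1 : ‖∫ t in (0 : ℝ)..1, Complex.exp (-(y * (t : ℂ) ^ 2))‖ ≤ (1 + Real.exp (-y.re)) * |1 - 0| := by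
    refine intervalIntegral.norm_integral_le_of_norm_le_const fun t ht => ?_
    rw [Set.uIoc_of_le zero_le_one] at ht
    exact norm_exp_neg_mul_sq_le y ht.1.le ht.2
  have h2 : ‖(2 / (Real.sqrt Real.pi : ℂ))‖ ≤ 2 := by
    rw [norm_div, Complex.norm_real, Complex.norm_ofNat, Real.norm_of_nonneg (Real.sqrt_nonneg _)]
    apply div_le_self (by norm_num)
    rw [Real.one_le_sqrt]
    linarith [Real.pi_gt_three]
  rw [erfEven, norm_mul]
  refine mul_le_mul h2 (by simpa using h1) (norm_nonneg _) (by norm_num)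

theorem hasDerivAt_erfEven (y : ℂ) :
    HasDerivAt erfEven (2 / (Real.sqrt Real.pi : ℂ) *
      ∫ t in (0 : ℝ)..1, -((t : ℂ) ^ 2) * Complex.exp (-(y * (t : ℂ) ^ 2))) y := by
  refine HasDerivAt.const_mul _ ?_
  refine (intervalIntegral.hasDerivAt_integral_of_dominated_loc_of_deriv_le
    (F := fun (y : ℂ) (t : ℝ) => Complex.exp (-(y * (t : ℂ) ^ 2)))
    (F' := fun (y : ℂ) (t : ℝ) => -((t : ℂ) ^ 2) * Complex.exp (-(y * (t : ℂ) ^ 2)))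
    (s := Metric.ball y 1) (bound := fun _ => 1 + Real.exp (‖y‖ + 1))
    (Metric.ball_mem_nhds y one_pos) ?_ ?_ ?_ ?_ ?_ ?_).2
  · exact Filter.Eventually.of_forall fun y => Continuous.aestronglyMeasurable (by fun_prop)
  · exact Continuous.intervalIntegrable (by fun_prop) _ _
  · exact Continuous.aestronglyMeasurable (by fun_prop)
  · refine Filter.Eventually.of_forall fun t ht x hx => ?_
    rw [Set.uIoc_of_le zero_le_one] at ht
    have h1 := norm_exp_neg_mul_sq_le x ht.1.le ht.2
    have h2 : ‖-((t : ℂ) ^ 2)‖ ≤ 1 := by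
      rw [norm_neg, norm_pow, Complex.norm_real, Real.norm_of_nonneg ht.1.le]
      exact pow_le_one₀ ht.1.le ht.2
    have h3 : Real.exp (-x.re) ≤ Real.exp (‖y‖ + 1) := by
      apply Real.exp_le_exp.mpr
      have e1 : -x.re ≤ ‖x‖ := (neg_le_abs _).trans (Complex.abs_re_le_norm x)
      have e2 : ‖x‖ ≤ ‖y‖ + ‖x - y‖ := by simpa using norm_add_le y (x - y)
      rw [Metric.mem_ball, dist_eq_norm] at hx
      linarith
    rw [norm_mul]
    calc _ ≤ 1 * (1 + Real.exp (-x.re)) := mul_le_mul h2 h1 (norm_nonneg _) zero_le_one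
      _ ≤ _ := by linarith
  · exact intervalIntegrable_const
  · refine Filter.Eventually.of_forall fun t _ x _ => ?_
    have h : HasDerivAt (fun x : ℂ => -(x * (t : ℂ) ^ 2)) (-(1 * (t : ℂ) ^ 2)) x :=
      ((hasDerivAt_id x).mul_const _).neg
    have h2 := h.cexp
    rw [one_mul, mul_comm] at h2
    exact h2

theorem differentiable_erfEven : Differentiable ℂ erfEven :=
  fun y => (hasDerivAt_erfEven y).differentiableAt

/-- In `y = z²` this is `erf' z = 2/√π exp(-z²)`. The two integrands add up to the derivative of `t
exp(-y t²)`, so only the boundary value at `1` survives. -/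
theorem erfEven_add_deriv (y : ℂ) :
    erfEven y + 2 * y * deriv erfEven y = 2 / (Real.sqrt Real.pi : ℂ) * Complex.exp (-y) := by
  rw [(hasDerivAt_erfEven y).deriv, erfEven]
  have hF : ∀ t : ℝ, HasDerivAt (fun t : ℝ => (t : ℂ) * Complex.exp (-(y * (t : ℂ) ^ 2)))
      (Complex.exp (-(y * (t : ℂ) ^ 2)) +
        2 * y * (-((t : ℂ) ^ 2) * Complex.exp (-(y * (t : ℂ) ^ 2)))) t := by
    intro t
    have h0 : HasDerivAt (fun t : ℂ => t * Complex.exp (-(y * t ^ 2)))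
        (1 * Complex.exp (-(y * (t : ℂ) ^ 2)) + (t : ℂ) * (Complex.exp (-(y * (t : ℂ) ^ 2)) *
          -(y * ((2 : ℕ) * (t : ℂ) ^ (2 - 1) * 1)))) (t : ℂ) := by
      have e := (((hasDerivAt_id (t : ℂ)).pow 2).const_mul y).neg.cexp
      exact (hasDerivAt_id (t : ℂ)).mul e
    convert h0.comp_ofReal using 1
    push_cast
    ring
  have hint := intervalIntegral.integral_eq_sub_of_hasDerivAt (a := 0) (b := 1) (fun t _ => hF t)
    (Continuous.intervalIntegrable (by fun_prop) _ _)
  rw [intervalIntegral.integral_add (Continuous.intervalIntegrable (by fun_prop) _ _)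
    (Continuous.intervalIntegrable (by fun_prop) _ _), intervalIntegral.integral_const_mul] at hint
  simp only [Complex.ofReal_one, one_pow, mul_one, one_mul, Complex.ofReal_zero, zero_mul, sub_zero] at hint
  rw [← hint]
  ring

/-! ### The holomorphic function underlying `ψ̂` -/

/-- The terms of `psiCore`, as functions of `(a, z, τ, w)`. -/
def psiTerm (n : ℤ) (x : ℂ × ℂ × ℂ × ℂ) : ℂ :=
  ((n : ℂ) + 1 / 2 + x.1) *
    erfEven (-(Real.pi * Complex.I * (x.2.2.2 - x.2.2.1) * ((n : ℂ) + 1 / 2 + x.1) ^ 2)) * (-1 : ℂ) ^ n *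
    Complex.exp (Real.pi * Complex.I * ((n : ℂ) + 1 / 2) ^ 2 * x.2.2.1 +
      2 * Real.pi * Complex.I * ((n : ℂ) + 1 / 2) * x.2.1)

/-- `ψ̂` divided by `-i √(π i (w - τ))`, with `z₂ / τ₂` replaced by an independent variable `a`. -/
def psiCore (a z τ w : ℂ) : ℂ := Complex.I * ∑' n : ℤ, psiTerm n (a, z, τ, w)

theorem csqrt_sq (x : ℂ) : csqrt x ^ 2 = x := by
  have h := Complex.cpow_nat_inv_pow x two_ne_zero
  rw [csqrt, one_div]
  exact_mod_cast h

/-- Since `erf` is odd, one factor of the square root comes out of the series and the rest depends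
only on its square. No branch remains in `psiCore`, which is also defined at `w = τ`. -/
theorem psiHat_eq (z z' τ w : ℂ) :
    psiHat z z' τ w = -Complex.I * csqrt (Real.pi * Complex.I * (w - τ)) *
      psiCore ((z - z') / (2 * Complex.I) / (τ.im : ℂ)) z τ w := by
  rw [psiHat, psiCore, mul_left_comm (-Complex.I * _)]
  congr 1
  rw [← tsum_mul_left]
  refine tsum_congr fun n => ?_
  rw [erf_eq_mul_erfEven, mul_pow, mul_pow, csqrt_sq, neg_sq, Complex.I_sq, psiTerm, Complex.exp_add]
  ring_nf

theorem norm_neg_one_zpow_complex (n : ℤ) : ‖(-1 : ℂ) ^ n‖ = 1 := by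
  rw [norm_zpow, norm_neg, norm_one, one_zpow]

theorem gaussian_le {δ B x : ℝ} (hδ : 0 < δ) :
    -(δ * x ^ 2) + B * x ≤ (B + 1) ^ 2 / (4 * δ) - x := by
  have h : (B + 1) ^ 2 / (4 * δ) - x - (-(δ * x ^ 2) + B * x) = (2 * δ * x - (B + 1)) ^ 2 / (4 * δ) := by
    field_simp
    ring
  have h2 : 0 ≤ (2 * δ * x - (B + 1)) ^ 2 / (4 * δ) := by positivity
  linarith

/-- The bound `2 (1 + exp(-Re y))` for `erfEven` gives two terms. The first keeps the Gaussian decay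
from `Im τ`; in the second the exponential trades `Im τ` for `Im w` in the leading quadratic term.
Both Gaussians beat the linear exponents by completing the square (`gaussian_le`). -/
theorem norm_psiTerm_le {R δ : ℝ} (hδ : 0 < δ) {a z τ w : ℂ} (ha : ‖a‖ ≤ R) (hz : ‖z‖ ≤ R)
    (hτ : ‖τ‖ ≤ R) (hw : ‖w‖ ≤ R) (hτ' : δ ≤ τ.im) (hw' : δ ≤ w.im) (n : ℤ) :
    ‖psiTerm n (a, z, τ, w)‖ ≤ 4 * Real.exp (R + 2 * Real.pi * R ^ 3 + 1 / 2 +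
      (2 * Real.pi * (2 * R ^ 2 + R) + 1 + 1) ^ 2 / (4 * (Real.pi * δ))) * Real.exp (-|(n : ℝ)|) := by
  have hpi := Real.pi_pos
  have hR : 0 ≤ R := (norm_nonneg _).trans ha
  set ν : ℝ := (n : ℝ) + 1 / 2 with hν
  have hνc : (n : ℂ) + 1 / 2 = (ν : ℂ) := by rw [hν]; push_cast; ring
  set B := 2 * Real.pi * (2 * R ^ 2 + R) with hB
  have hX : ‖(ν : ℂ) + a‖ ≤ Real.exp (|ν| + R) := by
    refine (norm_add_le _ _).trans ?_
    rw [Complex.norm_real, Real.norm_eq_abs]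
    linarith [Real.add_one_le_exp (|ν| + R)]
  have hexp : ∀ s : ℝ, -(Real.pi * δ * |ν| ^ 2) + B * |ν| + 2 * Real.pi * R ^ 3 ≥ s →
      Real.exp (|ν| + R) * Real.exp s ≤ Real.exp (R + 2 * Real.pi * R ^ 3 + 1 / 2 +
      (B + 1 + 1) ^ 2 / (4 * (Real.pi * δ))) * Real.exp (-|(n : ℝ)|) := by
    intro s hs
    rw [← Real.exp_add, ← Real.exp_add]
    apply Real.exp_le_exp.mpr
    have h1 := gaussian_le (δ := Real.pi * δ) (B := B + 1) (x := |ν|) (by positivity)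
    have h2 : |(n : ℝ)| ≤ |ν| + 1 / 2 := by
      have : (n : ℝ) = ν - 1 / 2 := by rw [hν]; ring
      rw [this]
      refine (abs_sub _ _).trans ?_
      rw [abs_of_nonneg (by norm_num : (0 : ℝ) ≤ 1 / 2)]
    linarith
  have hB1 : 2 * Real.pi * R ≤ B := by
    rw [hB]; nlinarith [sq_nonneg R]
  have him : ∀ x : ℂ, ∀ r : ℝ, ‖x‖ ≤ r → -r ≤ x.im ∧ x.im ≤ r := fun x r h =>
    abs_le.mp ((Complex.abs_im_le_norm x).trans h)
  have hmul : ∀ t r : ℝ, -r ≤ t → t ≤ r → -(ν * t) ≤ |ν| * r := fun t r h1 h2 => by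
    have e1 : -(ν * t) ≤ |ν * t| := neg_le_abs _
    rw [abs_mul] at e1
    exact e1.trans (mul_le_mul_of_nonneg_left (abs_le.mpr ⟨h1, h2⟩) (abs_nonneg _))
  have hsq : |ν| ^ 2 = ν ^ 2 := sq_abs ν
  have hν0 : 0 ≤ |ν| := abs_nonneg ν
  have hν2 : 0 ≤ ν ^ 2 := sq_nonneg ν
  have hwτ : ‖w - τ‖ ≤ 2 * R := (norm_sub_le _ _).trans (by linarith)
  -- the two Gaussian factors
  have key1 : ‖Complex.exp (Real.pi * Complex.I * (ν : ℂ) ^ 2 * τ + 2 * Real.pi * Complex.I * ν * z)‖ =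
      Real.exp (-(Real.pi * ν ^ 2 * τ.im) - 2 * Real.pi * (ν * z.im)) := by
    rw [Complex.norm_exp]
    congr 1
    have : Real.pi * Complex.I * (ν : ℂ) ^ 2 * τ + 2 * Real.pi * Complex.I * ν * z =
      ((Real.pi * ν ^ 2 : ℝ) : ℂ) * (τ * Complex.I) + ((2 * Real.pi * ν : ℝ) : ℂ) * (z * Complex.I) := by
      push_cast; ring
    rw [this, Complex.add_re, Complex.re_ofReal_mul, Complex.re_ofReal_mul, Complex.mul_I_re,
      Complex.mul_I_re]
    ring
  have key2 : Real.exp (-(-(Real.pi * Complex.I * (w - τ) * ((ν : ℂ) + a) ^ 2)).re) *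
      Real.exp (-(Real.pi * ν ^ 2 * τ.im) - 2 * Real.pi * (ν * z.im)) =
      Real.exp (-(Real.pi * ν ^ 2 * w.im) - 2 * Real.pi * (ν * ((w - τ) * a + z).im) -
        Real.pi * ((w - τ) * a ^ 2).im) := by
    rw [← Real.exp_add]
    congr 1
    have : -(Real.pi * Complex.I * (w - τ) * ((ν : ℂ) + a) ^ 2) =
      -(((Real.pi * ν ^ 2 : ℝ) : ℂ) * ((w - τ) * Complex.I) +
        ((2 * Real.pi * ν : ℝ) : ℂ) * ((w - τ) * a * Complex.I) +
        (Real.pi : ℂ) * ((w - τ) * a ^ 2 * Complex.I)) := by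
      push_cast; ring
    rw [this, Complex.neg_re, Complex.add_re, Complex.add_re, Complex.re_ofReal_mul,
      Complex.re_ofReal_mul, Complex.re_ofReal_mul, Complex.mul_I_re, Complex.mul_I_re, Complex.mul_I_re,
      Complex.add_im, Complex.sub_im]
    ring
  have b1 := hexp (-(Real.pi * ν ^ 2 * τ.im) - 2 * Real.pi * (ν * z.im)) (by
    have h1 := hmul z.im R (him z R hz).1 (him z R hz).2
    have h2 : Real.pi * ν ^ 2 * δ ≤ Real.pi * ν ^ 2 * τ.im :=
      mul_le_mul_of_nonneg_left hτ' (by positivity)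
    have h3 : 2 * Real.pi * -(ν * z.im) ≤ 2 * Real.pi * (|ν| * R) :=
      mul_le_mul_of_nonneg_left h1 (by positivity)
    have h4 : 2 * Real.pi * R * |ν| ≤ B * |ν| := mul_le_mul_of_nonneg_right hB1 hν0
    have h5 : 0 ≤ 2 * Real.pi * R ^ 3 := by positivity
    rw [hsq]
    linarith)
  have b2 := hexp (-(Real.pi * ν ^ 2 * w.im) - 2 * Real.pi * (ν * ((w - τ) * a + z).im) -
        Real.pi * ((w - τ) * a ^ 2).im) (by
    have n1 : ‖(w - τ) * a + z‖ ≤ 2 * R ^ 2 + R := by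
      refine (norm_add_le _ _).trans ?_
      rw [norm_mul]
      have := mul_le_mul hwτ ha (norm_nonneg _) (by positivity)
      nlinarith
    have n2 : ‖(w - τ) * a ^ 2‖ ≤ 2 * R ^ 3 := by
      rw [norm_mul, norm_pow]
      have := mul_le_mul hwτ (pow_le_pow_left₀ (norm_nonneg _) ha 2) (by positivity) (by positivity)
      nlinarith
    have h1 := hmul _ _ (him _ _ n1).1 (him _ _ n1).2
    have h2 : Real.pi * ν ^ 2 * δ ≤ Real.pi * ν ^ 2 * w.im :=
      mul_le_mul_of_nonneg_left hw' (by positivity)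
    have h3 := mul_le_mul_of_nonneg_left h1 Real.two_pi_pos.le
    have h5 := mul_le_mul_of_nonneg_left (him _ _ n2).1 hpi.le
    rw [hsq, hB]
    linarith)
  simp only [psiTerm, hνc]
  rw [norm_mul, norm_mul, norm_mul, norm_neg_one_zpow_complex, mul_one, key1]
  have h6 := norm_erfEven_le (-(Real.pi * Complex.I * (w - τ) * ((ν : ℂ) + a) ^ 2))
  refine (mul_le_mul_of_nonneg_right (mul_le_mul hX h6 (norm_nonneg _) (Real.exp_pos _).le)
    (Real.exp_pos _).le).trans ?_
  have h7 : ∀ e y g : ℝ, e * (2 * (1 + y)) * g = 2 * (e * g) + 2 * (e * (y * g)) := fun _ _ _ => by ring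
  rw [h7, key2]
  linarith

theorem summable_exp_neg_abs_int : Summable fun n : ℤ => Real.exp (-|(n : ℝ)|) := by
  have h : Summable fun n : ℕ => Real.exp (-(n : ℝ)) := Real.summable_exp_neg_nat
  refine Summable.of_nat_of_neg ?_ ?_
  · simpa using h
  · simpa using h

/-- The domain of holomorphy of `psiCore`. -/
def psiDomain : Set (ℂ × ℂ × ℂ × ℂ) := {x | 0 < x.2.2.1.im ∧ 0 < x.2.2.2.im}

theorem isOpen_psiDomain : IsOpen psiDomain :=
  IsOpen.inter (s := {x : ℂ × ℂ × ℂ × ℂ | 0 < x.2.2.1.im}) (t := {x : ℂ × ℂ × ℂ × ℂ | 0 < x.2.2.2.im})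
    (isOpen_lt continuous_const (by fun_prop)) (isOpen_lt continuous_const (by fun_prop))

theorem psiTerm_locally_bounded {x : ℂ × ℂ × ℂ × ℂ} (hx : x ∈ psiDomain) :
    ∃ u : ℤ → ℝ, Summable u ∧ ∀ᶠ y in nhds x, ∀ n, ‖psiTerm n y‖ ≤ u n := by
  obtain ⟨h1, h2⟩ := hx
  refine ⟨_, summable_exp_neg_abs_int.mul_left (4 * Real.exp ((‖x‖ + 1) + 2 * Real.pi * (‖x‖ + 1) ^ 3 +
    1 / 2 + (2 * Real.pi * (2 * (‖x‖ + 1) ^ 2 + (‖x‖ + 1)) + 1 + 1) ^ 2 /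
      (4 * (Real.pi * (min x.2.2.1.im x.2.2.2.im / 2))))), ?_⟩
  have hδ : 0 < min x.2.2.1.im x.2.2.2.im / 2 := by
    have := lt_min h1 h2
    linarith
  have e1 : ∀ᶠ y in nhds x, ‖y‖ < ‖x‖ + 1 :=
    continuous_norm.continuousAt.eventually_lt continuousAt_const (by linarith)
  have e2 : ∀ᶠ y : ℂ × ℂ × ℂ × ℂ in nhds x, min x.2.2.1.im x.2.2.2.im / 2 < y.2.2.1.im :=
    continuousAt_const.eventually_lt (by fun_prop) (by linarith [min_le_left x.2.2.1.im x.2.2.2.im])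
  have e3 : ∀ᶠ y : ℂ × ℂ × ℂ × ℂ in nhds x, min x.2.2.1.im x.2.2.2.im / 2 < y.2.2.2.im :=
    continuousAt_const.eventually_lt (by fun_prop) (by linarith [min_le_right x.2.2.1.im x.2.2.2.im])
  filter_upwards [e1, e2, e3] with y y1 y2 y3 n
  have c0 := norm_fst_le y
  have c1 := norm_snd_le y
  have c2 := norm_snd_le y.2
  have c3 := norm_fst_le y.2
  have c4 := norm_snd_le y.2.2
  have c5 := norm_fst_le y.2.2
  exact norm_psiTerm_le hδ (by linarith) (by linarith) (by linarith) (by linarith) y2.le y3.le n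

theorem analyticAt_psiTerm (n : ℤ) (x : ℂ × ℂ × ℂ × ℂ) : AnalyticAt ℂ (psiTerm n) x := by
  unfold psiTerm
  have h1 : AnalyticAt ℂ (fun x : ℂ × ℂ × ℂ × ℂ => x.1) x := analyticAt_fst
  have h2 : AnalyticAt ℂ (fun x : ℂ × ℂ × ℂ × ℂ => x.2.1) x := analyticAt_fst.fun_comp analyticAt_snd
  have h3 : AnalyticAt ℂ (fun x : ℂ × ℂ × ℂ × ℂ => x.2.2.1) x :=
    analyticAt_fst.fun_comp (analyticAt_snd.fun_comp analyticAt_snd)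
  have h4 : AnalyticAt ℂ (fun x : ℂ × ℂ × ℂ × ℂ => x.2.2.2) x :=
    analyticAt_snd.fun_comp (analyticAt_snd.fun_comp analyticAt_snd)
  have h5 : AnalyticAt ℂ (fun x : ℂ × ℂ × ℂ × ℂ =>
      -(Real.pi * Complex.I * (x.2.2.2 - x.2.2.1) * ((n : ℂ) + 1 / 2 + x.1) ^ 2)) x := by fun_prop
  have h6 : AnalyticAt ℂ (fun x : ℂ × ℂ × ℂ × ℂ => erfEven
      (-(Real.pi * Complex.I * (x.2.2.2 - x.2.2.1) * ((n : ℂ) + 1 / 2 + x.1) ^ 2))) x :=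
    (differentiable_erfEven.analyticAt _).fun_comp h5
  exact (((analyticAt_const.add h1).mul h6).mul analyticAt_const).mul (by fun_prop)

theorem summable_psiTerm {x : ℂ × ℂ × ℂ × ℂ} (hx : x ∈ psiDomain) : Summable fun n => psiTerm n x := by
  obtain ⟨u, hu, hb⟩ := psiTerm_locally_bounded hx
  exact Summable.of_norm_bounded hu hb.self_of_nhds

theorem analyticAt_psiCore {x : ℂ × ℂ × ℂ × ℂ} (hx : x ∈ psiDomain) :
    AnalyticAt ℂ (fun x : ℂ × ℂ × ℂ × ℂ => psiCore x.1 x.2.1 x.2.2.1 x.2.2.2) x := by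
  unfold psiCore
  exact analyticAt_const.mul (osgoodSpace_complex.prod.prod.prod.analyticOnNhd_tsum isOpen_psiDomain
    (fun n x _ => analyticAt_psiTerm n x) (fun y hy => psiTerm_locally_bounded hy) x hx)

/-- Under `n ↦ -1 - n` the linear factor and `(-1)^n` both change sign. -/
theorem psiCore_neg {τ w : ℂ} (a z : ℂ) : psiCore (-a) (-z) τ w = psiCore a z τ w := by
  rw [psiCore, psiCore, ← (Equiv.subLeft (-1 : ℤ)).tsum_eq]
  congr 1
  refine tsum_congr fun n => ?_
  simp only [psiTerm, Equiv.subLeft_apply]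
  have h1 : ((-1 - n : ℤ) : ℂ) + 1 / 2 = -((n : ℂ) + 1 / 2) := by push_cast; ring
  have h2 : (-1 : ℂ) ^ (-1 - n) = -(-1 : ℂ) ^ n := by
    rw [zpow_sub₀ (by norm_num), zpow_neg_one, inv_neg, inv_one, div_eq_mul_inv, ← inv_zpow]
    norm_num
  rw [h1, h2, show -((n : ℂ) + 1 / 2) + -a = -((n : ℂ) + 1 / 2 + a) by ring, neg_sq, neg_sq]
  ring_nf

/-! ### Theta series with characteristics -/

/-- `i ∑ (-1) ^ n h (n + 1/2 + a) exp (π i (2 (n + 1/2) b + a b))`. -/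
def charSum (h : ℂ → ℂ) (a b : ℂ) : ℂ :=
  Complex.I * ∑' n : ℤ, (-1 : ℂ) ^ n * h ((n : ℂ) + 1 / 2 + a) *
    Complex.exp (Real.pi * Complex.I * (2 * ((n : ℂ) + 1 / 2) * b + a * b))

theorem neg_one_zpow_neg (m : ℤ) : (-1 : ℂ) ^ (-m) = (-1 : ℂ) ^ m := by
  rw [zpow_neg, ← inv_zpow, inv_neg, inv_one]

theorem neg_one_zpow_eq_exp (m : ℤ) : (-1 : ℂ) ^ m = Complex.exp (Real.pi * Complex.I * m) := by
  rw [mul_comm, Complex.exp_int_mul, Complex.exp_pi_mul_I]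

theorem charSum_add_int_left (h : ℂ → ℂ) (a b : ℂ) (m : ℤ) :
    charSum h (a + m) b =
      (-1 : ℂ) ^ m * Complex.exp (-(Real.pi * Complex.I * m * b)) * charSum h a b := by
  rw [charSum, charSum, ← (Equiv.subRight m).tsum_eq, mul_left_comm]
  congr 1
  rw [← tsum_mul_left]
  refine tsum_congr fun n => ?_
  rw [Equiv.subRight_apply, sub_eq_add_neg n m, zpow_add₀ (by norm_num), neg_one_zpow_neg,
    show (((n + -m : ℤ) : ℂ) + 1 / 2 + (a + m)) = (n : ℂ) + 1 / 2 + a by push_cast; ring,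
    show Real.pi * Complex.I * (2 * (((n + -m : ℤ) : ℂ) + 1 / 2) * b + (a + m) * b) =
      -(Real.pi * Complex.I * m * b) + Real.pi * Complex.I * (2 * ((n : ℂ) + 1 / 2) * b + a * b) by
      push_cast; ring, Complex.exp_add]
  ring

theorem charSum_add_int_right (h : ℂ → ℂ) (a b : ℂ) (m : ℤ) :
    charSum h a (b + m) =
      (-1 : ℂ) ^ m * Complex.exp (Real.pi * Complex.I * m * a) * charSum h a b := by
  rw [charSum, charSum, mul_left_comm]
  congr 1
  rw [← tsum_mul_left]
  refine tsum_congr fun n => ?_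
  rw [show Real.pi * Complex.I * (2 * ((n : ℂ) + 1 / 2) * (b + m) + a * (b + m)) =
      (n * m : ℤ) * (2 * Real.pi * Complex.I) + (Real.pi * Complex.I * m + (Real.pi * Complex.I * m * a +
        Real.pi * Complex.I * (2 * ((n : ℂ) + 1 / 2) * b + a * b))) by push_cast; ring,
    Complex.exp_add, Complex.exp_int_mul_two_pi_mul_I, Complex.exp_add, Complex.exp_add, neg_one_zpow_eq_exp m]
  ring

theorem charSum_translate (h : ℂ → ℂ) (a b : ℂ) :
    charSum (fun x => h x * Complex.exp (Real.pi * Complex.I * x ^ 2)) a (b - a) =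
      Complex.exp (Real.pi * Complex.I / 4) * charSum h a b := by
  rw [charSum, charSum, mul_left_comm]
  congr 1
  rw [← tsum_mul_left]
  refine tsum_congr fun n => ?_
  -- Since `n² + n` is even, only the square of `1/2` contributes to the multiplier, as `exp(πi/4)`.
  have hev : Complex.exp (Real.pi * Complex.I * ((n : ℂ) ^ 2 + n)) = 1 := by
    obtain ⟨k, hk⟩ := Int.even_mul_succ_self n
    rw [Complex.exp_eq_one_iff]
    refine ⟨k, ?_⟩
    have : (n : ℂ) ^ 2 + n = 2 * k := by
      have := congrArg (Int.cast : ℤ → ℂ) hk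
      push_cast at this
      linear_combination this
    rw [this]; ring
  have key : Complex.exp (Real.pi * Complex.I * ((n : ℂ) + 1 / 2 + a) ^ 2) *
      Complex.exp (Real.pi * Complex.I * (2 * ((n : ℂ) + 1 / 2) * (b - a) + a * (b - a))) =
      Complex.exp (Real.pi * Complex.I / 4) *
        Complex.exp (Real.pi * Complex.I * (2 * ((n : ℂ) + 1 / 2) * b + a * b)) := by
    rw [← Complex.exp_add, ← Complex.exp_add, ← one_mul (Complex.exp (Real.pi * Complex.I / 4 + _)), ← hev,
      ← Complex.exp_add, hev]
    congr 1
    ring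
  linear_combination ((-1 : ℂ) ^ n * h ((n : ℂ) + 1 / 2 + a)) * key

/-- The kernel of the theta function `ϑ`. -/
def thetaKernel (τ x : ℂ) : ℂ := Complex.exp (Real.pi * Complex.I * τ * x ^ 2)

/-- The kernel of the unary theta series of weight `3 / 2`. -/
def unaryKernel (w x : ℂ) : ℂ := x * Complex.exp (Real.pi * Complex.I * w * x ^ 2)

/-- The kernel of the completed theta function. -/
def psiKernel (τ w x : ℂ) : ℂ :=
  x * erfEven (-(Real.pi * Complex.I * (w - τ) * x ^ 2)) * Complex.exp (Real.pi * Complex.I * τ * x ^ 2)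

theorem charSum_thetaKernel (τ a b : ℂ) :
    charSum (thetaKernel τ) a b =
      Complex.exp (Real.pi * Complex.I * a * (a * τ + b)) * jacobiTheta (a * τ + b) τ := by
  rw [charSum, jacobiTheta, mul_left_comm]
  congr 1
  rw [← tsum_mul_left]
  refine tsum_congr fun n => ?_
  have key : Complex.exp (Real.pi * Complex.I * τ * ((n : ℂ) + 1 / 2 + a) ^ 2) *
      Complex.exp (Real.pi * Complex.I * (2 * ((n : ℂ) + 1 / 2) * b + a * b)) =
      Complex.exp (Real.pi * Complex.I * a * (a * τ + b)) *
      (Complex.exp (Real.pi * Complex.I * ((n : ℂ) + 1 / 2) ^ 2 * τ) *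
        Complex.exp (2 * Real.pi * Complex.I * ((n : ℂ) + 1 / 2) * (a * τ + b))) := by
    rw [← Complex.exp_add, ← Complex.exp_add, ← Complex.exp_add]
    congr 1
    ring
  rw [thetaKernel]
  linear_combination (-1 : ℂ) ^ n * key

theorem charSum_psiKernel (τ w a b : ℂ) :
    charSum (psiKernel τ w) a b =
      Complex.exp (Real.pi * Complex.I * a * (a * τ + b)) * psiCore a (a * τ + b) τ w := by
  rw [charSum, psiCore, mul_left_comm]
  congr 1
  rw [← tsum_mul_left]
  refine tsum_congr fun n => ?_
  have key : Complex.exp (Real.pi * Complex.I * τ * ((n : ℂ) + 1 / 2 + a) ^ 2) *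
      Complex.exp (Real.pi * Complex.I * (2 * ((n : ℂ) + 1 / 2) * b + a * b)) =
      Complex.exp (Real.pi * Complex.I * a * (a * τ + b)) *
      Complex.exp (Real.pi * Complex.I * ((n : ℂ) + 1 / 2) ^ 2 * τ +
      2 * Real.pi * Complex.I * ((n : ℂ) + 1 / 2) * (a * τ + b)) := by
    rw [← Complex.exp_add, ← Complex.exp_add]
    congr 1
    ring
  simp only [psiKernel, psiTerm]
  linear_combination ((-1 : ℂ) ^ n * (((n : ℂ) + 1 / 2 + a) *
    erfEven (-(Real.pi * Complex.I * (w - τ) * ((n : ℂ) + 1 / 2 + a) ^ 2)))) * key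

/-- Both half-integral shifts, that of the index and the one equivalent to `(-1)^n`, are absorbed
into the argument of the two-variable theta function. -/
theorem charSum_term_eq (τ a b : ℂ) (n : ℤ) :
    (-1 : ℂ) ^ n * Complex.exp (Real.pi * Complex.I * τ * ((n : ℂ) + 1 / 2 + a) ^ 2) *
      Complex.exp (Real.pi * Complex.I * (2 * ((n : ℂ) + 1 / 2) * b + a * b)) =
    -Complex.I * Complex.exp (Real.pi * Complex.I * (-(a * (b + 1)) + (a + 1 / 2) ^ 2 * τ +
      2 * (a + 1 / 2) * (b + 1 / 2))) * jacobiTheta₂_term n ((a + 1 / 2) * τ + (b + 1 / 2)) τ := by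
  have hI : -Complex.I = Complex.exp (-(Real.pi * Complex.I / 2)) := by
    rw [Complex.exp_neg, show (Real.pi * Complex.I / 2 : ℂ) = Real.pi / 2 * Complex.I by ring,
      Complex.exp_pi_div_two_mul_I, Complex.inv_I]
  rw [neg_one_zpow_eq_exp, jacobiTheta₂_term, hI, ← Complex.exp_add, ← Complex.exp_add, ← Complex.exp_add,
    ← Complex.exp_add]
  congr 1
  ring

theorem charSum_thetaKernel_eq_jacobiTheta₂ (τ a b : ℂ) :
    charSum (thetaKernel τ) a b = Complex.exp (Real.pi * Complex.I * (-(a * (b + 1)) + (a + 1 / 2) ^ 2 * τ +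
      2 * (a + 1 / 2) * (b + 1 / 2))) * jacobiTheta₂ ((a + 1 / 2) * τ + (b + 1 / 2)) τ := by
  rw [charSum, jacobiTheta₂]
  simp only [thetaKernel, charSum_term_eq]
  rw [tsum_mul_left]
  linear_combination (-(Complex.exp (Real.pi * Complex.I * (-(a * (b + 1)) + (a + 1 / 2) ^ 2 * τ +
      2 * (a + 1 / 2) * (b + 1 / 2))) *
      ∑' n : ℤ, jacobiTheta₂_term n ((a + 1 / 2) * τ + (b + 1 / 2)) τ)) * Complex.I_sq

theorem charSum_unaryKernel_eq_jacobiTheta₂ {w : ℂ} (hw : 0 < w.im) (a b : ℂ) :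
    charSum (unaryKernel w) a b = Complex.exp (Real.pi * Complex.I * (-(a * (b + 1)) + (a + 1 / 2) ^ 2 * w +
      2 * (a + 1 / 2) * (b + 1 / 2))) *
        (jacobiTheta₂' ((a + 1 / 2) * w + (b + 1 / 2)) w / (2 * Real.pi * Complex.I) +
          (a + 1 / 2) * jacobiTheta₂ ((a + 1 / 2) * w + (b + 1 / 2)) w) := by
  have hpi : (2 * Real.pi * Complex.I : ℂ) ≠ 0 := Complex.two_pi_I_ne_zero
  set E := Complex.exp (Real.pi * Complex.I * (-(a * (b + 1)) + (a + 1 / 2) ^ 2 * w +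
      2 * (a + 1 / 2) * (b + 1 / 2))) with hE
  have h1 := ((hasSum_jacobiTheta₂'_term ((a + 1 / 2) * w + (b + 1 / 2)) hw).div_const
    (2 * Real.pi * Complex.I)).add ((hasSum_jacobiTheta₂_term ((a + 1 / 2) * w + (b + 1 / 2)) hw).mul_left
      (a + 1 / 2))
  rw [charSum, ← h1.tsum_eq, ← tsum_mul_left, ← tsum_mul_left]
  refine tsum_congr fun n => ?_
  have h2 := charSum_term_eq w a b n
  rw [← hE] at h2
  rw [unaryKernel, jacobiTheta₂'_term, mul_assoc (2 * Real.pi * Complex.I : ℂ),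
    mul_div_cancel_left₀ _ hpi]
  linear_combination Complex.I * ((n : ℂ) + 1 / 2 + a) * h2 -
    ((n : ℂ) + 1 / 2 + a) * E * jacobiTheta₂_term n ((a + 1 / 2) * w + (b + 1 / 2)) w * Complex.I_sq

theorem csqrt_ne_zero {x : ℂ} (hx : x ≠ 0) : csqrt x ≠ 0 := by
  intro h
  apply hx
  rw [← csqrt_sq x, h]
  norm_num

theorem charSum_thetaKernel_inversion {τ : ℂ} (hτ : 0 < τ.im) (a b : ℂ) :
    charSum (thetaKernel (-1 / τ)) (-b) a =
      -Complex.I * csqrt (-Complex.I * τ) * charSum (thetaKernel τ) a b := by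
  have hτ0 : τ ≠ 0 := by rintro rfl; simp at hτ
  have hs : csqrt (-Complex.I * τ) ≠ 0 := csqrt_ne_zero (by simp [hτ0])
  -- Passing from `-b` to `-b - 1` makes the half shifts match: `-b - 1 + 1/2 = -(b + 1/2)`.
  have e1 := charSum_add_int_left (thetaKernel (-1 / τ)) (-b - 1) a 1
  rw [show -b - 1 + ((1 : ℤ) : ℂ) = -b by push_cast; ring] at e1
  rw [e1, charSum_thetaKernel_eq_jacobiTheta₂, charSum_thetaKernel_eq_jacobiTheta₂,
    jacobiTheta₂_functional_equation ((a + 1 / 2) * τ + (b + 1 / 2)) τ, ← csqrt,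
    show ((a + 1 / 2) * τ + (b + 1 / 2)) / τ = (-b - 1 + 1 / 2) * (-1 / τ) + (a + 1 / 2) by
      field_simp; ring]
  have hI : -Complex.I = Complex.exp (-(Real.pi * Complex.I / 2)) := by
    rw [Complex.exp_neg, show (Real.pi * Complex.I / 2 : ℂ) = Real.pi / 2 * Complex.I by ring,
      Complex.exp_pi_div_two_mul_I, Complex.inv_I]
  set J := jacobiTheta₂ ((-b - 1 + 1 / 2) * (-1 / τ) + (a + 1 / 2)) (-1 / τ)
  set s := csqrt (-Complex.I * τ)
  have key : (-1 : ℂ) ^ (1 : ℤ) * Complex.exp (-(Real.pi * Complex.I * (1 : ℤ) * a)) *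
      Complex.exp (Real.pi * Complex.I * (-((-b - 1) * (a + 1)) + (-b - 1 + 1 / 2) ^ 2 * (-1 / τ) +
        2 * (-b - 1 + 1 / 2) * (a + 1 / 2))) =
      Complex.exp (-(Real.pi * Complex.I / 2)) *
        (Complex.exp (Real.pi * Complex.I * (-(a * (b + 1)) + (a + 1 / 2) ^ 2 * τ +
          2 * (a + 1 / 2) * (b + 1 / 2))) *
        Complex.exp (-Real.pi * Complex.I * ((a + 1 / 2) * τ + (b + 1 / 2)) ^ 2 / τ)) := by
    rw [neg_one_zpow_eq_exp, ← Complex.exp_add, ← Complex.exp_add, ← Complex.exp_add, ← Complex.exp_add]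
    rw [Complex.exp_eq_exp_iff_exists_int]
    refine ⟨1, ?_⟩
    push_cast
    field_simp
    ring
  rw [← mul_assoc, key, hI]
  field_simp

theorem charSum_unaryKernel_inversion {w : ℂ} (hw : 0 < w.im) (a b : ℂ) :
    charSum (unaryKernel (-1 / w)) (-b) a =
      w * (-Complex.I * csqrt (-Complex.I * w)) * charSum (unaryKernel w) a b := by
  have hw0 : w ≠ 0 := by rintro rfl; simp at hw
  have hw' : 0 < (-1 / w).im := by
    rw [neg_div, one_div, Complex.neg_im, Complex.inv_im, neg_div, neg_neg]
    exact div_pos hw (Complex.normSq_pos.mpr hw0)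
  have hs : csqrt (-Complex.I * w) ≠ 0 := csqrt_ne_zero (by simp [hw0])
  have hpi : (2 * Real.pi * Complex.I : ℂ) ≠ 0 := Complex.two_pi_I_ne_zero
  have e1 := charSum_add_int_left (unaryKernel (-1 / w)) (-b - 1) a 1
  rw [show -b - 1 + ((1 : ℤ) : ℂ) = -b by push_cast; ring] at e1
  rw [e1, charSum_unaryKernel_eq_jacobiTheta₂ hw', charSum_unaryKernel_eq_jacobiTheta₂ hw,
    jacobiTheta₂_functional_equation ((a + 1 / 2) * w + (b + 1 / 2)) w,
    jacobiTheta₂'_functional_equation ((a + 1 / 2) * w + (b + 1 / 2)) w, ← csqrt,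
    show ((a + 1 / 2) * w + (b + 1 / 2)) / w = (-b - 1 + 1 / 2) * (-1 / w) + (a + 1 / 2) by
      field_simp; ring]
  have hI : -Complex.I = Complex.exp (-(Real.pi * Complex.I / 2)) := by
    rw [Complex.exp_neg, show (Real.pi * Complex.I / 2 : ℂ) = Real.pi / 2 * Complex.I by ring,
      Complex.exp_pi_div_two_mul_I, Complex.inv_I]
  set J := jacobiTheta₂ ((-b - 1 + 1 / 2) * (-1 / w) + (a + 1 / 2)) (-1 / w)
  set J' := jacobiTheta₂' ((-b - 1 + 1 / 2) * (-1 / w) + (a + 1 / 2)) (-1 / w)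
  set s := csqrt (-Complex.I * w)
  have key : (-1 : ℂ) ^ (1 : ℤ) * Complex.exp (-(Real.pi * Complex.I * (1 : ℤ) * a)) *
      Complex.exp (Real.pi * Complex.I * (-((-b - 1) * (a + 1)) + (-b - 1 + 1 / 2) ^ 2 * (-1 / w) +
        2 * (-b - 1 + 1 / 2) * (a + 1 / 2))) =
      Complex.exp (-(Real.pi * Complex.I / 2)) *
        (Complex.exp (Real.pi * Complex.I * (-(a * (b + 1)) + (a + 1 / 2) ^ 2 * w +
          2 * (a + 1 / 2) * (b + 1 / 2))) *
        Complex.exp (-Real.pi * Complex.I * ((a + 1 / 2) * w + (b + 1 / 2)) ^ 2 / w)) := by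
    rw [neg_one_zpow_eq_exp, ← Complex.exp_add, ← Complex.exp_add, ← Complex.exp_add, ← Complex.exp_add]
    rw [Complex.exp_eq_exp_iff_exists_int]
    refine ⟨1, ?_⟩
    push_cast
    field_simp
    ring
  rw [← mul_assoc, key, hI]
  set E1 := Complex.exp (Real.pi * Complex.I * (-(a * (b + 1)) + (a + 1 / 2) ^ 2 * w +
          2 * (a + 1 / 2) * (b + 1 / 2)))
  set E2 := Complex.exp (-Real.pi * Complex.I * ((a + 1 / 2) * w + (b + 1 / 2)) ^ 2 / w)
  -- The inhomogeneous term in the functional equation of the derivative combines with the `(a +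
  -- 1/2)`-multiple of theta, so the unary series has a clean transformation law.
  have h3 : 1 / s * E2 / w * (J' - 2 * Real.pi * Complex.I * ((a + 1 / 2) * w + (b + 1 / 2)) * J) /
      (2 * Real.pi * Complex.I) + (a + 1 / 2) * (1 / s * E2 * J) =
      1 / s * E2 / w * (J' / (2 * Real.pi * Complex.I) + (-b - 1 + 1 / 2) * J) := by
    field_simp
    ring
  rw [h3]
  field_simp

/-! ### Inversion of the completed theta series -/

/-- The completed theta function with characteristics. -/
def psiKlein (a b τ w : ℂ) : ℂ := charSum (psiKernel τ w) a b

theorem hasSum_deriv_psiTerm (a z : ℂ) {τ w : ℂ} (hτ : 0 < τ.im) (hw : 0 < w.im) :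
    HasSum (fun n => deriv (fun w => psiTerm n (a, z, τ, w)) w)
      (deriv (fun w => ∑' n, psiTerm n (a, z, τ, w)) w) := by
  have hU : IsOpen {w : ℂ | 0 < w.im} := isOpen_lt continuous_const (by fun_prop)
  have h := hasSum_iteratedDeriv hU 1 (F := fun n w => psiTerm n (a, z, τ, w))
    (fun n w _ => ((analyticAt_psiTerm n (a, z, τ, w)).differentiableAt.fun_comp' w
      (by fun_prop : DifferentiableAt ℂ (fun w : ℂ => (a, z, τ, w)) w)).differentiableWithinAt)
    (fun w hw => by
      obtain ⟨u, hu, hb⟩ := psiTerm_locally_bounded (x := (a, z, τ, w)) ⟨hτ, hw⟩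
      refine ⟨u, hu, ?_⟩
      have hc : ContinuousAt (fun w : ℂ => (a, z, τ, w)) w := by fun_prop
      exact hc.eventually hb) w hw
  simpa only [iteratedDeriv_one] using h

theorem differentiableAt_psiCore_snd (a z : ℂ) {τ w : ℂ} (hτ : 0 < τ.im) (hw : 0 < w.im) :
    DifferentiableAt ℂ (fun w => psiCore a z τ w) w :=
  DifferentiableAt.fun_comp' (f := fun w : ℂ => (a, z, τ, w)) w
    (analyticAt_psiCore (x := (a, z, τ, w)) ⟨hτ, hw⟩).differentiableAt (by fun_prop)

/-- On each term `2(w-τ)∂_w` acts as `2y d/dy` for `y = -πi(w-τ)X²`, so `erfEven_add_deriv` replaces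
`erfEven` by an exponential. -/
theorem psiCore_add_deriv (a z : ℂ) {τ w : ℂ} (hτ : 0 < τ.im) (hw : 0 < w.im) :
    psiCore a z τ w + 2 * (w - τ) * deriv (fun w => psiCore a z τ w) w =
      Complex.I * ∑' n : ℤ, (-1 : ℂ) ^ n * (((n : ℂ) + 1 / 2 + a) * (2 / (Real.sqrt Real.pi : ℂ) *
        Complex.exp (Real.pi * Complex.I * (w - τ) * ((n : ℂ) + 1 / 2 + a) ^ 2))) *
        Complex.exp (Real.pi * Complex.I * ((n : ℂ) + 1 / 2) ^ 2 * τ +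
      2 * Real.pi * Complex.I * ((n : ℂ) + 1 / 2) * z) := by
  have h1 := hasSum_deriv_psiTerm a z hτ hw
  have h2 := (summable_psiTerm (x := (a, z, τ, w)) ⟨hτ, hw⟩).hasSum.add (h1.mul_left (2 * (w - τ)))
  have h3 : deriv (fun w => psiCore a z τ w) w =
      Complex.I * deriv (fun w => ∑' n, psiTerm n (a, z, τ, w)) w := by
    simp only [psiCore]
    rw [deriv_const_mul_field]
  rw [h3, psiCore, mul_left_comm, ← mul_add, ← h2.tsum_eq]
  congr 1
  refine tsum_congr fun n => ?_
  set X : ℂ := (n : ℂ) + 1 / 2 + a with hX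
  have h4 : HasDerivAt (fun w => -(Real.pi * Complex.I * (w - τ) * X ^ 2)) (-(Real.pi * Complex.I * 1 * X ^ 2)) w :=
    ((((hasDerivAt_id w).sub_const τ).const_mul _).mul_const _).neg
  have h5 := (differentiable_erfEven _).hasDerivAt.comp w h4
  have h8 := ((h5.const_mul X).mul_const ((-1 : ℂ) ^ n)).mul_const
    (Complex.exp (Real.pi * Complex.I * ((n : ℂ) + 1 / 2) ^ 2 * τ +
      2 * Real.pi * Complex.I * ((n : ℂ) + 1 / 2) * z))
  have h6 : deriv (fun w => psiTerm n (a, z, τ, w)) w = X * (deriv erfEven (-(Real.pi * Complex.I * (w - τ) * X ^ 2)) *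
      -(Real.pi * Complex.I * 1 * X ^ 2)) * (-1 : ℂ) ^ n * Complex.exp (Real.pi * Complex.I * ((n : ℂ) + 1 / 2) ^ 2 * τ +
      2 * Real.pi * Complex.I * ((n : ℂ) + 1 / 2) * z) :=
    h8.deriv
  have h7 := erfEven_add_deriv (-(Real.pi * Complex.I * (w - τ) * X ^ 2))
  rw [neg_neg] at h7
  rw [h6, psiTerm, ← h7]
  simp only [← hX]
  ring

/-- The Gaussians in `w - τ` and in `τ` multiply to one in `w` alone. The right side is therefore
independent of `τ`. -/
theorem psiKlein_add_deriv (a b : ℂ) {τ w : ℂ} (hτ : 0 < τ.im) (hw : 0 < w.im) :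
    psiKlein a b τ w + 2 * (w - τ) * deriv (fun w => psiKlein a b τ w) w =
      2 / (Real.sqrt Real.pi : ℂ) * charSum (unaryKernel w) a b := by
  have h1 : (fun w => psiKlein a b τ w) = fun w =>
      Complex.exp (Real.pi * Complex.I * a * (a * τ + b)) * psiCore a (a * τ + b) τ w := by
    ext w; exact charSum_psiKernel τ w a b
  have h2 : psiKlein a b τ w = _ := congrFun h1 w
  rw [h1, deriv_const_mul_field, h2, mul_left_comm, ← mul_add, psiCore_add_deriv a _ hτ hw, charSum,
    mul_left_comm, mul_left_comm (2 / (Real.sqrt Real.pi : ℂ))]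
  congr 1
  rw [← tsum_mul_left, ← tsum_mul_left]
  refine tsum_congr fun n => ?_
  set X : ℂ := (n : ℂ) + 1 / 2 + a with hX
  have key : Complex.exp (Real.pi * Complex.I * a * (a * τ + b)) *
      Complex.exp (Real.pi * Complex.I * (w - τ) * X ^ 2) *
      Complex.exp (Real.pi * Complex.I * ((n : ℂ) + 1 / 2) ^ 2 * τ +
      2 * Real.pi * Complex.I * ((n : ℂ) + 1 / 2) * (a * τ + b)) =
      Complex.exp (Real.pi * Complex.I * w * X ^ 2) *
      Complex.exp (Real.pi * Complex.I * (2 * ((n : ℂ) + 1 / 2) * b + a * b)) := by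
    rw [← Complex.exp_add, ← Complex.exp_add, ← Complex.exp_add, hX]
    congr 1
    ring
  rw [unaryKernel]
  linear_combination ((-1 : ℂ) ^ n * X * (2 / (Real.sqrt Real.pi : ℂ))) * key

theorem differentiableAt_psiKlein (a b : ℂ) {τ w : ℂ} (hτ : 0 < τ.im) (hw : 0 < w.im) :
    DifferentiableAt ℂ (fun w => psiKlein a b τ w) w := by
  have h1 : (fun w => psiKlein a b τ w) = fun w =>
      Complex.exp (Real.pi * Complex.I * a * (a * τ + b)) * psiCore a (a * τ + b) τ w := by
    ext w; exact charSum_psiKernel τ w a b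
  rw [h1]
  exact (differentiableAt_psiCore_snd a _ hτ hw).const_mul _

theorem neg_I_mul_mem_slitPlane {w : ℂ} (hw : 0 < w.im) : -Complex.I * w ∈ Complex.slitPlane := by
  left
  simpa using hw

theorem hasDerivAt_csqrt_neg_I_mul {w : ℂ} (hw : 0 < w.im) :
    HasDerivAt (fun w => csqrt (-Complex.I * w)) (csqrt (-Complex.I * w) / (2 * w)) w := by
  have hw0 : w ≠ 0 := by rintro rfl; simp at hw
  have h0 : -Complex.I * w ≠ 0 := by simp [hw0]
  have h1 : HasDerivAt (fun w : ℂ => -Complex.I * w) (-Complex.I * 1) w := (hasDerivAt_id w).const_mul _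
  have h2 := h1.cpow_const (c := (1 / 2 : ℂ)) (neg_I_mul_mem_slitPlane hw)
  rw [Complex.cpow_sub _ _ h0, Complex.cpow_one] at h2
  refine h2.congr_deriv ?_
  simp only [csqrt]
  field_simp

theorem im_neg_one_div_pos {w : ℂ} (hw : 0 < w.im) : 0 < (-1 / w).im := by
  have hw0 : w ≠ 0 := by rintro rfl; simp at hw
  rw [neg_div, one_div, Complex.neg_im, Complex.inv_im, neg_div, neg_neg]
  exact div_pos hw (Complex.normSq_pos.mpr hw0)

/-- By `psiKlein_add_deriv` and the inversion of the unary theta series, the difference `D` of the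
two sides satisfies `τ D + 2(w-τ) w D' = 0`. Then `(w-τ)/w * D²` has derivative zero on the
half-plane and vanishes at `w = τ`, so `D = 0` for `w ≠ τ`; at `w = τ` the equation itself forces `D
= 0`. -/
theorem psiKlein_inversion {τ w : ℂ} (hτ : 0 < τ.im) (hw : 0 < w.im) (a b : ℂ) :
    psiKlein (-b) a (-1 / τ) (-1 / w) =
      τ * (-Complex.I * csqrt (-Complex.I * w)) * psiKlein a b τ w := by
  have hτ0 : τ ≠ 0 := by rintro rfl; simp at hτ
  set D : ℂ → ℂ := fun w => psiKlein (-b) a (-1 / τ) (-1 / w) -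
    τ * (-Complex.I * csqrt (-Complex.I * w)) * psiKlein a b τ w with hD
  have hode : ∀ w : ℂ, 0 < w.im → ∃ D', HasDerivAt D D' w ∧ τ * D w + 2 * (w - τ) * w * D' = 0 := by
    intro w hw
    have hw0 : w ≠ 0 := by rintro rfl; simp at hw
    have h1 : HasDerivAt (fun w : ℂ => -1 / w) (1 / w ^ 2) w := by
      have := (hasDerivAt_inv hw0).const_mul (-1)
      simp only [← div_eq_mul_inv] at this
      exact this.congr_deriv (by ring)
    have h2 := (differentiableAt_psiKlein (-b) a (im_neg_one_div_pos hτ) (im_neg_one_div_pos hw)).hasDerivAt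
    have h3 := (differentiableAt_psiKlein a b hτ hw).hasDerivAt
    have h4 : HasDerivAt (fun w => psiKlein (-b) a (-1 / τ) (-1 / w)) _ w := h2.comp w h1
    have h5 := (((hasDerivAt_csqrt_neg_I_mul hw).const_mul (-Complex.I)).const_mul τ).mul h3
    refine ⟨_, h4.sub h5, ?_⟩
    have o1 := psiKlein_add_deriv (-b) a (im_neg_one_div_pos hτ) (im_neg_one_div_pos hw)
    have o2 := psiKlein_add_deriv a b hτ hw
    rw [charSum_unaryKernel_inversion hw] at o1
    have e1 : -1 / w - -1 / τ = (w - τ) / (τ * w) := by field_simp; ring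
    rw [e1] at o1
    simp only [hD]
    set P1 := psiKlein (-b) a (-1 / τ) (-1 / w)
    set d1 := deriv (fun w => psiKlein (-b) a (-1 / τ) w) (-1 / w)
    set P2 := psiKlein a b τ w
    set d2 := deriv (fun w => psiKlein a b τ w) w
    set s := csqrt (-Complex.I * w)
    have o1' : τ * P1 + 2 * (w - τ) * w * (d1 * (1 / w ^ 2)) = τ * (P1 + 2 * ((w - τ) / (τ * w)) * d1) := by
      field_simp
    have o3 : 2 * (w - τ) * w * (τ * (-Complex.I * (s / (2 * w))) * P2 + τ * (-Complex.I * s) * d2) =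
      τ * (-Complex.I * s) * ((w - τ) * P2 + 2 * (w - τ) * w * d2) := by
      field_simp
      ring
    linear_combination o1' - o3 + τ * o1 - τ * (-Complex.I * s) * w * o2
  have hconst : ∀ w : ℂ, 0 < w.im → (w - τ) / w * D w ^ 2 = 0 := by
    intro w hw
    have hU : IsOpen {w : ℂ | 0 < w.im} := isOpen_lt continuous_const (by fun_prop)
    have hconv : Convex ℝ {w : ℂ | 0 < w.im} := convex_halfSpace_im_gt 0
    have hder : ∀ w ∈ {w : ℂ | 0 < w.im}, HasDerivAt (fun w => (w - τ) / w * D w ^ 2) 0 w := by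
      intro w hw
      have hw' : 0 < w.im := hw
      have hw0 : w ≠ 0 := by rintro rfl; simp at hw'
      obtain ⟨D', hD1, hD2⟩ := hode w hw
      have h1 := (((hasDerivAt_id w).sub_const τ).div (hasDerivAt_id w) hw0).mul (hD1.pow 2)
      refine h1.congr_deriv ?_
      have : (0 : ℂ) = D w / w ^ 2 * (τ * D w + 2 * (w - τ) * w * D') := by rw [hD2, mul_zero]
      rw [this]
      simp
      field_simp
    have := hconv.is_const_of_fderivWithin_eq_zero (𝕜 := ℂ) (f := fun w => (w - τ) / w * D w ^ 2)
      (fun w hw => (hder w hw).differentiableAt.differentiableWithinAt) (fun w hw => by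
        rw [fderivWithin_of_isOpen hU hw]
        have := (hder w hw).hasFDerivAt.fderiv
        rw [this]; ext; simp) hw hτ
    simpa using this
  have hDw : D w = 0 := by
    by_cases h : w = τ
    · obtain ⟨D', _, hD2⟩ := hode w hw
      rw [h, sub_self, mul_zero, zero_mul, zero_mul, add_zero] at hD2
      rw [h]
      exact (mul_eq_zero.mp hD2).resolve_left hτ0
    · have hw0 : w ≠ 0 := by rintro rfl; simp at hw
      have := hconst w hw
      rcases mul_eq_zero.mp this with h1 | h1
      · exact absurd h1 (div_ne_zero (sub_ne_zero.mpr h) hw0)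
      · exact pow_eq_zero_iff (two_ne_zero) |>.mp h1
  exact sub_eq_zero.mp hDw

/-! ### Automorphy factors -/

theorem det_eq_one_complex (γ : SL(2, ℤ)) :
    ((γ 0 0 : ℤ) : ℂ) * ((γ 1 1 : ℤ) : ℂ) - ((γ 0 1 : ℤ) : ℂ) * ((γ 1 0 : ℤ) : ℂ) = 1 := by
  have h := γ.det_coe
  rw [Matrix.det_fin_two] at h
  exact_mod_cast h

theorem im_autFactor (γ : SL(2, ℤ)) (x : ℂ) : (autFactor γ x).im = (γ 1 0 : ℤ) * x.im := by
  simp [autFactor]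

theorem autFactor_ne_zero (γ : SL(2, ℤ)) {x : ℂ} (hx : 0 < x.im) : autFactor γ x ≠ 0 := by
  intro h
  have h1 := im_autFactor γ x
  rw [h, Complex.zero_im] at h1
  have h2 : ((γ 1 0 : ℤ) : ℝ) = 0 := (mul_eq_zero.mp h1.symm).resolve_right hx.ne'
  have h3 : ((γ 1 0 : ℤ) : ℂ) = 0 := by exact_mod_cast h2
  rw [autFactor, h3, zero_mul, zero_add] at h
  have h4 := det_eq_one_complex γ
  rw [h3, h] at h4
  simp at h4

theorem im_moebius (γ : SL(2, ℤ)) (x : ℂ) :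
    (moebius γ x).im = x.im / Complex.normSq (autFactor γ x) := by
  have h := congrArg Complex.re (det_eq_one_complex γ)
  simp at h
  rw [moebius, Complex.div_im, ← sub_div]
  congr 1
  simp [autFactor]
  linear_combination x.im * h

theorem im_moebius_pos (γ : SL(2, ℤ)) {x : ℂ} (hx : 0 < x.im) : 0 < (moebius γ x).im := by
  rw [im_moebius]
  exact div_pos hx (Complex.normSq_pos.mpr (autFactor_ne_zero γ hx))

theorem mul_entries (γ₁ γ₂ : SL(2, ℤ)) (i j : Fin 2) :
    (((γ₁ * γ₂) i j : ℤ) : ℂ) = ((γ₁ i 0 : ℤ) : ℂ) * ((γ₂ 0 j : ℤ) : ℂ) + ((γ₁ i 1 : ℤ) : ℂ) * ((γ₂ 1 j : ℤ) : ℂ) := by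
  rw [Matrix.SpecialLinearGroup.coe_mul, Matrix.mul_apply, Fin.sum_univ_two]
  push_cast
  rfl

theorem autFactor_mul (γ₁ γ₂ : SL(2, ℤ)) {x : ℂ} (hx : 0 < x.im) :
    autFactor (γ₁ * γ₂) x = autFactor γ₁ (moebius γ₂ x) * autFactor γ₂ x := by
  have h := autFactor_ne_zero γ₂ hx
  have h2 : moebius γ₂ x * autFactor γ₂ x = ((γ₂ 0 0 : ℤ) : ℂ) * x + ((γ₂ 0 1 : ℤ) : ℂ) :=
    div_mul_cancel₀ _ h
  have h4 : autFactor γ₂ x = ((γ₂ 1 0 : ℤ) : ℂ) * x + ((γ₂ 1 1 : ℤ) : ℂ) := rfl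
  have h5 : autFactor γ₁ (moebius γ₂ x) = ((γ₁ 1 0 : ℤ) : ℂ) * moebius γ₂ x + ((γ₁ 1 1 : ℤ) : ℂ) := rfl
  rw [h5, autFactor, mul_entries, mul_entries]
  linear_combination -((γ₁ 1 0 : ℤ) : ℂ) * h2 - ((γ₁ 1 1 : ℤ) : ℂ) * h4

theorem moebius_mul (γ₁ γ₂ : SL(2, ℤ)) {x : ℂ} (hx : 0 < x.im) :
    moebius (γ₁ * γ₂) x = moebius γ₁ (moebius γ₂ x) := by
  have h := autFactor_ne_zero γ₂ hx
  have h1 := autFactor_ne_zero γ₁ (im_moebius_pos γ₂ hx)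
  have h2 : moebius γ₂ x * autFactor γ₂ x = ((γ₂ 0 0 : ℤ) : ℂ) * x + ((γ₂ 0 1 : ℤ) : ℂ) :=
    div_mul_cancel₀ _ h
  rw [moebius, autFactor_mul γ₁ γ₂ hx, mul_entries, mul_entries, moebius.eq_1 γ₁,
    div_eq_div_iff (mul_ne_zero h1 h) h1]
  have h3 : (((γ₁ 0 0 : ℤ) : ℂ) * moebius γ₂ x + ((γ₁ 0 1 : ℤ) : ℂ)) * autFactor γ₂ x =
      ((γ₁ 0 0 : ℤ) : ℂ) * (((γ₂ 0 0 : ℤ) : ℂ) * x + ((γ₂ 0 1 : ℤ) : ℂ)) +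
        ((γ₁ 0 1 : ℤ) : ℂ) * autFactor γ₂ x := by
    rw [← h2]; ring
  have h4 : autFactor γ₂ x = ((γ₂ 1 0 : ℤ) : ℂ) * x + ((γ₂ 1 1 : ℤ) : ℂ) := rfl
  calc _ = ((((γ₁ 0 0 : ℤ) : ℂ) * (((γ₂ 0 0 : ℤ) : ℂ) * x + ((γ₂ 0 1 : ℤ) : ℂ)) +
        ((γ₁ 0 1 : ℤ) : ℂ) * autFactor γ₂ x)) * autFactor γ₁ (moebius γ₂ x) := by rw [h4]; ring
    _ = _ := by rw [← h3]; ring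

theorem autFactor_one (x : ℂ) : autFactor 1 x = 1 := by simp [autFactor]

theorem moebius_one (x : ℂ) : moebius 1 x = x := by simp [moebius, autFactor_one]

/-- If the quotient were a real number `r ≤ 0`, imaginary parts would give `c Im w = r c Im τ`. This
is impossible for `c ≠ 0`, and for `c = 0` the quotient is `1`. -/
theorem autFactor_div_mem_slitPlane (γ : SL(2, ℤ)) {τ w : ℂ} (hτ : 0 < τ.im) (hw : 0 < w.im) :
    autFactor γ w / autFactor γ τ ∈ Complex.slitPlane := by
  rw [Complex.mem_slitPlane_iff]
  by_contra hcon
  push Not at hcon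
  obtain ⟨h1, h2⟩ := hcon
  set r := autFactor γ w / autFactor γ τ with hr
  have h0 := autFactor_ne_zero γ hτ
  have hreal : r = (r.re : ℂ) := by
    apply Complex.ext <;> simp [h2]
  have h3 : autFactor γ w = (r.re : ℂ) * autFactor γ τ := by
    rw [← hreal, hr, div_mul_cancel₀ _ h0]
  have h4 := congrArg Complex.im h3
  rw [Complex.im_ofReal_mul, im_autFactor, im_autFactor] at h4
  by_cases hc : ((γ 1 0 : ℤ) : ℝ) = 0
  · have hc' : ((γ 1 0 : ℤ) : ℂ) = 0 := by exact_mod_cast hc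
    have h5 : autFactor γ w = autFactor γ τ := by simp [autFactor, hc']
    have h6 : r = 1 := by rw [hr, h5, div_self h0]
    rw [h6, Complex.one_re] at h1
    linarith
  · have h5 : w.im = r.re * τ.im := by
      apply mul_left_cancel₀ hc
      rw [h4]; ring
    nlinarith

/-- A branch of the square root of `(c τ + d) (c w + d)`. -/
def rho (γ : SL(2, ℤ)) (τ w : ℂ) : ℂ := autFactor γ τ * csqrt (autFactor γ w / autFactor γ τ)

theorem rho_sq (γ : SL(2, ℤ)) {τ : ℂ} (hτ : 0 < τ.im) (w : ℂ) :
    rho γ τ w ^ 2 = autFactor γ τ * autFactor γ w := by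
  have h0 := autFactor_ne_zero γ hτ
  rw [rho, mul_pow, csqrt_sq]
  field_simp

theorem rho_ne_zero (γ : SL(2, ℤ)) {τ w : ℂ} (hτ : 0 < τ.im) (hw : 0 < w.im) : rho γ τ w ≠ 0 := by
  intro h
  have h1 := rho_sq γ hτ w
  rw [h] at h1
  exact mul_ne_zero (autFactor_ne_zero γ hτ) (autFactor_ne_zero γ hw) (by rw [← h1]; ring)

theorem csqrt_one : csqrt 1 = 1 := by simp [csqrt]

theorem rho_self (γ : SL(2, ℤ)) {τ : ℂ} (hτ : 0 < τ.im) : rho γ τ τ = autFactor γ τ := by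
  rw [rho, div_self (autFactor_ne_zero γ hτ), csqrt_one, mul_one]

theorem continuousAt_csqrt {x : ℂ} (hx : x ∈ Complex.slitPlane) : ContinuousAt csqrt x :=
  continuousAt_id.cpow continuousAt_const hx

theorem continuousAt_autFactor (γ : SL(2, ℤ)) (x : ℂ) : ContinuousAt (autFactor γ) x := by
  unfold autFactor
  fun_prop

theorem continuousAt_moebius (γ : SL(2, ℤ)) {x : ℂ} (hx : 0 < x.im) : ContinuousAt (moebius γ) x := by
  unfold moebius
  exact ContinuousAt.div (by fun_prop) (continuousAt_autFactor γ x) (autFactor_ne_zero γ hx)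

theorem continuousAt_rho (γ : SL(2, ℤ)) {τ w : ℂ} (hτ : 0 < τ.im) (hw : 0 < w.im) :
    ContinuousAt (fun w => rho γ τ w) w := by
  unfold rho
  refine continuousAt_const.mul ?_
  exact ContinuousAt.comp (f := fun w => autFactor γ w / autFactor γ τ)
    (continuousAt_csqrt (autFactor_div_mem_slitPlane γ hτ hw)) ((continuousAt_autFactor γ w).div_const _)

/-- On the connected half-plane, continuous square roots of a nonvanishing function that agree at
one point coincide. This settles all branch questions below. -/
theorem eq_of_sq_eq_upperHalfPlane {f g : ℂ → ℂ} (hf : ∀ w : ℂ, 0 < w.im → ContinuousAt f w)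
    (hg : ∀ w : ℂ, 0 < w.im → ContinuousAt g w) (hsq : ∀ w : ℂ, 0 < w.im → f w ^ 2 = g w ^ 2)
    (hg0 : ∀ w : ℂ, 0 < w.im → g w ≠ 0) {τ : ℂ} (hτ : 0 < τ.im) (h : f τ = g τ) {w : ℂ} (hw : 0 < w.im) :
    f w = g w :=
  (convex_halfSpace_im_gt 0).isPreconnected.eq_of_sq_eq (S := {w : ℂ | 0 < w.im})
    (fun w hw => (hf w hw).continuousWithinAt) (fun w hw => (hg w hw).continuousWithinAt)
    (fun w hw => hsq w hw) (fun {w} hw => hg0 w hw) (y := τ) hτ h hw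

/-- Both sides are continuous in `w` and have equal squares by the cocycle relation for `cτ + d`.
They agree at `w = τ`, where `rho` is `cτ + d` itself. -/
theorem rho_mul (γ₁ γ₂ : SL(2, ℤ)) {τ w : ℂ} (hτ : 0 < τ.im) (hw : 0 < w.im) :
    rho (γ₁ * γ₂) τ w = rho γ₁ (moebius γ₂ τ) (moebius γ₂ w) * rho γ₂ τ w := by
  have hτ' := im_moebius_pos γ₂ hτ
  refine eq_of_sq_eq_upperHalfPlane (f := fun w => rho (γ₁ * γ₂) τ w)
    (g := fun w => rho γ₁ (moebius γ₂ τ) (moebius γ₂ w) * rho γ₂ τ w)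
    (fun w hw => continuousAt_rho _ hτ hw) (fun w hw => ?_) (fun w hw => ?_) (fun w hw => ?_) hτ ?_ hw
  · refine ContinuousAt.mul ?_ (continuousAt_rho _ hτ hw)
    exact ContinuousAt.comp (g := fun w => rho γ₁ (moebius γ₂ τ) w)
      (continuousAt_rho γ₁ hτ' (im_moebius_pos γ₂ hw)) (continuousAt_moebius γ₂ hw)
  · rw [mul_pow, rho_sq _ hτ, rho_sq _ hτ', rho_sq _ hτ, autFactor_mul _ _ hτ, autFactor_mul _ _ hw]
    ring
  · exact mul_ne_zero (rho_ne_zero γ₁ hτ' (im_moebius_pos γ₂ hw)) (rho_ne_zero γ₂ hτ hw)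
  · simp only [rho_self _ hτ, rho_self _ hτ', autFactor_mul _ _ hτ]

theorem csqrt_neg_I_mul {τ w : ℂ} (hτ : 0 < τ.im) (hw : 0 < w.im) :
    csqrt (-Complex.I * w) = csqrt (-Complex.I * τ) * rho ModularGroup.S τ w / τ := by
  have hτ0 : τ ≠ 0 := by rintro rfl; simp at hτ
  have hS : ∀ x, autFactor ModularGroup.S x = x := fun x => by simp [autFactor, ModularGroup.S]
  refine eq_of_sq_eq_upperHalfPlane (f := fun w => csqrt (-Complex.I * w))
    (g := fun w => csqrt (-Complex.I * τ) * rho ModularGroup.S τ w / τ)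
    (fun w hw => (hasDerivAt_csqrt_neg_I_mul hw).continuousAt) (fun w hw => ?_) (fun w hw => ?_)
    (fun w hw => ?_) hτ ?_ hw
  · exact (continuousAt_const.mul (continuousAt_rho _ hτ hw)).div_const _
  · rw [div_pow, mul_pow, csqrt_sq, csqrt_sq, rho_sq _ hτ, hS, hS]
    field_simp
  · exact div_ne_zero (mul_ne_zero (csqrt_ne_zero (by simp [hτ0])) (rho_ne_zero _ hτ hw)) hτ0
  · simp only [rho_self _ hτ, hS]
    field_simp

/-! ### Transformation of the theta series with characteristics -/

/-- The first entry of the characteristic `(a, b)` transformed by `γ`. -/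
def charLeft (γ : SL(2, ℤ)) (a b : ℂ) : ℂ := ((γ 1 1 : ℤ) : ℂ) * a - ((γ 1 0 : ℤ) : ℂ) * b

/-- The second entry of the characteristic `(a, b)` transformed by `γ`. -/
def charRight (γ : SL(2, ℤ)) (a b : ℂ) : ℂ := -((γ 0 1 : ℤ) : ℂ) * a + ((γ 0 0 : ℤ) : ℂ) * b

theorem charLeft_mul (γ₁ γ₂ : SL(2, ℤ)) (a b : ℂ) :
    charLeft (γ₁ * γ₂) a b = charLeft γ₁ (charLeft γ₂ a b) (charRight γ₂ a b) := by
  simp only [charLeft, charRight, mul_entries]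
  ring

theorem charRight_mul (γ₁ γ₂ : SL(2, ℤ)) (a b : ℂ) :
    charRight (γ₁ * γ₂) a b = charRight γ₁ (charLeft γ₂ a b) (charRight γ₂ a b) := by
  simp only [charLeft, charRight, mul_entries]
  ring

theorem charLeft_one (a b : ℂ) : charLeft 1 a b = a := by simp [charLeft]

theorem charRight_one (a b : ℂ) : charRight 1 a b = b := by simp [charRight]

/-- `ϑ` and `ψ̂` transform under `γ` with multipliers `C` and `C * rho γ τ w`. -/
def KleinLaw (γ : SL(2, ℤ)) (τ w C : ℂ) : Prop :=
  C ≠ 0 ∧ ∀ a b,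
    charSum (thetaKernel (moebius γ τ)) (charLeft γ a b) (charRight γ a b) = C * charSum (thetaKernel τ) a b ∧
    charSum (psiKernel (moebius γ τ) (moebius γ w)) (charLeft γ a b) (charRight γ a b) =
      C * rho γ τ w * charSum (psiKernel τ w) a b

theorem kleinLaw_S {τ w : ℂ} (hτ : 0 < τ.im) (hw : 0 < w.im) :
    KleinLaw ModularGroup.S τ w (-Complex.I * csqrt (-Complex.I * τ)) := by
  have hτ0 : τ ≠ 0 := by rintro rfl; simp at hτ
  have hS : ∀ x, moebius ModularGroup.S x = -1 / x := fun x => by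
    simp [moebius, autFactor, ModularGroup.S]
  have hL : ∀ a b, charLeft ModularGroup.S a b = -b := fun a b => by simp [charLeft, ModularGroup.S]
  have hR : ∀ a b, charRight ModularGroup.S a b = a := fun a b => by simp [charRight, ModularGroup.S]
  refine ⟨mul_ne_zero (by simp) (csqrt_ne_zero (by simp [hτ0])), fun a b => ?_⟩
  rw [hS, hS, hL, hR]
  refine ⟨charSum_thetaKernel_inversion hτ a b, ?_⟩
  have h := psiKlein_inversion hτ hw a b
  rw [psiKlein, psiKlein, csqrt_neg_I_mul hτ hw] at h
  rw [h]
  field_simp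

theorem kleinLaw_T (τ w : ℂ) : KleinLaw ModularGroup.T τ w (Complex.exp (Real.pi * Complex.I / 4)) := by
  have hT : ∀ x, moebius ModularGroup.T x = x + 1 := fun x => by
    simp [moebius, autFactor, ModularGroup.T]
  have hA : ∀ x, autFactor ModularGroup.T x = 1 := fun x => by simp [autFactor, ModularGroup.T]
  have hL : ∀ a b, charLeft ModularGroup.T a b = a := fun a b => by simp [charLeft, ModularGroup.T]
  have hR : ∀ a b, charRight ModularGroup.T a b = b - a := fun a b => by
    simp [charRight, ModularGroup.T]; ring
  refine ⟨Complex.exp_ne_zero _, fun a b => ?_⟩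
  have e1 : thetaKernel (τ + 1) = fun x => thetaKernel τ x * Complex.exp (Real.pi * Complex.I * x ^ 2) := by
    ext x
    rw [thetaKernel, thetaKernel, ← Complex.exp_add]
    congr 1; ring
  have e2 : psiKernel (τ + 1) (w + 1) =
      fun x => psiKernel τ w x * Complex.exp (Real.pi * Complex.I * x ^ 2) := by
    ext x
    rw [psiKernel, psiKernel, mul_assoc _ (Complex.exp _), ← Complex.exp_add]
    congr 2 <;> ring_nf
  rw [hT, hT, hL, hR, e1, e2, charSum_translate, charSum_translate, rho, hA, hA, div_one, csqrt_one]
  simp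

/-- The actions on points and characteristics are homomorphic and `rho` is a cocycle, so the
generators `S` and `T` suffice. The constant may depend on `τ` and `w` and is left undetermined,
because it cancels in `genFun`. -/
theorem exists_kleinLaw (γ : SL(2, ℤ)) :
    ∀ τ w : ℂ, 0 < τ.im → 0 < w.im → ∃ C, KleinLaw γ τ w C := by
  have hγ : γ ∈ Subgroup.closure {ModularGroup.S, ModularGroup.T} := by
    rw [SpecialLinearGroup.SL2Z_generators]; trivial
  induction hγ using Subgroup.closure_induction with
  | mem x hx =>
    rcases hx with rfl | rfl
    · exact fun τ w hτ hw => ⟨_, kleinLaw_S hτ hw⟩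
    · exact fun τ w _ _ => ⟨_, kleinLaw_T τ w⟩
  | one =>
    intro τ w _ _
    refine ⟨1, one_ne_zero, fun a b => ?_⟩
    rw [moebius_one, moebius_one, charLeft_one, charRight_one, rho, autFactor_one, autFactor_one, div_one,
      csqrt_one]
    simp
  | mul γ₁ γ₂ _ _ ih₁ ih₂ =>
    intro τ w hτ hw
    obtain ⟨C₂, h2, H2⟩ := ih₂ τ w hτ hw
    obtain ⟨C₁, h1, H1⟩ := ih₁ _ _ (im_moebius_pos γ₂ hτ) (im_moebius_pos γ₂ hw)
    refine ⟨C₁ * C₂, mul_ne_zero h1 h2, fun a b => ?_⟩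
    rw [moebius_mul _ _ hτ, moebius_mul _ _ hw, charLeft_mul, charRight_mul, (H1 _ _).1, (H1 _ _).2,
      (H2 _ _).1, (H2 _ _).2, rho_mul _ _ hτ hw]
    constructor <;> ring
  | inv γ _ ih =>
    intro τ w hτ hw
    have hτ' := im_moebius_pos γ⁻¹ hτ
    have hw' := im_moebius_pos γ⁻¹ hw
    obtain ⟨C, h, H⟩ := ih _ _ hτ' hw'
    refine ⟨C⁻¹, inv_ne_zero h, fun a b => ?_⟩
    have hr := rho_mul γ γ⁻¹ hτ hw
    have hr0 := rho_ne_zero γ hτ' hw'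
    rw [mul_inv_cancel, rho, autFactor_one, autFactor_one, div_one, csqrt_one, one_mul] at hr
    have H1 := H (charLeft γ⁻¹ a b) (charRight γ⁻¹ a b)
    rw [← charLeft_mul, ← charRight_mul, ← moebius_mul _ _ hτ, ← moebius_mul _ _ hw, mul_inv_cancel,
      moebius_one, moebius_one, charLeft_one, charRight_one] at H1
    rw [H1.1, H1.2]
    constructor
    · field_simp
    · set X := charSum (psiKernel (moebius γ⁻¹ τ) (moebius γ⁻¹ w)) (charLeft γ⁻¹ a b) (charRight γ⁻¹ a b)
      linear_combination X * hr - X * rho γ (moebius γ⁻¹ τ) (moebius γ⁻¹ w) * rho γ⁻¹ τ w *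
        inv_mul_cancel₀ h

/-! ### The combination of theta series of level three -/

/-- A summand of `tripleSum`. -/
def tripleTerm (h : ℂ → ℂ) (ε : ℤ) (a b : ℂ) : ℂ :=
  Complex.exp (Real.pi * Complex.I * ε * b) * charSum h (a + ε / 3) (3 * b)

/-- The combination of theta series with shifted characteristics underlying `Ĥ`. -/
def tripleSum (h : ℂ → ℂ) (a b : ℂ) : ℂ := -tripleTerm h 1 a b + tripleTerm h (-1) a b

/-- For `d = 3n + δ` the shift `ε/3` becomes `εδ/3` plus the integer `εn`, and the second
characteristic gains `-εβ`. Quasi-periodicity removes these integers. The resulting factor is the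
same for both signs, because `ε² = 1` and `(-1)^(εm) = (-1)^m`. -/
theorem tripleTerm_transform {α β c n δ ε : ℤ} (hdet : α * (3 * n + δ) - 3 * β * c = 1)
    (hε : ε = 1 ∨ ε = -1) {h h' : ℂ → ℂ} {κ : ℂ}
    (H : ∀ a b : ℂ, charSum h' (((3 * n + δ : ℤ) : ℂ) * a - c * b) (-(3 * β : ℂ) * a + α * b) =
      κ * charSum h a b) (a b : ℂ) :
    (-1 : ℂ) ^ β * (-1 : ℂ) ^ n * Complex.exp (-(Real.pi * Complex.I * β * (3 * n + δ) / 3)) *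
      tripleTerm h' (ε * δ) ((3 * n + δ : ℂ) * a - (3 * c : ℂ) * b) (-(β : ℂ) * a + α * b) =
      κ * tripleTerm h ε a b := by
  have hdet' : (α : ℂ) * (3 * n + δ) - 3 * β * c = 1 := by exact_mod_cast hdet
  have hε2 : (ε : ℂ) ^ 2 = 1 := by rcases hε with rfl | rfl <;> simp
  have hs : ∀ m : ℤ, (-1 : ℂ) ^ (ε * m) = (-1 : ℂ) ^ m := fun m => by
    rcases hε with rfl | rfl
    · rw [one_mul]
    · rw [neg_one_mul, neg_one_zpow_neg]
  have H1 := H (a + ε / 3) (3 * b)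
  set a' : ℂ := (3 * n + δ : ℂ) * a - (3 * c : ℂ) * b with ha'
  set b' : ℂ := -(β : ℂ) * a + α * b with hb'
  have e1 : ((3 * n + δ : ℤ) : ℂ) * (a + ε / 3) - c * (3 * b) =
      (a' + ((ε * δ : ℤ) : ℂ) / 3) + ((ε * n : ℤ) : ℂ) := by
    rw [ha']; push_cast; ring
  have e2 : -(3 * β : ℂ) * (a + ε / 3) + α * (3 * b) = 3 * b' + ((ε * -β : ℤ) : ℂ) := by
    rw [hb']; push_cast; ring
  rw [e1, e2, charSum_add_int_right, charSum_add_int_left, hs, hs, neg_one_zpow_neg] at H1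
  rw [tripleTerm, tripleTerm, mul_left_comm κ, ← H1]
  have key : Complex.exp (-(Real.pi * Complex.I * β * (3 * n + δ) / 3)) *
      Complex.exp (Real.pi * Complex.I * ((ε * δ : ℤ) : ℂ) * b') =
      Complex.exp (Real.pi * Complex.I * ε * b) *
        (Complex.exp (Real.pi * Complex.I * ((ε * -β : ℤ) : ℂ) *
          (a' + ((ε * δ : ℤ) : ℂ) / 3 + ((ε * n : ℤ) : ℂ))) *
        Complex.exp (-(Real.pi * Complex.I * ((ε * n : ℤ) : ℂ) * (3 * b')))) := by
    rw [← Complex.exp_add, ← Complex.exp_add, ← Complex.exp_add]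
    congr 1
    rw [ha', hb']
    push_cast
    linear_combination (Real.pi * Complex.I * ε * b) * hdet' +
      (Real.pi * Complex.I * β * (3 * n + δ) / 3) * hε2
  linear_combination ((-1 : ℂ) ^ β * (-1 : ℂ) ^ n *
    charSum h' (a' + ((ε * δ : ℤ) : ℂ) / 3) (3 * b')) * key

/-- The determinant makes `d ≡ ±1` mod `3`, and the two summands are kept or interchanged
accordingly; antisymmetry turns the exchange into the sign `δ`. The factor `s` does not depend on
the kernels, so one value serves the theta and the error-function series. -/
theorem tripleSum_transform {α β c d : ℤ} (hdet : α * d - 3 * β * c = 1) :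
    ∃ s : ℂ, s ≠ 0 ∧ ∀ (h h' : ℂ → ℂ) (κ : ℂ),
      (∀ a b : ℂ, charSum h' ((d : ℂ) * a - c * b) (-(3 * β : ℂ) * a + α * b) = κ * charSum h a b) →
      ∀ a b : ℂ, tripleSum h' ((d : ℂ) * a - (3 * c : ℂ) * b) (-(β : ℂ) * a + α * b) =
        s * κ * tripleSum h a b := by
  have hd : ∃ n δ : ℤ, d = 3 * n + δ ∧ (δ = 1 ∨ δ = -1) := by
    have h3 : d % 3 ≠ 0 := by
      intro h
      obtain ⟨m, rfl⟩ := Int.dvd_of_emod_eq_zero h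
      have : 3 * (α * m - β * c) = 1 := by linear_combination hdet
      omega
    rcases (by omega : d % 3 = 1 ∨ d % 3 = 2) with h | h
    · exact ⟨d / 3, 1, by omega, Or.inl rfl⟩
    · exact ⟨d / 3 + 1, -1, by omega, Or.inr rfl⟩
  obtain ⟨n, δ, rfl, hδ⟩ := hd
  set s₀ : ℂ := (-1 : ℂ) ^ β * (-1 : ℂ) ^ n * Complex.exp (-(Real.pi * Complex.I * β * (3 * n + δ) / 3))
    with hs₀
  have hs0 : s₀ ≠ 0 := mul_ne_zero (mul_ne_zero (zpow_ne_zero _ (by norm_num))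
    (zpow_ne_zero _ (by norm_num))) (Complex.exp_ne_zero _)
  refine ⟨δ / s₀, div_ne_zero (by rcases hδ with rfl | rfl <;> simp) hs0, fun h h' κ H a b => ?_⟩
  have t1 := tripleTerm_transform hdet (Or.inl rfl) H a b
  have t2 := tripleTerm_transform hdet (Or.inr rfl) H a b
  rw [← hs₀] at t1 t2
  push_cast
  rw [tripleSum, tripleSum]
  generalize (3 * (n : ℂ) + δ) * a - 3 * c * b = a' at t1 t2 ⊢
  generalize -(β : ℂ) * a + α * b = b' at t1 t2 ⊢
  clear_value s₀
  rcases hδ with rfl | rfl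
  · norm_num at t1 t2 ⊢
    field_simp
    linear_combination -t1 + t2
  · norm_num at t1 t2 ⊢
    field_simp
    linear_combination t1 - t2

/-! ### Partial theta functions and the rank generating function -/

theorem exp_two_pi_sub_one (z : ℂ) : Complex.exp (2 * Real.pi * Complex.I * z) - 1 =
    Complex.exp (Real.pi * z * Complex.I) * (2 * Complex.I * Complex.sin (Real.pi * z)) := by
  rw [Complex.sin, show 2 * Real.pi * Complex.I * z =
    Real.pi * z * Complex.I + Real.pi * z * Complex.I by ring, Complex.exp_add]
  have : Complex.exp (Real.pi * z * Complex.I) * Complex.exp (-(Real.pi * z) * Complex.I) = 1 := by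
    rw [← Complex.exp_add]; simp
  linear_combination (Complex.exp (Real.pi * z * Complex.I) ^ 2 -
    Complex.exp (Real.pi * z * Complex.I) * Complex.exp (-(Real.pi * z) * Complex.I)) *
      Complex.I_sq + this

theorem qOf_pow (τ : ℂ) (n : ℕ) : qOf τ ^ n = Complex.exp (2 * Real.pi * Complex.I * (n * τ)) := by
  rw [qOf, ← Complex.exp_nat_mul]
  congr 1; ring

theorem tri_cast (n : ℕ) : (tri n : ℂ) = (n : ℂ) * (n + 1) / 2 := by
  have h := congrArg (Nat.cast : ℕ → ℂ) (two_mul_tri n)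
  push_cast at h
  linear_combination h / 2

theorem triInt_cast (n : ℤ) : (triInt n : ℂ) = (n : ℂ) * (n + 1) / 2 := by
  have h := congrArg (Int.cast : ℤ → ℂ) (two_mul_triInt n)
  push_cast at h
  linear_combination h / 2

/-- The terms of the theta function `ϑ`. -/
def thetaTerm (n : ℤ) (z τ : ℂ) : ℂ :=
  (-1 : ℂ) ^ n * Complex.exp (Real.pi * Complex.I * ((n : ℂ) + 1 / 2) ^ 2 * τ) *
    Complex.exp (2 * Real.pi * Complex.I * ((n : ℂ) + 1 / 2) * z)

theorem norm_thetaTerm (n : ℤ) (z τ : ℂ) : ‖thetaTerm n z τ‖ =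
    ‖Complex.exp (Real.pi * Complex.I * τ / 4 + Real.pi * Complex.I * z)‖ *
      ‖jacobiTheta₂_term n (z + τ / 2) τ‖ := by
  rw [thetaTerm, norm_mul, norm_mul, norm_neg_one_zpow_complex, one_mul, ← norm_mul, ← norm_mul,
    jacobiTheta₂_term, ← Complex.exp_add, ← Complex.exp_add]
  congr 2; ring

theorem summable_norm_thetaTerm (z : ℂ) {τ : ℂ} (hτ : 0 < τ.im) :
    Summable fun n : ℤ => ‖thetaTerm n z τ‖ := by
  simp only [norm_thetaTerm]
  exact ((summable_jacobiTheta₂_term_iff (z + τ / 2) τ).mpr hτ).norm.mul_left _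

theorem summable_thetaTerm (z : ℂ) {τ : ℂ} (hτ : 0 < τ.im) :
    Summable fun n : ℤ => thetaTerm n z τ := (summable_norm_thetaTerm z hτ).of_norm

theorem thetaTerm_neg_add_one (n : ℕ) (z τ : ℂ) :
    thetaTerm (-((n : ℤ) + 1)) z τ = -thetaTerm n (-z) τ := by
  rw [thetaTerm, thetaTerm, neg_one_zpow_neg, zpow_add₀ (by norm_num), zpow_one,
    show ((-((n : ℤ) + 1) : ℤ) : ℂ) + 1 / 2 = -(((n : ℤ) : ℂ) + 1 / 2) by push_cast; ring, neg_sq]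
  ring_nf

theorem summable_thetaTerm_nat (z : ℂ) {τ : ℂ} (hτ : 0 < τ.im) :
    Summable fun n : ℕ => thetaTerm n z τ := (summable_thetaTerm z hτ).comp_injective Nat.cast_injective

/-- The partial theta function `2 i ∑_{n ≥ 0} (-1) ^ n q ^ ((n + 1/2) ^ 2 / 2) ζ ^ (n + 1/2)`. -/
def partialTheta (z τ : ℂ) : ℂ := 2 * Complex.I * ∑' n : ℕ, thetaTerm n z τ

theorem tsum_thetaTerm_sign {s : ℂ} (z : ℂ) {τ : ℂ} (hτ : 0 < τ.im) :
    Complex.I * ∑' n : ℤ, (if 0 ≤ n then 1 else s) * thetaTerm n z τ =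
      (partialTheta z τ - s * partialTheta (-z) τ) / 2 := by
  have h1 := summable_thetaTerm_nat z hτ
  have h2 := (summable_thetaTerm_nat (-z) hτ).mul_left (-s)
  have e1 : ∀ n : ℕ, (if 0 ≤ (n : ℤ) then 1 else s) * thetaTerm n z τ = thetaTerm n z τ := fun n => by
    rw [if_pos (Int.natCast_nonneg n), one_mul]
  have e2 : ∀ n : ℕ, (if 0 ≤ (-((n : ℤ) + 1)) then 1 else s) * thetaTerm (-((n : ℤ) + 1)) z τ =
      -s * thetaTerm n (-z) τ := fun n => by
    rw [if_neg (by omega), thetaTerm_neg_add_one]; ring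
  rw [tsum_of_nat_of_neg_add_one (by simpa only [e1] using h1) (by simpa only [e2] using h2)]
  simp only [e1, e2]
  rw [tsum_mul_left, partialTheta, partialTheta]
  ring

theorem jacobiTheta_eq_tsum (z τ : ℂ) : jacobiTheta z τ = Complex.I * ∑' n : ℤ, thetaTerm n z τ := rfl

theorem jacobiTheta_eq_partialTheta (z : ℂ) {τ : ℂ} (hτ : 0 < τ.im) :
    jacobiTheta z τ = (partialTheta z τ - partialTheta (-z) τ) / 2 := by
  have h := tsum_thetaTerm_sign (s := 1) z hτ
  simp only [ite_self, one_mul] at h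
  exact h

/-- The false theta function `i ∑ sgn (n + 1/2) (-1) ^ n q ^ ((n + 1/2) ^ 2 / 2) ζ ^ (n + 1/2)`. -/
def signTheta (z τ : ℂ) : ℂ := (partialTheta z τ + partialTheta (-z) τ) / 2

theorem signTheta_eq_tsum (z : ℂ) {τ : ℂ} (hτ : 0 < τ.im) :
    signTheta z τ = Complex.I * ∑' n : ℤ, (if 0 ≤ n then 1 else -1) * thetaTerm n z τ := by
  rw [tsum_thetaTerm_sign z hτ, signTheta]
  ring

/-- The expression `i / 2 * q ^ (1/8) * (- ζ * F(3 z + τ) + ζ⁻¹ * F(3 z - τ))`. -/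
def tripleFactor (F : ℂ → ℂ) (z τ : ℂ) : ℂ :=
  Complex.I / 2 * Complex.exp (2 * Real.pi * Complex.I * τ / 8) *
    (-(Complex.exp (2 * Real.pi * Complex.I * z) * F (3 * z + τ)) +
      Complex.exp (-(2 * Real.pi * Complex.I * z)) * F (3 * z - τ))

theorem tripleFactor_neg (F : ℂ → ℂ) (z τ : ℂ) :
    tripleFactor (fun y => F (-y)) z τ = -tripleFactor F (-z) τ := by
  simp only [tripleFactor]
  rw [show -(3 * z + τ) = 3 * -z - τ by ring, show -(3 * z - τ) = 3 * -z + τ by ring,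
    show 2 * Real.pi * Complex.I * -z = -(2 * Real.pi * Complex.I * z) by ring, neg_neg]
  ring

/-- The product `(ζ q; q)_∞ (ζ⁻¹ q; q)_∞`. -/
def rankProd (z τ : ℂ) : ℂ :=
  poch (qOf τ) (Complex.exp (2 * Real.pi * Complex.I * z) * qOf τ) *
    poch (qOf τ) ((Complex.exp (2 * Real.pi * Complex.I * z))⁻¹ * qOf τ)

theorem rankProd_eq_exp {z τ : ℂ} (h : |z.im| < τ.im) : rankProd z τ = Complex.exp (-lambertSeries z τ) :=
  poch_mul_poch_eq_exp h

theorem rankProd_ne_zero {z τ : ℂ} (h : |z.im| < τ.im) : rankProd z τ ≠ 0 := by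
  rw [rankProd_eq_exp h]
  exact Complex.exp_ne_zero _

theorem rankProd_neg (z τ : ℂ) : rankProd (-z) τ = rankProd z τ := by
  rw [rankProd, rankProd, mul_neg, Complex.exp_neg, inv_inv, mul_comm]

theorem thetaProd_mul_exp {τ : ℂ} (hτ : 0 < τ.im) (z : ℂ) :
    Complex.exp (2 * Real.pi * Complex.I * z) * thetaProd (qOf τ) (Complex.exp (2 * Real.pi * Complex.I * z)) =
      (Complex.exp (2 * Real.pi * Complex.I * z) - 1) * rankProd z τ := by
  rw [thetaProd, poch_eq_mul (norm_qOf_lt_one hτ) (Complex.exp (2 * Real.pi * Complex.I * z))⁻¹, rankProd]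
  have h := Complex.exp_ne_zero (2 * Real.pi * Complex.I * z)
  field_simp

/-- The Jacobi triple product. -/
theorem jacobiTheta_eq_prod {τ : ℂ} (hτ : 0 < τ.im) (z : ℂ) :
    jacobiTheta z τ = -2 * Complex.exp (2 * Real.pi * Complex.I * τ / 8) * poch (qOf τ) (qOf τ) *
      Complex.sin (Real.pi * z) * rankProd z τ := by
  set ζ := Complex.exp (2 * Real.pi * Complex.I * z) with hζ
  have hζ0 : ζ ≠ 0 := Complex.exp_ne_zero _
  have hterm (n : ℤ) : ζ ^ n * qOf τ ^ triInt n = jacobiTheta₂_term n (z + τ / 2) τ := by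
    rw [hζ, qOf, ← Complex.exp_int_mul, ← Complex.exp_int_mul, ← Complex.exp_add, jacobiTheta₂_term, triInt_cast]
    congr 1; ring
  have hsum : Summable fun n : ℤ => ‖ζ ^ n * qOf τ ^ triInt n‖ := by
    simp only [hterm]
    exact ((summable_jacobiTheta₂_term_iff (z + τ / 2) τ).mpr hτ).norm
  have h1 := tsum_triple (norm_qOf_lt_one hτ) (qOf_ne_zero τ) hζ0 hsum
  have h2 : jacobiTheta z τ = Complex.I * (Complex.exp (2 * Real.pi * Complex.I * τ / 8) *
      Complex.exp (Real.pi * z * Complex.I) * (poch (qOf τ) (qOf τ) * thetaProd (qOf τ) ζ)) := by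
    rw [← h1, jacobiTheta_eq_tsum]
    congr 1
    rw [← tsum_mul_left]
    refine tsum_congr fun n => ?_
    rw [hterm, thetaTerm, jacobiTheta₂_term]
    have : Complex.exp (Real.pi * Complex.I * ((n : ℂ) + 1 / 2) ^ 2 * τ) *
        Complex.exp (2 * Real.pi * Complex.I * ((n : ℂ) + 1 / 2) * z) =
        Complex.exp (2 * Real.pi * Complex.I * τ / 8) * Complex.exp (Real.pi * z * Complex.I) *
        Complex.exp (2 * Real.pi * Complex.I * n * (z + τ / 2) + Real.pi * Complex.I * (n : ℂ) ^ 2 * τ) := by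
      rw [← Complex.exp_add, ← Complex.exp_add, ← Complex.exp_add]
      congr 1; ring
    linear_combination (-1 : ℂ) ^ n * this
  have h3 := thetaProd_mul_exp hτ z
  have h4 := exp_two_pi_sub_one z
  have h5 : ζ = Complex.exp (Real.pi * z * Complex.I) * Complex.exp (Real.pi * z * Complex.I) := by
    rw [hζ, ← Complex.exp_add]; congr 1; ring
  rw [← hζ, h4] at h3
  rw [h2]
  have hE := Complex.exp_ne_zero (Real.pi * z * Complex.I)
  set E := Complex.exp (Real.pi * z * Complex.I)
  have h6 : E * thetaProd (qOf τ) ζ = 2 * Complex.I * Complex.sin (Real.pi * z) * rankProd z τ := by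
    apply mul_left_cancel₀ hE
    rw [← mul_assoc, ← h5, h3]; ring
  linear_combination (Complex.I * Complex.exp (2 * Real.pi * Complex.I * τ / 8) * poch (qOf τ) (qOf τ)) * h6 +
    (2 * Complex.exp (2 * Real.pi * Complex.I * τ / 8) * poch (qOf τ) (qOf τ) *
      Complex.sin (Real.pi * z) * rankProd z τ) * Complex.I_sq

theorem partialTheta_two_mul (z τ : ℂ) :
    partialTheta (2 * z) τ = 2 * Complex.I * Complex.exp (2 * Real.pi * Complex.I * τ / 8) *
      ∑' n : ℕ, (-1 : ℂ) ^ n * Complex.exp (2 * Real.pi * Complex.I * z) ^ (2 * n + 1) * qOf τ ^ tri n := by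
  rw [partialTheta, mul_assoc (2 * Complex.I)]
  congr 1
  rw [← tsum_mul_left]
  refine tsum_congr fun n => ?_
  rw [thetaTerm, qOf_pow, ← Complex.exp_nat_mul, tri_cast, zpow_natCast]
  have : Complex.exp (Real.pi * Complex.I * (((n : ℤ) : ℂ) + 1 / 2) ^ 2 * τ) *
      Complex.exp (2 * Real.pi * Complex.I * (((n : ℤ) : ℂ) + 1 / 2) * (2 * z)) =
      Complex.exp (2 * Real.pi * Complex.I * τ / 8) *
        (Complex.exp (((2 * n + 1 : ℕ) : ℂ) * (2 * Real.pi * Complex.I * z)) *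
        Complex.exp (2 * Real.pi * Complex.I * ((n : ℂ) * (n + 1) / 2 * τ))) := by
    rw [← Complex.exp_add, ← Complex.exp_add, ← Complex.exp_add]
    push_cast
    congr 1; ring
  linear_combination (-1 : ℂ) ^ n * this

theorem tripleFactor_partialTheta (z : ℂ) {τ : ℂ} (hτ : 0 < τ.im) :
    tripleFactor (fun y => partialTheta y (3 * τ)) z τ = -Complex.exp (Real.pi * z * Complex.I) *
      ∑' n : ℕ, (-1 : ℂ) ^ n * Complex.exp (2 * Real.pi * Complex.I * z) ^ (3 * n) *
        qOf τ ^ (n ^ 2 + tri n) * (1 - Complex.exp (2 * Real.pi * Complex.I * z) ^ 2 * qOf τ ^ (2 * n + 1)) := by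
  have h3 : 0 < (3 * τ).im := by
    rw [show (3 : ℂ) * τ = ((3 : ℝ) : ℂ) * τ by norm_num, Complex.im_ofReal_mul]; linarith
  have s1 := (summable_thetaTerm_nat (3 * z + τ) h3).mul_left
    (-Complex.exp (2 * Real.pi * Complex.I * z))
  have s2 := (summable_thetaTerm_nat (3 * z - τ) h3).mul_left
    (Complex.exp (-(2 * Real.pi * Complex.I * z)))
  have s3 := s1.tsum_add s2
  rw [tsum_mul_left, tsum_mul_left] at s3
  have e1 : tripleFactor (fun y => partialTheta y (3 * τ)) z τ =
      -(Complex.exp (2 * Real.pi * Complex.I * τ / 8) *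
        ∑' n : ℕ, (-Complex.exp (2 * Real.pi * Complex.I * z) * thetaTerm n (3 * z + τ) (3 * τ) +
          Complex.exp (-(2 * Real.pi * Complex.I * z)) * thetaTerm n (3 * z - τ) (3 * τ))) := by
    rw [s3]
    simp only [tripleFactor, partialTheta]
    linear_combination (Complex.exp (2 * Real.pi * Complex.I * τ / 8) *
      (-Complex.exp (2 * Real.pi * Complex.I * z) * ∑' n : ℕ, thetaTerm n (3 * z + τ) (3 * τ) +
      Complex.exp (-(2 * Real.pi * Complex.I * z)) * ∑' n : ℕ, thetaTerm n (3 * z - τ) (3 * τ))) *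
        Complex.I_sq
  rw [e1, neg_mul]
  congr 1
  rw [← tsum_mul_left, ← tsum_mul_left]
  refine tsum_congr fun n => ?_
  rw [thetaTerm, thetaTerm, qOf_pow, qOf_pow, ← Complex.exp_nat_mul, ← Complex.exp_nat_mul, zpow_natCast]
  have k1 : Complex.exp (2 * Real.pi * Complex.I * τ / 8) * (Complex.exp (2 * Real.pi * Complex.I * z) *
      (Complex.exp (Real.pi * Complex.I * (((n : ℤ) : ℂ) + 1 / 2) ^ 2 * (3 * τ)) *
      Complex.exp (2 * Real.pi * Complex.I * (((n : ℤ) : ℂ) + 1 / 2) * (3 * z + τ)))) =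
      Complex.exp (Real.pi * z * Complex.I) * (Complex.exp (((3 * n : ℕ) : ℂ) * (2 * Real.pi * Complex.I * z)) *
      (Complex.exp (2 * Real.pi * Complex.I * (((n ^ 2 + tri n : ℕ) : ℂ) * τ)) *
      (Complex.exp (((2 : ℕ) : ℂ) * (2 * Real.pi * Complex.I * z)) *
      Complex.exp (2 * Real.pi * Complex.I * (((2 * n + 1 : ℕ) : ℂ) * τ))))) := by
    simp only [← Complex.exp_add]
    push_cast
    rw [tri_cast]
    congr 1; ring
  have k2 : Complex.exp (2 * Real.pi * Complex.I * τ / 8) * (Complex.exp (-(2 * Real.pi * Complex.I * z)) *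
      (Complex.exp (Real.pi * Complex.I * (((n : ℤ) : ℂ) + 1 / 2) ^ 2 * (3 * τ)) *
      Complex.exp (2 * Real.pi * Complex.I * (((n : ℤ) : ℂ) + 1 / 2) * (3 * z - τ)))) =
      Complex.exp (Real.pi * z * Complex.I) * (Complex.exp (((3 * n : ℕ) : ℂ) * (2 * Real.pi * Complex.I * z)) *
      Complex.exp (2 * Real.pi * Complex.I * (((n ^ 2 + tri n : ℕ) : ℂ) * τ))) := by
    simp only [← Complex.exp_add]
    push_cast
    rw [tri_cast]
    congr 1; ring
  linear_combination (-1 : ℂ) ^ n * (k2 - k1)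

theorem norm_exp_mul_qOf_lt_one {z τ : ℂ} (h : |z.im| < τ.im) :
    ‖Complex.exp (2 * Real.pi * Complex.I * z) * qOf τ‖ < 1 := by
  rw [qOf, ← Complex.exp_add, ← mul_add, norm_exp_two_pi_I_mul, Real.exp_lt_one_iff]
  have h1 : 0 < (z + τ).im := by
    rw [Complex.add_im]
    linarith [neg_abs_le z.im]
  have := Real.two_pi_pos
  have : 0 < 2 * Real.pi * (z + τ).im := by positivity
  linarith

theorem unimodalGF_mul_rankProd {z τ : ℂ} (h : |z.im| < τ.im) :
    unimodalGF (Complex.exp (2 * Real.pi * Complex.I * z)) (qOf τ) * rankProd z τ =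
      rankSeries (qOf τ) (Complex.exp (2 * Real.pi * Complex.I * z)) := by
  have hτ : 0 < τ.im := (abs_nonneg _).trans_lt h
  refine unimodalGF_mul_poch (Complex.exp_ne_zero _) (norm_qOf_lt_one hτ) (norm_exp_mul_qOf_lt_one h) ?_
  rw [← Complex.exp_neg, ← mul_neg]
  exact norm_exp_mul_qOf_lt_one (by simpa using h)

theorem rankSeries_inv (q a : ℂ) : rankSeries q a⁻¹ = rankSeries q a := by
  rw [rankSeries, rankSeries]
  refine tsum_congr fun n => ?_
  rw [inv_inv, mul_comm (poch q (a⁻¹ * _))]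

/-- A rewriting of `rankSeries_eq`: `a * thetaProd q a` becomes `(ζ - 1)` times `rankProd`, and half
of the exponential of `ζ - 1` is absorbed by `tripleFactor`. -/
theorem rankSeries_eq_partialTheta {z τ : ℂ} (h : |z.im| < τ.im) :
    rankSeries (qOf τ) (Complex.exp (2 * Real.pi * Complex.I * z)) =
      2 * Complex.I * Complex.sin (Real.pi * z) * rankProd z τ *
        tripleFactor (fun y => partialTheta y (3 * τ)) z τ +
      partialTheta (2 * z) τ / (2 * Complex.I * Complex.exp (2 * Real.pi * Complex.I * τ / 8)) := by
  have hτ : 0 < τ.im := (abs_nonneg _).trans_lt h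
  rw [rankSeries_eq (norm_qOf_lt_one hτ) (qOf_ne_zero τ) (Complex.exp_ne_zero _), thetaProd_mul_exp hτ,
    tripleFactor_partialTheta z hτ, partialTheta_two_mul, exp_two_pi_sub_one, mul_div_cancel_left₀ _
    (mul_ne_zero (by simp) (Complex.exp_ne_zero _))]
  ring

theorem tripleFactor_jacobiTheta (z : ℂ) {τ : ℂ} (hτ : 0 < τ.im) :
    tripleFactor (fun y => jacobiTheta y (3 * τ)) z τ =
      (tripleFactor (fun y => partialTheta y (3 * τ)) z τ +
        tripleFactor (fun y => partialTheta y (3 * τ)) (-z) τ) / 2 := by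
  have h3 : 0 < (3 * τ).im := by
    rw [show (3 : ℂ) * τ = ((3 : ℝ) : ℂ) * τ by norm_num, Complex.im_ofReal_mul]; linarith
  have h := tripleFactor_neg (fun y => partialTheta y (3 * τ)) z τ
  rw [← neg_eq_iff_eq_neg] at h
  rw [← h]
  simp only [tripleFactor, jacobiTheta_eq_partialTheta _ h3]
  ring

theorem tripleFactor_signTheta (z τ : ℂ) :
    tripleFactor (fun y => signTheta y (3 * τ)) z τ =
      (tripleFactor (fun y => partialTheta y (3 * τ)) z τ -
        tripleFactor (fun y => partialTheta y (3 * τ)) (-z) τ) / 2 := by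
  have h := tripleFactor_neg (fun y => partialTheta y (3 * τ)) z τ
  rw [← neg_eq_iff_eq_neg] at h
  rw [← h]
  simp only [tripleFactor, signTheta]
  ring

/-- The even part of the partial theta expansion of the rank series. -/
theorem rankSeries_eq_signTheta {z τ : ℂ} (h : |z.im| < τ.im) :
    rankSeries (qOf τ) (Complex.exp (2 * Real.pi * Complex.I * z)) =
      2 * Complex.I * Complex.sin (Real.pi * z) * rankProd z τ *
        tripleFactor (fun y => signTheta y (3 * τ)) z τ +
      signTheta (2 * z) τ / (2 * Complex.I * Complex.exp (2 * Real.pi * Complex.I * τ / 8)) := by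
  have h1 := rankSeries_eq_partialTheta h
  have h2 := rankSeries_eq_partialTheta (z := -z) (τ := τ) (by simpa using h)
  rw [mul_neg, Complex.exp_neg, rankSeries_inv, rankProd_neg, mul_neg, Complex.sin_neg, mul_neg 2 z] at h2
  rw [tripleFactor_signTheta, signTheta]
  linear_combination (h1 + h2) / 2

/-- The odd part of the partial theta expansion of the rank series: a quintuple product identity. -/
theorem jacobiTheta_two_mul {z τ : ℂ} (h : |z.im| < τ.im) :
    jacobiTheta (2 * z) τ = 4 * Complex.exp (2 * Real.pi * Complex.I * τ / 8) * rankProd z τ *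
      Complex.sin (Real.pi * z) * tripleFactor (fun y => jacobiTheta y (3 * τ)) z τ := by
  have hτ : 0 < τ.im := (abs_nonneg _).trans_lt h
  have h1 := rankSeries_eq_partialTheta h
  have h2 := rankSeries_eq_partialTheta (z := -z) (τ := τ) (by simpa using h)
  rw [mul_neg, Complex.exp_neg, rankSeries_inv, rankProd_neg, mul_neg, Complex.sin_neg, mul_neg 2 z] at h2
  rw [tripleFactor_jacobiTheta z hτ, jacobiTheta_eq_partialTheta _ hτ]
  have hE := Complex.exp_ne_zero (2 * Real.pi * Complex.I * τ / 8)
  set E := Complex.exp (2 * Real.pi * Complex.I * τ / 8)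
  set S := Complex.sin (Real.pi * z)
  set T1 := tripleFactor (fun y => partialTheta y (3 * τ)) z τ
  set T2 := tripleFactor (fun y => partialTheta y (3 * τ)) (-z) τ
  -- The rank series is invariant under `ζ ↦ ζ⁻¹`, so subtracting its two expansions eliminates it.
  have h3 : (partialTheta (2 * z) τ - partialTheta (-(2 * z)) τ) / (2 * Complex.I * E) =
      -(2 * Complex.I * S * rankProd z τ * (T1 + T2)) := by
    linear_combination h2 - h1
  rw [div_eq_iff (mul_ne_zero (by simp) hE)] at h3
  linear_combination h3 / 2 - 2 * E * S * rankProd z τ * (T1 + T2) * Complex.I_sq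

/-! ### A generating function for the completed coefficients -/

theorem three_mul_im (τ : ℂ) : (3 * τ).im = 3 * τ.im := by
  rw [show (3 : ℂ) * τ = ((3 : ℝ) : ℂ) * τ by norm_num, Complex.im_ofReal_mul]

theorem three_mul_im_pos {τ : ℂ} (hτ : 0 < τ.im) : 0 < (3 * τ).im := by
  rw [three_mul_im]; linarith

theorem analyticAt_jacobiTheta {τ : ℂ} (hτ : 0 < τ.im) (z : ℂ) :
    AnalyticAt ℂ (fun z => jacobiTheta z τ) z := by
  have h : (fun z => jacobiTheta z τ) = fun z => Complex.exp (Real.pi * Complex.I * (-(0 * (z + 1)) +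
      (0 + 1 / 2) ^ 2 * τ + 2 * (0 + 1 / 2) * (z + 1 / 2))) *
        jacobiTheta₂ ((0 + 1 / 2) * τ + (z + 1 / 2)) τ := by
    ext z
    rw [← charSum_thetaKernel_eq_jacobiTheta₂, charSum_thetaKernel]
    simp
  have hd : Differentiable ℂ fun z => jacobiTheta z τ := by
    rw [h]
    intro z
    refine DifferentiableAt.mul (by fun_prop) ?_
    exact DifferentiableAt.fun_comp' (g := fun z => jacobiTheta₂ z τ) z
      (differentiableAt_jacobiTheta₂_fst _ hτ) (by fun_prop)
  exact hd.analyticAt z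

/-- The holomorphic function of `z`, `v`, `τ`, `w` whose value at `v = 1 / (2 i τ₂)` gives `K` for the
completed part of `T̂`. -/
def psiTriple (z v τ w : ℂ) : ℂ :=
  Complex.I / 2 * Complex.exp (2 * Real.pi * Complex.I * τ / 8) *
    (-(Complex.exp (2 * Real.pi * Complex.I * z) * psiCore (z * v + 1 / 3) (3 * z + τ) (3 * τ) (3 * w)) +
      Complex.exp (-(2 * Real.pi * Complex.I * z)) * psiCore (z * v - 1 / 3) (3 * z - τ) (3 * τ) (3 * w))

/-- The normalized generating function whose exponential Taylor coefficients in `z` at `v = 1 / (2 i τ₂)` are the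
numbers `2 û_k(τ, w)`. -/
def genFun (z v τ w : ℂ) : ℂ :=
  eisExp z τ * psiCore (2 * z * v) (2 * z) τ w / psiCore 0 0 τ w -
    4 * Real.pi * (Real.sqrt 3 : ℂ) * z * Complex.exp (2 * Real.pi * Complex.I * τ / 8) *
      Complex.exp (-lambertSeries 0 τ) * psiTriple z v τ w / psiCore 0 0 τ w

/-- The factor `-i √(π i (w - τ))` in the argument of `erf`. -/
def psiFactor (τ w : ℂ) : ℂ := -Complex.I * csqrt (Real.pi * Complex.I * (w - τ))

theorem psiFactor_three_mul (τ w : ℂ) : psiFactor (3 * τ) (3 * w) = (Real.sqrt 3 : ℂ) * psiFactor τ w := by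
  have h : csqrt (Real.pi * Complex.I * (3 * w - 3 * τ)) =
      (Real.sqrt 3 : ℂ) * csqrt (Real.pi * Complex.I * (w - τ)) := by
    rw [show Real.pi * Complex.I * (3 * w - 3 * τ) = ((3 : ℝ) : ℂ) * (Real.pi * Complex.I * (w - τ)) by
      push_cast; ring]
    set x := Real.pi * Complex.I * (w - τ)
    by_cases hx : x = 0
    · rw [hx]; simp [csqrt]
    · rw [csqrt, csqrt, Complex.cpow_def_of_ne_zero (mul_ne_zero (by norm_num) hx),
        Complex.cpow_def_of_ne_zero hx, Complex.log_ofReal_mul (by norm_num) hx, add_mul, Complex.exp_add,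
        Real.sqrt_eq_rpow, Real.rpow_def_of_pos (by norm_num)]
      push_cast
      rfl
  rw [psiFactor, psiFactor, h]
  ring

theorem psiFactor_ne_zero {τ w : ℂ} (h : τ ≠ w) : psiFactor τ w ≠ 0 := by
  have hpi : (Real.pi : ℂ) ≠ 0 := by exact_mod_cast Real.pi_ne_zero
  exact mul_ne_zero (by simp) (csqrt_ne_zero (mul_ne_zero (mul_ne_zero hpi Complex.I_ne_zero)
    (sub_ne_zero.mpr h.symm)))

/-- The value `1 / (2 i Im τ)`. -/
def invIm (τ : ℂ) : ℂ := 1 / (2 * Complex.I * (τ.im : ℂ))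

theorem THat_zero_right (z τ w : ℂ) :
    THat z 0 τ w = jacobiTheta z τ + psiFactor τ w * psiCore (z * invIm τ) z τ w := by
  rw [THat, psiHat_eq, psiFactor, invIm]
  congr 3
  rw [sub_zero, div_div, mul_one_div]

/-- With `z' = 0` the shifts `±τ` and `±conj τ` contribute `±2i Im τ`. Divided by `2i * 3 Im τ` this
is the characteristic `±1/3`, next to `z/(2i Im τ)`. -/
theorem HHatFactor_zero_right {τ : ℂ} (hτ : 0 < τ.im) (z w : ℂ) :
    HHatFactor z 0 τ w = tripleFactor (fun y => jacobiTheta y (3 * τ)) z τ +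
      (Real.sqrt 3 : ℂ) * psiFactor τ w * psiTriple z (invIm τ) τ w := by
  have hi : (τ.im : ℂ) ≠ 0 := by exact_mod_cast hτ.ne'
  have hconj : τ - (starRingEnd ℂ) τ = 2 * Complex.I * (τ.im : ℂ) := by
    rw [Complex.sub_conj]; push_cast; ring
  have e1 : (3 * z + τ - (3 * 0 + (starRingEnd ℂ) τ)) / (2 * Complex.I) / ((3 * τ).im : ℂ) =
      z * invIm τ + 1 / 3 := by
    rw [three_mul_im, invIm, show 3 * z + τ - (3 * 0 + (starRingEnd ℂ) τ) =
      3 * z + (τ - (starRingEnd ℂ) τ) by ring, hconj]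
    push_cast
    field_simp
  have e2 : (3 * z - τ - (3 * 0 - (starRingEnd ℂ) τ)) / (2 * Complex.I) / ((3 * τ).im : ℂ) =
      z * invIm τ - 1 / 3 := by
    rw [three_mul_im, invIm, show 3 * z - τ - (3 * 0 - (starRingEnd ℂ) τ) =
      3 * z - (τ - (starRingEnd ℂ) τ) by ring, hconj]
    push_cast
    field_simp
  rw [HHatFactor, THat, THat, psiHat_eq, psiHat_eq, e1, e2, ← psiFactor, psiFactor_three_mul, tripleFactor,
    psiTriple]
  ring

theorem jacobiTheta_zero {τ : ℂ} (hτ : 0 < τ.im) : jacobiTheta 0 τ = 0 := by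
  rw [jacobiTheta_eq_prod hτ]; simp

theorem psiTriple_zero (v τ w : ℂ) : psiTriple 0 v τ w = 0 := by
  have h := psiCore_neg (τ := 3 * τ) (w := 3 * w) (1 / 3) τ
  simp only [psiTriple, mul_zero, zero_mul, zero_add, zero_sub, neg_zero, Complex.exp_zero, one_mul]
  rw [h]
  ring

/-! ### Joint holomorphy of the building blocks. -/

theorem analyticAt_psiCore_comp {E : Type*} [NormedAddCommGroup E] [NormedSpace ℂ E] {a z τ w : E → ℂ} {x : E}
    (ha : AnalyticAt ℂ a x) (hz : AnalyticAt ℂ z x) (ht : AnalyticAt ℂ τ x) (hw : AnalyticAt ℂ w x)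
    (hτ0 : 0 < (τ x).im) (hw0 : 0 < (w x).im) :
    AnalyticAt ℂ (fun y => psiCore (a y) (z y) (τ y) (w y)) x :=
  AnalyticAt.fun_comp (f := fun y => (a y, z y, τ y, w y))
    (analyticAt_psiCore (x := (a x, z x, τ x, w x)) ⟨hτ0, hw0⟩) (ha.prod (hz.prod (ht.prod hw)))

theorem analyticAt_psiTriple_comp {E : Type*} [NormedAddCommGroup E] [NormedSpace ℂ E] {z v τ w : E → ℂ} {x : E}
    (hz : AnalyticAt ℂ z x) (hv : AnalyticAt ℂ v x) (ht : AnalyticAt ℂ τ x) (hw : AnalyticAt ℂ w x)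
    (hτ0 : 0 < (τ x).im) (hw0 : 0 < (w x).im) :
    AnalyticAt ℂ (fun y => psiTriple (z y) (v y) (τ y) (w y)) x := by
  have h3t : AnalyticAt ℂ (fun y => 3 * τ y) x := analyticAt_const.mul ht
  have h3w : AnalyticAt ℂ (fun y => 3 * w y) x := analyticAt_const.mul hw
  have h3z : AnalyticAt ℂ (fun y => 3 * z y) x := analyticAt_const.mul hz
  have h1 := analyticAt_psiCore_comp ((hz.fun_mul hv).fun_add (analyticAt_const (v := (1 / 3 : ℂ))))
    (h3z.fun_add ht) h3t h3w (three_mul_im_pos hτ0) (three_mul_im_pos hw0)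
  have h2 := analyticAt_psiCore_comp ((hz.fun_mul hv).fun_sub (analyticAt_const (v := (1 / 3 : ℂ))))
    (h3z.fun_sub ht) h3t h3w (three_mul_im_pos hτ0) (three_mul_im_pos hw0)
  unfold psiTriple
  fun_prop

theorem analyticAt_lambertSeries_comp {E : Type*} [NormedAddCommGroup E] [NormedSpace ℂ E] {z τ : E → ℂ} {x : E}
    (hz : AnalyticAt ℂ z x) (ht : AnalyticAt ℂ τ x) (h : |(z x).im| < (τ x).im) :
    AnalyticAt ℂ (fun y => lambertSeries (z y) (τ y)) x :=
  AnalyticAt.fun_comp (f := fun y => (z y, τ y)) (analyticAt_lambertSeries (x := (z x, τ x)) h) (hz.prod ht)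

theorem sincPi_zero_ne_zero : sincPi 0 ≠ 0 := by rw [sincPi_zero]; exact one_ne_zero

theorem analyticAt_eisExp_comp {E : Type*} [NormedAddCommGroup E] [NormedSpace ℂ E] {z τ : E → ℂ} {x : E}
    (hz : AnalyticAt ℂ z x) (ht : AnalyticAt ℂ τ x) (h : |(z x).im| < (τ x).im) (h0 : sincPi (z x) ≠ 0) :
    AnalyticAt ℂ (fun y => eisExp (z y) (τ y)) x := by
  have h1 := analyticAt_lambertSeries_comp hz ht h
  have h2 := analyticAt_lambertSeries_comp (analyticAt_const (v := (0 : ℂ))) ht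
    (by simpa using (abs_nonneg _).trans_lt h)
  have h3 : AnalyticAt ℂ (fun y => sincPi (z y)) x := (analyticAt_sincPi (z x)).fun_comp hz
  unfold eisExp
  exact (h1.sub h2).cexp.div h3 h0

theorem analyticAt_genFun_comp {E : Type*} [NormedAddCommGroup E] [NormedSpace ℂ E] {z v τ w : E → ℂ} {x : E}
    (hz : AnalyticAt ℂ z x) (hv : AnalyticAt ℂ v x) (ht : AnalyticAt ℂ τ x) (hw : AnalyticAt ℂ w x)
    (hτ0 : 0 < (τ x).im) (hw0 : 0 < (w x).im) (h1 : |(z x).im| < (τ x).im) (h2 : sincPi (z x) ≠ 0)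
    (h0 : psiCore 0 0 (τ x) (w x) ≠ 0) :
    AnalyticAt ℂ (fun y => genFun (z y) (v y) (τ y) (w y)) x := by
  have h1 := analyticAt_eisExp_comp hz ht h1 h2
  have h2z : AnalyticAt ℂ (fun y => 2 * z y) x := analyticAt_const.mul hz
  have h2 := analyticAt_psiCore_comp (h2z.fun_mul hv) h2z ht hw hτ0 hw0
  have h3 := analyticAt_psiCore_comp (analyticAt_const (v := (0 : ℂ))) (analyticAt_const (v := (0 : ℂ)))
    ht hw hτ0 hw0
  have h4 := analyticAt_psiTriple_comp hz hv ht hw hτ0 hw0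
  have h5 := analyticAt_lambertSeries_comp (analyticAt_const (v := (0 : ℂ))) ht (by simpa using hτ0)
  unfold genFun
  refine ((h1.mul h2).div h3 h0).sub (AnalyticAt.div ?_ h3 h0)
  fun_prop

theorem eisExp_zero (τ : ℂ) : eisExp 0 τ = 1 := by simp [eisExp, sincPi_zero]

theorem genFun_zero (v : ℂ) {τ w : ℂ} (h0 : psiCore 0 0 τ w ≠ 0) : genFun 0 v τ w = 1 := by
  simp [genFun, eisExp_zero, h0]

/-! ### Behaviour of the theta functions at `z = 0`. -/

theorem eventually_abs_im_lt {y : ℝ} (hy : 0 < y) : ∀ᶠ z : ℂ in nhds 0, |z.im| < y :=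
  ContinuousAt.eventually_lt (by fun_prop) continuousAt_const (by simpa using hy)

theorem eisExp_mul_rankProd {z τ : ℂ} (h : |z.im| < τ.im) (hz : sincPi z ≠ 0) :
    eisExp z τ * (sincPi z * rankProd z τ) = Complex.exp (-lambertSeries 0 τ) := by
  rw [rankProd_eq_exp h, eisExp, ← mul_assoc, div_mul_cancel₀ _ hz, ← Complex.exp_add]
  congr 1; ring

/-- The quintuple product identity with `rankProd` and `sincPi` cancelled by `eisExp`. In this form
the theta parts of the two summands of the generating function annihilate each other. -/
theorem eisExp_mul_jacobiTheta {z τ : ℂ} (h : |z.im| < τ.im) (hz : sincPi z ≠ 0) :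
    eisExp z τ * jacobiTheta (2 * z) τ = 4 * Complex.exp (2 * Real.pi * Complex.I * τ / 8) *
      Complex.exp (-lambertSeries 0 τ) * (Real.pi * z) *
        tripleFactor (fun y => jacobiTheta y (3 * τ)) z τ := by
  rw [jacobiTheta_two_mul h, ← sincPi_mul, ← eisExp_mul_rankProd h hz]
  ring

theorem hasDerivAt_mul_sin {f : ℂ → ℂ} (hf : DifferentiableAt ℂ f 0) :
    HasDerivAt (fun z => f z * Complex.sin (Real.pi * z)) (f 0 * Real.pi) 0 := by
  have h1 : HasDerivAt (fun z : ℂ => (Real.pi : ℂ) * z) (Real.pi * 1) 0 := (hasDerivAt_id 0).const_mul _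
  have h2 := hf.hasDerivAt.mul h1.csin
  refine h2.congr_deriv ?_
  simp

theorem analyticAt_tripleFactor_jacobiTheta {τ : ℂ} (hτ : 0 < τ.im) (z : ℂ) :
    AnalyticAt ℂ (fun z => tripleFactor (fun y => jacobiTheta y (3 * τ)) z τ) z := by
  have h1 : AnalyticAt ℂ (fun z => jacobiTheta (3 * z + τ) (3 * τ)) z :=
    (analyticAt_jacobiTheta (three_mul_im_pos hτ) _).fun_comp (by fun_prop : AnalyticAt ℂ (fun z => 3 * z + τ) z)
  have h2 : AnalyticAt ℂ (fun z => jacobiTheta (3 * z - τ) (3 * τ)) z :=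
    (analyticAt_jacobiTheta (three_mul_im_pos hτ) _).fun_comp (by fun_prop : AnalyticAt ℂ (fun z => 3 * z - τ) z)
  unfold tripleFactor
  fun_prop

theorem analyticAt_rankProd {τ : ℂ} (hτ : 0 < τ.im) : AnalyticAt ℂ (fun z => rankProd z τ) 0 := by
  have h1 := (analyticAt_lambertSeries_comp (analyticAt_id (𝕜 := ℂ) (z := (0 : ℂ)))
    (analyticAt_const (v := τ)) (by simpa using hτ)).neg.cexp
  refine h1.congr ?_
  filter_upwards [eventually_abs_im_lt hτ] with z hz
  exact (rankProd_eq_exp hz).symm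

theorem deriv_jacobiTheta_zero {τ : ℂ} (hτ : 0 < τ.im) :
    HasDerivAt (fun z => jacobiTheta z τ) (2 * Real.pi * Complex.exp (2 * Real.pi * Complex.I * τ / 8) *
      Complex.exp (-lambertSeries 0 τ) * tripleFactor (fun y => jacobiTheta y (3 * τ)) 0 τ) 0 := by
  have h1 := (analyticAt_jacobiTheta hτ 0).differentiableAt.hasDerivAt
  have h2 : HasDerivAt (fun z : ℂ => 2 * z) (2 * 1) 0 := (hasDerivAt_id 0).const_mul _
  have h3 : HasDerivAt (fun z : ℂ => jacobiTheta (2 * z) τ) (deriv (fun z => jacobiTheta z τ) 0 * (2 * 1)) 0 :=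
    HasDerivAt.comp (h₂ := fun z => jacobiTheta z τ) (h := fun z : ℂ => 2 * z) 0 (by simpa using h1) h2
  have hK := (analyticAt_tripleFactor_jacobiTheta hτ 0).differentiableAt
  have hJ := (analyticAt_rankProd hτ).differentiableAt
  have h4 := hasDerivAt_mul_sin (f := fun z => 4 * Complex.exp (2 * Real.pi * Complex.I * τ / 8) *
    rankProd z τ * tripleFactor (fun y => jacobiTheta y (3 * τ)) z τ) (by fun_prop)
  have h5 := h4.congr_of_eventuallyEq (f₁ := fun z : ℂ => jacobiTheta (2 * z) τ) (by
    filter_upwards [eventually_abs_im_lt hτ] with z hz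
    rw [jacobiTheta_two_mul hz]; ring)
  have h6 := h3.unique h5
  refine h1.congr_deriv ?_
  rw [← rankProd_eq_exp (by simpa using hτ)]
  linear_combination h6 / 2

/-- Otherwise `deriv_jacobiTheta_zero` would give `ϑ'(0) = 0`, whereas the triple product shows
`ϑ'(0)` to be a product of nonzero factors. -/
theorem tripleFactor_jacobiTheta_zero_ne_zero {τ : ℂ} (hτ : 0 < τ.im) :
    tripleFactor (fun y => jacobiTheta y (3 * τ)) 0 τ ≠ 0 := by
  intro h0
  have h1 := deriv_jacobiTheta_zero hτ
  rw [h0, mul_zero] at h1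
  have hJ := (analyticAt_rankProd hτ).differentiableAt
  have h2 := hasDerivAt_mul_sin (f := fun z => -2 * Complex.exp (2 * Real.pi * Complex.I * τ / 8) *
    poch (qOf τ) (qOf τ) * rankProd z τ) (by fun_prop)
  have h3 := h2.congr_of_eventuallyEq (f₁ := fun z : ℂ => jacobiTheta z τ) (by
    filter_upwards with z
    rw [jacobiTheta_eq_prod hτ]; ring)
  have h4 := h1.unique h3
  have hpi : (Real.pi : ℂ) ≠ 0 := by exact_mod_cast Real.pi_ne_zero
  have h5 := rankProd_ne_zero (z := 0) (τ := τ) (by simpa using hτ)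
  have h6 := poch_self_ne_zero (norm_qOf_lt_one hτ)
  exact mul_ne_zero (mul_ne_zero (mul_ne_zero (mul_ne_zero (by norm_num) (Complex.exp_ne_zero _)) h6) h5) hpi
    h4.symm

theorem hasDerivAt_zero_of_even {f : ℂ → ℂ} (hf : DifferentiableAt ℂ f 0) (he : ∀ z, f (-z) = f z) :
    HasDerivAt f 0 0 := by
  have h1 := hf.hasDerivAt
  have h2 : HasDerivAt (fun z => f (-z)) (deriv f 0 * -1) 0 :=
    HasDerivAt.comp (h₂ := f) (h := fun z : ℂ => -z) 0 (by simpa using h1) (hasDerivAt_neg 0)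
  rw [funext he] at h2
  have h3 := h1.unique h2
  refine h1.congr_deriv ?_
  linear_combination h3 / 2

theorem expTrace_congr {n : ℕ} {f g : ℕ → ℂ} (h : ∀ j, 1 ≤ j → f j = g j) : expTrace n f = expTrace n g := by
  refine Finset.sum_congr rfl fun l _ => Finset.prod_congr rfl fun j hj => ?_
  rw [h j (Finset.mem_Icc.mp hj).1]

/-- As `ϑ(0) = 0`, the value `T̂(0)` is `psiFactor τ w * psiCore 0 0 τ w`, and the first factor is
nonzero for `τ ≠ w`. -/
theorem mem_domain_iff {τ w : ℂ} : (τ, w) ∈ domain ↔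
    0 < τ.im ∧ 0 < w.im ∧ τ ≠ w ∧ psiCore 0 0 τ w ≠ 0 := by
  constructor
  · rintro ⟨h1, h2, h3, h4⟩
    refine ⟨h1, h2, h3, fun h => h4 ?_⟩
    simp only [] at h1 h2 h3 ⊢
    rw [THat_zero_right, jacobiTheta_zero h1, zero_mul, h]
    simp
  · rintro ⟨h1, h2, h3, h4⟩
    refine ⟨h1, h2, h3, ?_⟩
    simp only []
    rw [THat_zero_right, jacobiTheta_zero h1, zero_mul, zero_add]
    exact mul_ne_zero (psiFactor_ne_zero h3) h4

/-- The error-function part of `T̂` is even in `z` once `z' = 0`, so `ĝ_1` is governed by `ϑ'(0)`,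
and `K(0)` is a pure theta value since `psiTriple` vanishes at `z = 0`. In `A/A(0) + 4πi ĝ_1 z
K/K(0)` the theta parts then cancel by `eisExp_mul_jacobiTheta`, and the remainder is `genFun`.
Comparing Taylor coefficients and applying `expTrace_injective` identifies the numbers. -/
theorem two_mul_uHat_eq {τ w : ℂ} (h : (τ, w) ∈ domain) {k : ℕ} (hk : 1 ≤ k) :
    2 * uHat k τ w = expTaylorCoeff (fun z => genFun z (invIm τ) τ w) k := by
  obtain ⟨hτ, hw, hne, hP0⟩ := mem_domain_iff.mp h
  have hpi : (2 * Real.pi * Complex.I : ℂ) ≠ 0 := Complex.two_pi_I_ne_zero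
  have hc := psiFactor_ne_zero hne
  set v := invIm τ
  set c := psiFactor τ w
  set P : ℂ → ℂ := fun z => psiCore (z * v) z τ w with hP
  set T : ℂ → ℂ := fun z => THat z 0 τ w with hT
  set K : ℂ → ℂ := fun z => HHatFactor z 0 τ w with hK
  set Kθ : ℂ → ℂ := fun z => tripleFactor (fun y => jacobiTheta y (3 * τ)) z τ with hKθ
  set B := Complex.exp (2 * Real.pi * Complex.I * τ / 8) * Complex.exp (-lambertSeries 0 τ) with hB
  have hTeq : T = fun z => jacobiTheta z τ + c * P z := funext fun z => THat_zero_right z τ w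
  have hKeq : K = fun z => Kθ z + (Real.sqrt 3 : ℂ) * c * psiTriple z v τ w :=
    funext fun z => HHatFactor_zero_right hτ z w
  have hid : AnalyticAt ℂ (fun z : ℂ => z) 0 := analyticAt_id
  have hPa : AnalyticAt ℂ P 0 :=
    analyticAt_psiCore_comp (hid.fun_mul analyticAt_const) hid analyticAt_const analyticAt_const hτ hw
  have hTa : AnalyticAt ℂ T 0 := by
    rw [hTeq]
    exact (analyticAt_jacobiTheta hτ 0).fun_add (analyticAt_const.fun_mul hPa)
  have hKθa : AnalyticAt ℂ Kθ 0 := analyticAt_tripleFactor_jacobiTheta hτ 0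
  have hKa : AnalyticAt ℂ K 0 := by
    rw [hKeq]
    exact hKθa.fun_add (analyticAt_const.fun_mul
      (analyticAt_psiTriple_comp hid analyticAt_const analyticAt_const analyticAt_const hτ hw))
  have hEa : AnalyticAt ℂ (fun z => eisExp z τ) 0 :=
    analyticAt_eisExp_comp hid analyticAt_const (by simpa using hτ) sincPi_zero_ne_zero
  have hP00 : P 0 = psiCore 0 0 τ w := by simp [hP]
  have hT0 : T 0 = c * P 0 := by
    rw [hTeq]; simp [jacobiTheta_zero hτ]
  have hT0' : T 0 ≠ 0 := by rw [hT0, hP00]; exact mul_ne_zero hc hP0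
  have hK0 : K 0 = Kθ 0 := by rw [hKeq]; simp [psiTriple_zero]
  have hKθ0 : Kθ 0 ≠ 0 := tripleFactor_jacobiTheta_zero_ne_zero hτ
  have hK0' : K 0 ≠ 0 := by rw [hK0]; exact hKθ0
  -- the coefficient `ĝ₁`
  have hPd : HasDerivAt P 0 0 := hasDerivAt_zero_of_even hPa.differentiableAt fun z => by
    simp only [hP]
    rw [neg_mul, psiCore_neg]
  have hTd : HasDerivAt T (2 * Real.pi * B * Kθ 0) 0 := by
    rw [hTeq]
    refine ((deriv_jacobiTheta_zero hτ).fun_add (hPd.const_mul c)).congr_deriv ?_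
    rw [hB]; ring
  have hg1 : gHat 1 τ w = -(2 * Real.pi * B * Kθ 0 / (T 0 * (2 * Real.pi * Complex.I))) := by
    have h1 := expTrace_expTaylorCoeff hTa hT0' 1
    rw [iteratedDeriv_one, hTd.deriv] at h1
    have h2 := expTrace_recursion_succ 0 (expTaylorCoeff T)
    simp [expTrace_zero] at h2
    rw [h2] at h1
    rw [gHat, h1]
    simp
  -- the two factors
  set A : ℂ → ℂ := fun z => eisExp z τ * T (2 * z) with hA
  have hT2a : AnalyticAt ℂ (fun z => T (2 * z)) 0 :=
    AnalyticAt.fun_comp (f := fun z : ℂ => 2 * z) (by simpa using hTa) (by fun_prop)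
  have hAa : AnalyticAt ℂ A 0 := hEa.fun_mul hT2a
  have hA0 : A 0 = T 0 := by simp [hA, eisExp_zero]
  have hA0' : A 0 ≠ 0 := by rw [hA0]; exact hT0'
  have hAc : ∀ j, 1 ≤ j → expTaylorCoeff A j = 2 * gammaHat j τ w := by
    intro j hj
    rw [hA, expTaylorCoeff_mul hEa (by rw [eisExp_zero]; exact one_ne_zero) hT2a (by simpa using hT0') hj,
      expTaylorCoeff_eisExp hj hτ, expTaylorCoeff_comp_mul, gammaHat, gHat, ← hT]
    obtain ⟨i, rfl⟩ : ∃ i, j = i + 1 := ⟨j - 1, by omega⟩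
    rw [Nat.add_sub_cancel, pow_succ]
    ring
  have hKc : ∀ j, expTaylorCoeff K j = -hHat j τ w := fun j => by rw [hHat, neg_neg]
  -- the generating function
  set D : ℂ → ℂ := fun z => genFun z v τ w with hD
  have hDa : AnalyticAt ℂ D 0 :=
    analyticAt_genFun_comp hid analyticAt_const analyticAt_const analyticAt_const hτ hw
      (by simpa using hτ) sincPi_zero_ne_zero hP0
  have hD0 : D 0 = 1 := genFun_zero v hP0
  have hDeq : D =ᶠ[nhds 0] fun z => A z / A 0 + (4 * Real.pi * Complex.I * gHat 1 τ w / K 0) * (z * K z) := by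
    filter_upwards [eventually_abs_im_lt hτ,
      (analyticAt_sincPi 0).continuousAt.eventually_ne sincPi_zero_ne_zero] with z hz1 hz2
    have h1 := eisExp_mul_jacobiTheta hz1 hz2
    have h2 : A z = 4 * B * (Real.pi * z) * Kθ z + c * (eisExp z τ * P (2 * z)) := by
      have h3 : A z = eisExp z τ * jacobiTheta (2 * z) τ + c * (eisExp z τ * P (2 * z)) := by
        simp only [hA, hTeq]; ring
      rw [h3, h1, hB]; ring
    have hI := Complex.I_ne_zero
    have hpi' : (Real.pi : ℂ) ≠ 0 := by exact_mod_cast Real.pi_ne_zero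
    have hP0' : P 0 ≠ 0 := by rw [hP00]; exact hP0
    rw [hA0, hK0, hg1, h2, hT0, hKeq]
    simp only [hD, genFun, ← hP00]
    have h4 : eisExp z τ * psiCore (2 * z * v) (2 * z) τ w = eisExp z τ * P (2 * z) := rfl
    rw [h4, mul_assoc _ (Complex.exp _) (Complex.exp _), ← hB]
    field_simp
    ring
  have hcoef : ∀ n, 1 ≤ n → expTrace n (fun j => 2 * uHat j τ w) = expTrace n (expTaylorCoeff D) := by
    intro n hn
    rw [expTrace_uHat hn, ← expTrace_congr hAc, ← expTrace_congr (fun j _ => hKc j),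
      expTrace_expTaylorCoeff hAa hA0', expTrace_expTaylorCoeff hKa hK0',
      expTrace_expTaylorCoeff hDa (by rw [hD0]; exact one_ne_zero), hD0, hDeq.iteratedDeriv_eq n,
      iteratedDeriv_fun_add (hAa.contDiffAt.div_const _)
        ((analyticAt_const.fun_mul (hid.fun_mul hKa)).contDiffAt),
      iteratedDeriv_const_mul_field, iteratedDeriv_id_mul hKa hn]
    have hdiv : iteratedDeriv n (fun z => A z / A 0) 0 = iteratedDeriv n A 0 / A 0 := by
      simp only [div_eq_inv_mul]
      rw [iteratedDeriv_const_mul_field]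
    rw [hdiv]
    obtain ⟨i, rfl⟩ : ∃ i, n = i + 1 := ⟨n - 1, by omega⟩
    rw [Nat.add_sub_cancel, Nat.factorial_succ, pow_succ]
    have h1 : (i ! : ℂ) ≠ 0 := by exact_mod_cast Nat.factorial_ne_zero i
    have h2 : ((i + 1 : ℕ) : ℂ) ≠ 0 := by exact_mod_cast Nat.succ_ne_zero i
    have h3 := pow_ne_zero i hpi
    rw [Nat.cast_mul]
    set X := (2 * Real.pi * Complex.I : ℂ) with hX
    have h4 : 4 * Real.pi * Complex.I = 2 * X := by rw [hX]; ring
    rw [h4]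
    field_simp
  exact expTrace_injective hcoef k hk

/-! ### Transformation of the generating function -/

theorem charLeft_sub (γ : SL(2, ℤ)) (a z τ : ℂ) :
    charLeft γ a (z - a * τ) = autFactor γ τ * a - ((γ 1 0 : ℤ) : ℂ) * z := by
  rw [charLeft, autFactor]; ring

theorem char_sub_moebius (γ : SL(2, ℤ)) {τ : ℂ} (hτ : 0 < τ.im) (a z : ℂ) :
    charLeft γ a (z - a * τ) * moebius γ τ + charRight γ a (z - a * τ) = z / autFactor γ τ := by
  have h := autFactor_ne_zero γ hτ
  have hdet := det_eq_one_complex γ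
  rw [moebius, eq_div_iff h, add_mul, mul_assoc, div_mul_cancel₀ _ h, charLeft, charRight, autFactor]
  linear_combination z * hdet

theorem psiCore_eq_charSum (a z τ w : ℂ) :
    psiCore a z τ w = Complex.exp (-(Real.pi * Complex.I * a * z)) * charSum (psiKernel τ w) a (z - a * τ) := by
  rw [charSum_psiKernel, ← mul_assoc, ← Complex.exp_add, add_sub_cancel, neg_add_cancel, Complex.exp_zero,
    one_mul]

theorem jacobiTheta_eq_charSum (a z τ : ℂ) :
    jacobiTheta z τ = Complex.exp (-(Real.pi * Complex.I * a * z)) * charSum (thetaKernel τ) a (z - a * τ) := by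
  rw [charSum_thetaKernel, ← mul_assoc, ← Complex.exp_add, add_sub_cancel, neg_add_cancel, Complex.exp_zero,
    one_mul]

theorem char_sub_char (γ : SL(2, ℤ)) {τ : ℂ} (hτ : 0 < τ.im) (a z : ℂ) :
    z / autFactor γ τ - (autFactor γ τ * a - ((γ 1 0 : ℤ) : ℂ) * z) * moebius γ τ =
      charRight γ a (z - a * τ) := by
  rw [← char_sub_moebius γ hτ a z, charLeft_sub]; ring

theorem exp_char_transform (γ : SL(2, ℤ)) {τ : ℂ} (hτ : 0 < τ.im) (a z n : ℂ) :
    Complex.exp (-(n * Real.pi * Complex.I * (autFactor γ τ * a - ((γ 1 0 : ℤ) : ℂ) * z) *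
      (z / autFactor γ τ))) = Complex.exp (n * (Real.pi * Complex.I * ((γ 1 0 : ℤ) : ℂ) * z ^ 2 / autFactor γ τ)) *
        Complex.exp (-(n * Real.pi * Complex.I * a * z)) := by
  have h := autFactor_ne_zero γ hτ
  rw [← Complex.exp_add]
  congr 1
  field_simp
  ring

/-- The law for characteristics in Jacobi variables: `z = aτ + b` goes to `z/(cτ+d)`, and the
prefactor `exp(-πi a z)` produces the Gaussian of index `1/2`. -/
theorem KleinLaw.psiCore {γ : SL(2, ℤ)} {τ w C : ℂ} (H : KleinLaw γ τ w C) (hτ : 0 < τ.im) (a z : ℂ) :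
    psiCore (autFactor γ τ * a - ((γ 1 0 : ℤ) : ℂ) * z) (z / autFactor γ τ) (moebius γ τ) (moebius γ w) =
      Complex.exp (Real.pi * Complex.I * ((γ 1 0 : ℤ) : ℂ) * z ^ 2 / autFactor γ τ) * (C * rho γ τ w) *
        psiCore a z τ w := by
  have h1 := exp_char_transform γ hτ a z 1
  simp only [one_mul] at h1
  rw [psiCore_eq_charSum, char_sub_char γ hτ, h1, ← charLeft_sub, (H.2 _ _).2, psiCore_eq_charSum a z]
  ring

theorem KleinLaw.jacobiTheta {γ : SL(2, ℤ)} {τ w C : ℂ} (H : KleinLaw γ τ w C) (hτ : 0 < τ.im) (z : ℂ) :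
    jacobiTheta (z / autFactor γ τ) (moebius γ τ) =
      Complex.exp (Real.pi * Complex.I * ((γ 1 0 : ℤ) : ℂ) * z ^ 2 / autFactor γ τ) * C * jacobiTheta z τ := by
  have h1 := exp_char_transform γ hτ 0 z 1
  simp only [one_mul] at h1
  rw [jacobiTheta_eq_charSum (autFactor γ τ * 0 - ((γ 1 0 : ℤ) : ℂ) * z), char_sub_char γ hτ, h1,
    ← charLeft_sub, (H.2 _ _).1, jacobiTheta_eq_charSum 0 z]
  ring

/-- The function `psiTriple` with `z v` replaced by an independent variable. -/
def psiTripleAux (a z τ w : ℂ) : ℂ :=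
  Complex.I / 2 * Complex.exp (2 * Real.pi * Complex.I * τ / 8) *
    (-(Complex.exp (2 * Real.pi * Complex.I * z) * psiCore (a + 1 / 3) (3 * z + τ) (3 * τ) (3 * w)) +
      Complex.exp (-(2 * Real.pi * Complex.I * z)) * psiCore (a - 1 / 3) (3 * z - τ) (3 * τ) (3 * w))

theorem psiTriple_eq (z v τ w : ℂ) : psiTriple z v τ w = psiTripleAux (z * v) z τ w := rfl

theorem exp_triple_pos (a z τ : ℂ) : Complex.exp (2 * Real.pi * Complex.I * τ / 8) *
    (Complex.exp (2 * Real.pi * Complex.I * z) * Complex.exp (-(Real.pi * Complex.I * (a + 1 / 3) * (3 * z + τ)))) =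
      Complex.exp (-(Real.pi * Complex.I * τ / 12)) * Complex.exp (-(3 * Real.pi * Complex.I * a * z)) *
        Complex.exp (Real.pi * Complex.I * (z - a * τ)) := by
  simp only [← Complex.exp_add]
  congr 1; ring

theorem exp_triple_neg (a z τ : ℂ) : Complex.exp (2 * Real.pi * Complex.I * τ / 8) *
    (Complex.exp (-(2 * Real.pi * Complex.I * z)) *
      Complex.exp (-(Real.pi * Complex.I * (a - 1 / 3) * (3 * z - τ)))) =
      Complex.exp (-(Real.pi * Complex.I * τ / 12)) * Complex.exp (-(3 * Real.pi * Complex.I * a * z)) *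
        Complex.exp (-(Real.pi * Complex.I * (z - a * τ))) := by
  simp only [← Complex.exp_add]
  congr 1; ring

/-- Relative to the modulus `3τ`, the shift `±τ` is absorbed by the characteristic `a ± 1/3`, so
both terms have second characteristic `3(z - aτ)`. -/
theorem psiTripleAux_eq_tripleSum (a z τ w : ℂ) :
    psiTripleAux a z τ w = Complex.I / 2 * Complex.exp (-(Real.pi * Complex.I * τ / 12)) *
      Complex.exp (-(3 * Real.pi * Complex.I * a * z)) * tripleSum (psiKernel (3 * τ) (3 * w)) a (z - a * τ) := by
  have h1 := exp_triple_pos a z τ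
  have h2 := exp_triple_neg a z τ
  rw [psiTripleAux, psiCore_eq_charSum, psiCore_eq_charSum, tripleSum, tripleTerm, tripleTerm,
    show 3 * z + τ - (a + 1 / 3) * (3 * τ) = 3 * (z - a * τ) by ring,
    show 3 * z - τ - (a - 1 / 3) * (3 * τ) = 3 * (z - a * τ) by ring]
  push_cast
  rw [neg_div, ← sub_eq_add_neg a, mul_one, mul_neg_one, neg_mul (Real.pi * Complex.I)]
  set s1 := charSum (psiKernel (3 * τ) (3 * w)) (a + 1 / 3) (3 * (z - a * τ))
  set s2 := charSum (psiKernel (3 * τ) (3 * w)) (a - 1 / 3) (3 * (z - a * τ))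
  linear_combination (-(Complex.I / 2) * s1) * h1 + (Complex.I / 2 * s2) * h2

theorem tripleFactor_eq_tripleSum (a z τ : ℂ) :
    tripleFactor (fun y => jacobiTheta y (3 * τ)) z τ = Complex.I / 2 *
      Complex.exp (-(Real.pi * Complex.I * τ / 12)) *
      Complex.exp (-(3 * Real.pi * Complex.I * a * z)) * tripleSum (thetaKernel (3 * τ)) a (z - a * τ) := by
  have h1 := exp_triple_pos a z τ
  have h2 := exp_triple_neg a z τ
  rw [tripleFactor, jacobiTheta_eq_charSum (a + 1 / 3), jacobiTheta_eq_charSum (a - 1 / 3), tripleSum, tripleTerm,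
    tripleTerm,
    show 3 * z + τ - (a + 1 / 3) * (3 * τ) = 3 * (z - a * τ) by ring,
    show 3 * z - τ - (a - 1 / 3) * (3 * τ) = 3 * (z - a * τ) by ring]
  push_cast
  rw [neg_div, ← sub_eq_add_neg a, mul_one, mul_neg_one, neg_mul (Real.pi * Complex.I)]
  set s1 := charSum (thetaKernel (3 * τ)) (a + 1 / 3) (3 * (z - a * τ))
  set s2 := charSum (thetaKernel (3 * τ)) (a - 1 / 3) (3 * (z - a * τ))
  linear_combination (-(Complex.I / 2) * s1) * h1 + (Complex.I / 2 * s2) * h2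

/-- As `3 ∣ c`, conjugation by `diag(3, 1)` gives an integral `γ'` with `γ'(3x) = 3 γx` and the same
automorphy factor. Its Klein law at `(3τ, 3w)` and `tripleSum_transform` yield a common `κ`, up to
`rho`, for both functions. -/
theorem exists_triple_transform {γ : SL(2, ℤ)} (hγ : γ ∈ CongruenceSubgroup.Gamma0 3) {τ w : ℂ}
    (hτ : 0 < τ.im) (hw : 0 < w.im) : ∃ κ : ℂ, κ ≠ 0 ∧ ∀ a z : ℂ,
      tripleFactor (fun y => jacobiTheta y (3 * moebius γ τ)) (z / autFactor γ τ) (moebius γ τ) =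
        Complex.exp (3 * (Real.pi * Complex.I * ((γ 1 0 : ℤ) : ℂ) * z ^ 2 / autFactor γ τ)) * κ *
          tripleFactor (fun y => jacobiTheta y (3 * τ)) z τ ∧
      psiTripleAux (autFactor γ τ * a - ((γ 1 0 : ℤ) : ℂ) * z) (z / autFactor γ τ) (moebius γ τ) (moebius γ w) =
        Complex.exp (3 * (Real.pi * Complex.I * ((γ 1 0 : ℤ) : ℂ) * z ^ 2 / autFactor γ τ)) * (κ * rho γ τ w) *
          psiTripleAux a z τ w := by
  obtain ⟨c, hc⟩ : (3 : ℤ) ∣ γ 1 0 := by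
    have := CongruenceSubgroup.Gamma0_mem.mp hγ
    exact (ZMod.intCast_zmod_eq_zero_iff_dvd _ 3).mp this
  have hdet : γ 0 0 * γ 1 1 - 3 * γ 0 1 * c = 1 := by
    have h := γ.det_coe
    rw [Matrix.det_fin_two] at h
    have h' : γ 0 0 * γ 1 1 - γ 0 1 * γ 1 0 = 1 := h
    rw [hc] at h'
    linear_combination h'
  set γ' : SL(2, ℤ) := ⟨!![γ 0 0, 3 * γ 0 1; c, γ 1 1], by rw [Matrix.det_fin_two_of]; linear_combination hdet⟩
    with hγ'
  have hcC : ((γ 1 0 : ℤ) : ℂ) = 3 * c := by rw [hc]; push_cast; ring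
  have haut : ∀ x, autFactor γ' (3 * x) = autFactor γ x := fun x => by
    rw [autFactor, autFactor, hcC]
    simp [hγ']
    ring
  have hmoeb : ∀ x, moebius γ' (3 * x) = 3 * moebius γ x := fun x => by
    rw [moebius, haut, moebius, ← mul_div_assoc]
    congr 1
    simp [hγ']
    ring
  obtain ⟨κ, hκ, H⟩ := exists_kleinLaw γ' (3 * τ) (3 * w) (three_mul_im_pos hτ) (three_mul_im_pos hw)
  have hrho : rho γ' (3 * τ) (3 * w) = rho γ τ w := by rw [rho, haut, haut, rho]
  rw [hmoeb, hmoeb, hrho] at H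
  have hL : ∀ a b, charLeft γ' a b = ((γ 1 1 : ℤ) : ℂ) * a - c * b := fun a b => by
    simp [charLeft, hγ']
  have hR : ∀ a b, charRight γ' a b = -(3 * ((γ 0 1 : ℤ) : ℂ)) * a + ((γ 0 0 : ℤ) : ℂ) * b := fun a b => by
    simp [charRight, hγ']
  obtain ⟨s, hs, hsH⟩ := tripleSum_transform hdet
  have t1 := hsH _ _ κ (fun a b => by rw [← hL, ← hR]; exact (H a b).1)
  have t2 := hsH _ _ (κ * rho γ τ w) (fun a b => by rw [← hL, ← hR]; exact (H a b).2)
  simp only [← hcC] at t1 t2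
  have hL' : ∀ a b, ((γ 1 1 : ℤ) : ℂ) * a - ((γ 1 0 : ℤ) : ℂ) * b = charLeft γ a b := fun a b => rfl
  have hR' : ∀ a b, -((γ 0 1 : ℤ) : ℂ) * a + ((γ 0 0 : ℤ) : ℂ) * b = charRight γ a b := fun a b => rfl
  simp only [hL', hR'] at t1 t2
  have hE := Complex.exp_ne_zero (-(Real.pi * Complex.I * τ / 12))
  refine ⟨s * κ * (Complex.exp (-(Real.pi * Complex.I * moebius γ τ / 12)) /
    Complex.exp (-(Real.pi * Complex.I * τ / 12))), mul_ne_zero (mul_ne_zero hs hκ)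
      (div_ne_zero (Complex.exp_ne_zero _) hE), fun a z => ⟨?_, ?_⟩⟩
  · rw [tripleFactor_eq_tripleSum (autFactor γ τ * a - ((γ 1 0 : ℤ) : ℂ) * z), char_sub_char γ hτ,
      ← charLeft_sub, t1, charLeft_sub, exp_char_transform γ hτ, tripleFactor_eq_tripleSum a]
    field_simp
  · rw [psiTripleAux_eq_tripleSum, char_sub_char γ hτ, ← charLeft_sub, t2, charLeft_sub,
      exp_char_transform γ hτ, psiTripleAux_eq_tripleSum a]
    field_simp

/-- As `invIm τ = 1/(τ - conj τ)`, its law is affine. It is exactly compatible with `a ↦ (cτ+d)a -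
cz` when `a = z * invIm τ`. -/
theorem invIm_moebius (γ : SL(2, ℤ)) {τ : ℂ} (hτ : 0 < τ.im) :
    invIm (moebius γ τ) = autFactor γ τ * (autFactor γ τ * invIm τ - ((γ 1 0 : ℤ) : ℂ)) := by
  have hi : (τ.im : ℂ) ≠ 0 := by exact_mod_cast hτ.ne'
  have h0 := autFactor_ne_zero γ hτ
  have hconj : autFactor γ τ - (starRingEnd ℂ) (autFactor γ τ) =
      2 * Complex.I * ((γ 1 0 : ℤ) : ℂ) * (τ.im : ℂ) := by
    rw [Complex.sub_conj, im_autFactor]; push_cast; ring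
  have h1 : autFactor γ τ * invIm τ - ((γ 1 0 : ℤ) : ℂ) = (starRingEnd ℂ) (autFactor γ τ) * invIm τ := by
    have : ((γ 1 0 : ℤ) : ℂ) = (2 * Complex.I * ((γ 1 0 : ℤ) : ℂ) * (τ.im : ℂ)) * invIm τ := by
      rw [invIm]; field_simp
    rw [this, ← hconj]; ring
  rw [h1, ← mul_assoc, Complex.mul_conj, invIm, invIm, im_moebius]
  have hn : (Complex.normSq (autFactor γ τ) : ℂ) ≠ 0 := by
    exact_mod_cast (Complex.normSq_pos.mpr h0).ne'
  push_cast
  field_simp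

/-- With `X = exp(πi c z²/(cτ+d))`, `eisExp` contributes `X⁻¹`, `psiCore` at `2z` contributes `X⁴`
and `psiTriple` contributes `X³`, so both summands scale by `X³`. The multiplier `C ρ` cancels
against `psiCore 0 0`. -/
theorem genFun_transform {γ : SL(2, ℤ)} (hγ : γ ∈ CongruenceSubgroup.Gamma0 3) {τ w : ℂ}
    (hτ : 0 < τ.im) (hw : 0 < w.im) :
    (fun z => genFun (z / autFactor γ τ) (invIm (moebius γ τ)) (moebius γ τ) (moebius γ w)) =ᶠ[nhds 0]
      fun z => Complex.exp (3 * (Real.pi * Complex.I * ((γ 1 0 : ℤ) : ℂ) * z ^ 2 / autFactor γ τ)) *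
        genFun z (invIm τ) τ w := by
  obtain ⟨C, H⟩ := exists_kleinLaw γ τ w hτ hw
  obtain ⟨κ, hκ, Hκ⟩ := exists_triple_transform hγ hτ hw
  have hC := H.1
  have hl := autFactor_ne_zero γ hτ
  have hr := rho_ne_zero γ hτ hw
  have hτ' := im_moebius_pos γ hτ
  have hpi : (Real.pi : ℂ) ≠ 0 := by exact_mod_cast Real.pi_ne_zero
  set l := autFactor γ τ with hlam
  set c : ℂ := ((γ 1 0 : ℤ) : ℂ) with hc
  set τ' := moebius γ τ
  set w' := moebius γ w
  set B : ℂ → ℂ := fun τ => Complex.exp (2 * Real.pi * Complex.I * τ / 8) * Complex.exp (-lambertSeries 0 τ) with hB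
  have hB0 : B τ ≠ 0 := mul_ne_zero (Complex.exp_ne_zero _) (Complex.exp_ne_zero _)
  set K : ℂ → ℂ → ℂ := fun τ z => tripleFactor (fun y => jacobiTheta y (3 * τ)) z τ with hK
  have hK0 : K τ 0 ≠ 0 := tripleFactor_jacobiTheta_zero_ne_zero hτ
  have hKt : ∀ z, K τ' (z / l) = Complex.exp (3 * (Real.pi * Complex.I * c * z ^ 2 / l)) * κ * K τ z :=
    fun z => (Hκ 0 z).1
  -- The link between the two unknown multipliers comes from differentiating the law of `ϑ` at `0`,
  -- with `ϑ'(0)` expressed by `tripleFactor`.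
  have hBκ : B τ' * κ = l * C * B τ := by
    have d1 := deriv_jacobiTheta_zero hτ
    have d2 := deriv_jacobiTheta_zero hτ'
    have e1 : HasDerivAt (fun z : ℂ => z / l) (1 / l) 0 := (hasDerivAt_id 0).div_const l
    have e2 := HasDerivAt.comp (h₂ := fun z => jacobiTheta z τ') (h := fun z : ℂ => z / l) 0
      (by simpa using d2) e1
    have e3 : ((fun z => jacobiTheta z τ') ∘ fun z : ℂ => z / l) =
        fun z => Complex.exp (Real.pi * Complex.I * c * z ^ 2 / l) * C * jacobiTheta z τ :=
      funext fun z => H.jacobiTheta hτ z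
    rw [e3] at e2
    have e4 : DifferentiableAt ℂ (fun z : ℂ => Complex.exp (Real.pi * Complex.I * c * z ^ 2 / l) * C) 0 := by
      fun_prop
    have e5 := e2.unique (e4.hasDerivAt.mul d1)
    have hKt0 := hKt 0
    simp only [zero_div, hK] at hKt0
    simp only [hK] at hK0
    rw [hKt0, jacobiTheta_zero hτ] at e5
    simp at e5
    simp only [hB]
    field_simp at e5
    linear_combination e5
  have hsl : ContinuousAt (fun z : ℂ => z / l) 0 := by fun_prop
  have hKcont : ContinuousAt (K τ) 0 := (analyticAt_tripleFactor_jacobiTheta hτ 0).continuousAt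
  have hsinc : ContinuousAt sincPi 0 := (analyticAt_sincPi 0).continuousAt
  have htend : Filter.Tendsto (fun z : ℂ => z / l) (nhds 0) (nhds 0) := by
    have := hsl.tendsto
    rwa [zero_div] at this
  filter_upwards [eventually_abs_im_lt hτ, htend.eventually (eventually_abs_im_lt hτ'),
    hsinc.eventually_ne sincPi_zero_ne_zero, htend.eventually (hsinc.eventually_ne sincPi_zero_ne_zero),
    hKcont.eventually_ne hK0] with z h1 h2 h3 h4 h5
  have hl0 := hl
  set X := Complex.exp (Real.pi * Complex.I * c * z ^ 2 / l) with hX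
  have hX0 : X ≠ 0 := Complex.exp_ne_zero _
  have hX3 : Complex.exp (3 * (Real.pi * Complex.I * c * z ^ 2 / l)) = X ^ 3 := by
    rw [hX, ← Complex.exp_nat_mul]; norm_num
  have hX4 : Complex.exp (Real.pi * Complex.I * c * (2 * z) ^ 2 / l) = X ^ 4 := by
    rw [hX, ← Complex.exp_nat_mul]
    congr 1; push_cast; ring
  -- The behaviour of the Eisenstein part, including the anomaly of `G_2`, is read off from
  -- `eisExp_mul_jacobiTheta` at `τ` and at `γτ`.
  have heis : eisExp (z / l) τ' * X = eisExp z τ := by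
    by_cases hz : z = 0
    · rw [hX, hz, zero_div, eisExp_zero, eisExp_zero]; simp
    · have m1 := eisExp_mul_jacobiTheta h1 h3
      have m2 := eisExp_mul_jacobiTheta h2 h4
      have hθ : jacobiTheta (2 * z) τ ≠ 0 := by
        rw [jacobiTheta_two_mul h1, ← sincPi_mul]
        exact mul_ne_zero (mul_ne_zero (mul_ne_zero (mul_ne_zero (by norm_num) (Complex.exp_ne_zero _))
          (rankProd_ne_zero h1)) (mul_ne_zero h3 (mul_ne_zero hpi hz))) h5
      have m3 := H.jacobiTheta hτ (2 * z)
      have m4 := hKt z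
      simp only [hK] at m4
      rw [← hlam, ← hc, hX4] at m3
      rw [show 2 * (z / l) = 2 * z / l by ring, m3, m4, hX3] at m2
      apply mul_right_cancel₀ (mul_ne_zero (mul_ne_zero (pow_ne_zero 3 hX0) hC) hθ)
      have m5 : 4 * Real.pi * (z / l) * X ^ 3 * (B τ' * κ) * tripleFactor (fun y => jacobiTheta y (3 * τ)) z τ =
          4 * Real.pi * z * X ^ 3 * C * B τ * tripleFactor (fun y => jacobiTheta y (3 * τ)) z τ := by
        rw [hBκ]; field_simp
      simp only [hB] at m5
      linear_combination m2 + m5 - X ^ 3 * C * m1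
  have hPz : psiCore (2 * (z / l) * invIm τ') (2 * (z / l)) τ' w' =
      X ^ 4 * (C * rho γ τ w) * psiCore (2 * z * invIm τ) (2 * z) τ w := by
    have m := H.psiCore hτ (2 * z * invIm τ) (2 * z)
    rw [← hlam, ← hc, hX4] at m
    rw [← m, invIm_moebius γ hτ, ← hlam, ← hc]
    congr 1
    · field_simp
    · ring
  have hP0 : psiCore 0 0 τ' w' = C * rho γ τ w * psiCore 0 0 τ w := by
    have m := H.psiCore hτ 0 0
    simpa using m
  have hT : psiTriple (z / l) (invIm τ') τ' w' = X ^ 3 * (κ * rho γ τ w) * psiTriple z (invIm τ) τ w := by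
    rw [psiTriple_eq, psiTriple_eq, ← hX3, ← (Hκ (z * invIm τ) z).2, invIm_moebius γ hτ, ← hlam, ← hc]
    congr 1
    field_simp
  have hBt : B τ' = l * C * B τ / κ := by rw [← hBκ]; field_simp
  simp only [genFun]
  rw [hPz, hP0, hT, hX3, ← heis, mul_assoc _ (Complex.exp _) (Complex.exp _),
    mul_assoc _ (Complex.exp _) (Complex.exp _)]
  have hBdef : ∀ t, Complex.exp (2 * Real.pi * Complex.I * t / 8) * Complex.exp (-lambertSeries 0 t) = B t :=
    fun t => rfl
  rw [hBdef, hBdef, hBt]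
  -- In the degenerate case both sides are zero by the convention for division.
  by_cases hP : psiCore 0 0 τ w = 0
  · simp [hP]
  · field_simp

/-! ### Quasimodularity of the completions -/

theorem moebius_ne (γ : SL(2, ℤ)) {τ w : ℂ} (hτ : 0 < τ.im) (hw : 0 < w.im) (h : τ ≠ w) :
    moebius γ τ ≠ moebius γ w := by
  intro he
  apply h
  rw [← moebius_one τ, ← moebius_one w, ← inv_mul_cancel γ, moebius_mul _ _ hτ, moebius_mul _ _ hw, he]

theorem moebius_mem_domain (γ : SL(2, ℤ)) {τ w : ℂ} (h : (τ, w) ∈ domain) :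
    (moebius γ τ, moebius γ w) ∈ domain := by
  obtain ⟨hτ, hw, hne, h0⟩ := mem_domain_iff.mp h
  obtain ⟨C, H⟩ := exists_kleinLaw γ τ w hτ hw
  refine mem_domain_iff.mpr ⟨im_moebius_pos γ hτ, im_moebius_pos γ hw, moebius_ne γ hτ hw hne, ?_⟩
  have m := H.psiCore hτ 0 0
  simp only [mul_zero, sub_zero, zero_div, ne_eq, OfNat.ofNat_ne_zero, not_false_eq_true, zero_pow,
    Complex.exp_zero, one_mul] at m
  rw [m]
  exact mul_ne_zero (mul_ne_zero H.1 (rho_ne_zero γ hτ hw)) h0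

theorem expTaylorCoeff_exp_sq (Q : ℂ) {k : ℕ} (hk : 1 ≤ k) :
    expTaylorCoeff (fun z => Complex.exp (Q * z ^ 2)) k =
      if k = 2 then 2 * Q / (2 * Real.pi * Complex.I) ^ 2 else 0 := by
  rw [expTaylorCoeff_exp (by fun_prop) hk, iteratedDeriv_const_mul_field, iteratedDeriv_fun_pow_zero]
  split_ifs with h1
  · subst h1; simp [Nat.factorial]; ring
  · simp

theorem analyticAt_genFun {τ w : ℂ} (h : (τ, w) ∈ domain) (v : ℂ) : AnalyticAt ℂ (fun z => genFun z v τ w) 0 := by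
  obtain ⟨hτ, hw, hne, h0⟩ := mem_domain_iff.mp h
  exact analyticAt_genFun_comp analyticAt_id analyticAt_const analyticAt_const analyticAt_const hτ hw
    (by simpa using hτ) sincPi_zero_ne_zero h0

/-- Rescaling `z` by `cτ + d` gives the weight `k`. The Gaussian factor is the exponential of a
multiple of `z²`, so it affects only `k = 2`. -/
theorem uHat_moebius {γ : SL(2, ℤ)} (hγ : γ ∈ CongruenceSubgroup.Gamma0 3) {τ w : ℂ} (h : (τ, w) ∈ domain)
    {k : ℕ} (hk : 1 ≤ k) :
    uHat k (moebius γ τ) (moebius γ w) = autFactor γ τ ^ k * (uHat k τ w +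
      (if k = 2 then 3 * Real.pi * Complex.I / (2 * Real.pi * Complex.I) ^ 2 else 0) *
        (((γ 1 0 : ℤ) : ℂ) / autFactor γ τ)) := by
  obtain ⟨hτ, hw, hne, h0⟩ := mem_domain_iff.mp h
  have hl := autFactor_ne_zero γ hτ
  have h' := moebius_mem_domain γ h
  have e1 := two_mul_uHat_eq h' hk
  have e2 := two_mul_uHat_eq h hk
  have e3 := expTaylorCoeff_congr (genFun_transform hγ hτ hw) k
  set c : ℂ := ((γ 1 0 : ℤ) : ℂ)
  have e4 : (fun z => genFun (z / autFactor γ τ) (invIm (moebius γ τ)) (moebius γ τ) (moebius γ w)) =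
      fun z => (fun z => genFun z (invIm (moebius γ τ)) (moebius γ τ) (moebius γ w)) ((autFactor γ τ)⁻¹ * z) := by
    funext z; simp only [div_eq_inv_mul]
  have e5 : (fun z => Complex.exp (3 * (Real.pi * Complex.I * c * z ^ 2 / autFactor γ τ)) *
      genFun z (invIm τ) τ w) = fun z => Complex.exp ((3 * Real.pi * Complex.I * (c / autFactor γ τ)) * z ^ 2) *
        genFun z (invIm τ) τ w := by
    funext z
    congr 2
    ring
  have e6 : AnalyticAt ℂ (fun z : ℂ => Complex.exp ((3 * Real.pi * Complex.I * (c / autFactor γ τ)) * z ^ 2)) 0 := by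
    fun_prop
  rw [e4, e5, expTaylorCoeff_comp_mul (fun z => genFun z (invIm (moebius γ τ)) (moebius γ τ) (moebius γ w)),
    expTaylorCoeff_mul e6 (Complex.exp_ne_zero _)
    (analyticAt_genFun h _) (by rw [genFun_zero _ h0]; exact one_ne_zero) hk, expTaylorCoeff_exp_sq _ hk,
    ← e1, ← e2, inv_pow, inv_mul_eq_iff_eq_mul₀ (pow_ne_zero k hl)] at e3
  apply mul_left_cancel₀ (two_ne_zero' ℂ)
  rw [e3]
  split_ifs <;> ring

/-- The coefficient is holomorphic in `(v, τ, w)`; only the substitution `v = 1/(2i Im τ)`, which is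
real-analytic, breaks holomorphy. -/
theorem analyticAt_uHat {k : ℕ} (hk : 1 ≤ k) {p : ℂ × ℂ} (hp : p ∈ domain) :
    AnalyticAt ℝ (fun p : ℂ × ℂ => uHat k p.1 p.2) p := by
  obtain ⟨hτ, hw, hne, h0⟩ := mem_domain_iff.mp hp
  have hev : ∀ᶠ q : ℂ × ℂ in nhds p, q ∈ domain := by
    have c1 : ∀ᶠ q : ℂ × ℂ in nhds p, 0 < q.1.im :=
      continuousAt_const.eventually_lt (by fun_prop) hτ
    have c2 : ∀ᶠ q : ℂ × ℂ in nhds p, 0 < q.2.im :=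
      continuousAt_const.eventually_lt (by fun_prop) hw
    have c3 : ∀ᶠ q : ℂ × ℂ in nhds p, q.1 - q.2 ≠ 0 :=
      ContinuousAt.eventually_ne (by fun_prop) (sub_ne_zero.mpr hne)
    have c4 : ∀ᶠ q : ℂ × ℂ in nhds p, psiCore 0 0 q.1 q.2 ≠ 0 :=
      (analyticAt_psiCore_comp (analyticAt_const (v := (0 : ℂ))) (analyticAt_const (v := (0 : ℂ)))
        analyticAt_fst analyticAt_snd hτ hw).continuousAt.eventually_ne h0
    filter_upwards [c1, c2, c3, c4] with q h1 h2 h3 h4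
    exact mem_domain_iff.mpr ⟨h1, h2, sub_ne_zero.mp h3, h4⟩
  have hcx : AnalyticAt ℂ (fun x : ℂ × ℂ × ℂ => expTaylorCoeff (fun z => genFun z x.1 x.2.1 x.2.2) k)
      (invIm p.1, p.1, p.2) := by
    refine analyticAt_expTaylorCoeff (f := fun y : ℂ × ℂ × ℂ × ℂ => genFun y.1 y.2.1 y.2.2.1 y.2.2.2) ?_ ?_ k
    · have s2 : AnalyticAt ℂ (fun y : ℂ × ℂ × ℂ × ℂ => y.2) (0, invIm p.1, p.1, p.2) := analyticAt_snd
      have s3 : AnalyticAt ℂ (fun y : ℂ × ℂ × ℂ × ℂ => y.2.2) (0, invIm p.1, p.1, p.2) :=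
        AnalyticAt.fun_comp (f := fun y : ℂ × ℂ × ℂ × ℂ => y.2) analyticAt_snd s2
      exact analyticAt_genFun_comp analyticAt_fst
        (AnalyticAt.fun_comp (f := fun y : ℂ × ℂ × ℂ × ℂ => y.2) analyticAt_fst s2)
        (AnalyticAt.fun_comp (f := fun y : ℂ × ℂ × ℂ × ℂ => y.2.2) analyticAt_fst s3)
        (AnalyticAt.fun_comp (f := fun y : ℂ × ℂ × ℂ × ℂ => y.2.2) analyticAt_snd s3) hτ hw (by simpa using hτ)
          sincPi_zero_ne_zero h0
    · simp only [genFun_zero _ h0]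
      exact one_ne_zero
  have him : AnalyticAt ℝ (fun q : ℂ × ℂ => invIm q.1) p := by
    have i1 : AnalyticAt ℝ (fun q : ℂ × ℂ => ((q.1.im : ℝ) : ℂ)) p :=
      (((Complex.ofRealCLM.comp Complex.imCLM).comp (ContinuousLinearMap.fst ℝ ℂ ℂ)).analyticAt p)
    refine analyticAt_const.div (analyticAt_const.mul i1) ?_
    have : (p.1.im : ℂ) ≠ 0 := by exact_mod_cast hτ.ne'
    simp [this]
  have hr : AnalyticAt ℝ (fun q : ℂ × ℂ => (invIm q.1, q.1, q.2)) p :=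
    him.prod (analyticAt_fst.prod analyticAt_snd)
  have hmain := (AnalyticAt.fun_comp (f := fun q : ℂ × ℂ => (invIm q.1, q.1, q.2))
    (hcx.restrictScalars (𝕜 := ℝ)) hr).div_const (c := 2)
  refine hmain.congr ?_
  filter_upwards [hev] with q hq
  rw [← two_mul_uHat_eq hq hk, mul_div_cancel_left₀ _ (two_ne_zero' ℂ)]

theorem transformsQuasimodular_uHat {k : ℕ} (hk : 1 ≤ k) :
    TransformsQuasimodular (CongruenceSubgroup.Gamma0 3) (fun _ _ _ => 1) (k : ℤ) 0 domain (uHat k) := by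
  -- Depth one in `τ` and zero in `w`: the only further coefficient is a constant, which is nonzero
  -- only for `k = 2`.
  refine ⟨fun γ _ p hp => moebius_mem_domain γ hp, 1, 0, fun n _ => if n = 0 then uHat k else fun _ _ =>
    if k = 2 then 3 * Real.pi * Complex.I / (2 * Real.pi * Complex.I) ^ 2 else 0, ?_, fun p _ => by simp, ?_⟩
  · intro n _ m _ p hp
    by_cases hn : n = 0
    · simp only [hn, if_true]
      exact analyticAt_uHat hk hp
    · simp only [hn, if_false]
      exact analyticAt_const
  · intro γ hγ p hp
    rw [uHat_moebius hγ hp hk]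
    simp [Finset.sum_range_succ]

/-! ### Asymptotics of the error function -/

theorem re_csqrt_nonneg (x : ℂ) : 0 ≤ (csqrt x).re := by
  rw [csqrt, one_div, Complex.cpow_inv_two_re]
  exact Real.sqrt_nonneg _

theorem csqrt_sq_of_re_pos {Y : ℂ} (hY : 0 < Y.re) : csqrt (Y ^ 2) = Y := by
  have h := csqrt_sq (Y ^ 2)
  rcases sq_eq_sq_iff_eq_or_eq_neg.mp h with h | h
  · exact h
  · have := re_csqrt_nonneg (Y ^ 2)
    rw [h, Complex.neg_re] at this
    linarith

theorem erf_neg (z : ℂ) : erf (-z) = -erf z := by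
  rw [erf_eq_mul_erfEven, erf_eq_mul_erfEven, neg_sq, neg_mul]

theorem csqrt_pi_div_sq {Y : ℂ} (hY : 0 < Y.re) : csqrt (Real.pi / Y ^ 2) = Real.sqrt Real.pi / Y := by
  have hY0 : Y ≠ 0 := by rintro rfl; simp at hY
  have hs : ((Real.sqrt Real.pi : ℝ) : ℂ) ^ 2 = Real.pi := by
    rw [← Complex.ofReal_pow, Real.sq_sqrt Real.pi_pos.le]
  rw [← hs, ← div_pow, csqrt_sq_of_re_pos]
  rw [div_eq_mul_inv, Complex.re_ofReal_mul, Complex.inv_re]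
  have := Complex.normSq_pos.mpr hY0
  have := Real.sqrt_pos.mpr Real.pi_pos
  positivity

/-- The Gaussian integral over the half-line is `√π/(2Y)`, so `1 - erf Y` is `2Y/√π` times the tail
over `(1, ∞)`. There `x² ≥ x` reduces the estimate to a simple exponential. -/
theorem norm_one_sub_erf_le {Y : ℂ} (hY : 0 < Y.re) (hY2 : 0 < (Y ^ 2).re) :
    ‖1 - erf Y‖ ≤ 2 * ‖Y‖ / (Y ^ 2).re := by
  have hY0 : Y ≠ 0 := by rintro rfl; simp at hY
  have hsp : (Real.sqrt Real.pi : ℂ) ≠ 0 := by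
    exact_mod_cast (Real.sqrt_pos.mpr Real.pi_pos).ne'
  set f : ℝ → ℂ := fun x => Complex.exp (-(Y ^ 2) * (x : ℂ) ^ 2) with hf
  have hfi : MeasureTheory.Integrable f := integrable_cexp_neg_mul_sq hY2
  have h1 : ∫ x in Set.Ioi (0 : ℝ), f x = Real.sqrt Real.pi / Y / 2 := by
    have := integral_gaussian_complex_Ioi hY2
    rw [← csqrt_pi_div_sq hY]
    exact this
  have h2 := intervalIntegral.integral_interval_add_Ioi (a := 0) (b := 1) (μ := MeasureTheory.volume)
    hfi.integrableOn hfi.integrableOn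
  have h3 : erf Y = 2 / (Real.sqrt Real.pi : ℂ) * (Y * ∫ t in (0 : ℝ)..1, f t) := by
    rw [erf]
    congr 3
    funext t
    rw [hf]
    congr 1; ring
  have h4 : 1 - erf Y = 2 / (Real.sqrt Real.pi : ℂ) * Y * ∫ x in Set.Ioi (1 : ℝ), f x := by
    rw [h1] at h2
    rw [h3, eq_sub_of_add_eq' h2]
    field_simp
  have h5 : ‖∫ x in Set.Ioi (1 : ℝ), f x‖ ≤ ∫ x in Set.Ioi (1 : ℝ), Real.exp (-(Y ^ 2).re * x) := by
    refine MeasureTheory.norm_integral_le_of_norm_le (integrableOn_exp_mul_Ioi (by linarith) 1) ?_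
    refine (MeasureTheory.ae_restrict_iff' measurableSet_Ioi).mpr (Filter.Eventually.of_forall fun x hx => ?_)
    have hx1 : 1 < x := hx
    rw [hf, Complex.norm_exp, Real.exp_le_exp, ← Complex.ofReal_pow, Complex.re_mul_ofReal, Complex.neg_re]
    nlinarith [mul_pos hY2 (mul_pos (by linarith : 0 < x) (by linarith : 0 < x - 1))]
  rw [integral_exp_mul_Ioi (by linarith)] at h5
  have h6 : -Real.exp (-(Y ^ 2).re * 1) / -(Y ^ 2).re ≤ 1 / (Y ^ 2).re := by
    rw [neg_div_neg_eq]
    gcongr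
    exact Real.exp_le_one_iff.mpr (by linarith)
  have h7 : ‖(2 / (Real.sqrt Real.pi : ℂ))‖ ≤ 2 := by
    rw [norm_div, Complex.norm_real, Complex.norm_ofNat, Real.norm_of_nonneg (Real.sqrt_nonneg _)]
    apply div_le_self (by norm_num)
    rw [Real.one_le_sqrt]
    linarith [Real.pi_gt_three]
  rw [h4, norm_mul, norm_mul]
  calc _ ≤ 2 * ‖Y‖ * (1 / (Y ^ 2).re) := by
        gcongr
        exact h5.trans h6
    _ = _ := by ring

/-- Two factors of slope at most `1/3` have a product `Y` with `|Im Y| ≤ 3/4 Re Y`, so `Re Y²` is at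
least a quarter of `|Y|²`. -/
theorem norm_one_sub_erf_mul_le {c y : ℂ} (hc : 0 < c.re) (hc' : |c.im| ≤ c.re / 3) (hy : 0 < y.re)
    (hy' : |y.im| ≤ y.re / 3) : ‖1 - erf (c * y)‖ ≤ 8 / (‖c‖ * ‖y‖) := by
  obtain ⟨u, v⟩ := c
  obtain ⟨p, q⟩ := y
  simp only at hc hc' hy hy'
  have hv := abs_le.mp hc'
  have hq := abs_le.mp hy'
  have hup : 0 < u * p := mul_pos hc hy
  have hvq : |v * q| ≤ u * p / 9 := by
    rw [abs_mul]
    calc |v| * |q| ≤ u / 3 * (p / 3) := by gcongr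
      _ = _ := by ring
  have huq : |u * q| ≤ u * p / 3 := by
    rw [abs_mul, abs_of_pos hc, mul_div_assoc]; gcongr
  have hvp : |v * p| ≤ u * p / 3 := by
    rw [abs_mul, abs_of_pos hy]
    calc |v| * p ≤ u / 3 * p := by gcongr
      _ = _ := by ring
  rw [abs_le] at hvq huq hvp
  set Y : ℂ := ⟨u, v⟩ * ⟨p, q⟩ with hYd
  have hre : Y.re = u * p - v * q := by simp [hYd]
  have him : Y.im = u * q + v * p := by simp [hYd]
  have hr1 : 8 / 9 * (u * p) ≤ Y.re := by rw [hre]; linarith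
  have hr2 : Y.re ≤ 10 / 9 * (u * p) := by rw [hre]; linarith
  have hi1 : |Y.im| ≤ 2 / 3 * (u * p) := by rw [him, abs_le]; constructor <;> linarith
  have hi2 : Y.im ^ 2 ≤ (2 / 3 * (u * p)) ^ 2 := sq_le_sq' (by linarith [(abs_le.mp hi1).1]) (abs_le.mp hi1).2
  have hr3 : (8 / 9 * (u * p)) ^ 2 ≤ Y.re ^ 2 := by gcongr
  have hr4 : Y.re ^ 2 ≤ (10 / 9 * (u * p)) ^ 2 := by
    have : 0 ≤ Y.re := by linarith
    gcongr
  have hpos : 0 < Y.re := by linarith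
  have hup2 : 0 < (u * p) ^ 2 := by positivity
  have hsq : (Y ^ 2).re = Y.re ^ 2 - Y.im ^ 2 := by rw [sq, Complex.mul_re]; ring
  have hsq0 : 0 < (Y ^ 2).re := by rw [hsq]; nlinarith
  have hn : ‖Y‖ ^ 2 = Y.re ^ 2 + Y.im ^ 2 := by rw [Complex.sq_norm, Complex.normSq_apply]; ring
  have hM : ‖Y‖ ^ 2 ≤ 5 * (Y ^ 2).re := by
    rw [hsq, hn]; nlinarith
  have hY0 : 0 < ‖Y‖ := norm_pos_iff.mpr (by rintro h; rw [h] at hpos; simp at hpos)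
  refine (norm_one_sub_erf_le hpos hsq0).trans ?_
  rw [← norm_mul, ← hYd, div_le_div_iff₀ hsq0 hY0]
  nlinarith

/-! ### The limit of the completions at the cusp -/

theorem psiFactor_sq (τ w : ℂ) : psiFactor τ w ^ 2 = -(Real.pi * Complex.I * (w - τ)) := by
  rw [psiFactor, mul_pow, csqrt_sq, neg_sq, Complex.I_sq]; ring

/-- The radicand is `-πt + πiε`, just above the negative axis because `ε > 0`. Its principal root
times `-i` is close to the positive axis; below the cut the sign would be reversed. -/
theorem psiFactor_bounds (τ : ℂ) {ε t : ℝ} (hε : 0 < ε) (ht : 2 * ε ≤ t) :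
    0 < (psiFactor τ (τ + Complex.I * t + ε)).re ∧
      |(psiFactor τ (τ + Complex.I * t + ε)).im| ≤ (psiFactor τ (τ + Complex.I * t + ε)).re / 3 ∧
      Real.sqrt t ≤ ‖psiFactor τ (τ + Complex.I * t + ε)‖ := by
  have hpi := Real.pi_gt_three
  have ht0 : 0 < t := by linarith
  set c := psiFactor τ (τ + Complex.I * t + ε) with hc
  set x := csqrt (Real.pi * Complex.I * (τ + Complex.I * t + ε - τ)) with hx
  have hcx : c = -Complex.I * x := rfl
  have hre : c.re = x.im := by rw [hcx]; simp
  have him : c.im = -x.re := by rw [hcx]; simp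
  have hsq : x ^ 2 = Real.pi * Complex.I * (τ + Complex.I * t + ε - τ) := csqrt_sq _
  have hx0 : 0 ≤ x.re := re_csqrt_nonneg _
  have e1 : x.re * x.re - x.im * x.im = -(Real.pi * t) := by
    have := congrArg Complex.re hsq
    simpa [sq] using this
  have e2 : 2 * (x.re * x.im) = Real.pi * ε := by
    have := congrArg Complex.im hsq
    simp [sq] at this
    linarith
  have hprod : 0 < x.re * x.im := by nlinarith
  have him0 : 0 < x.im := by
    by_contra h
    nlinarith
  have hle : x.re ≤ x.im / 3 := by
    by_contra h
    push Not at h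
    have h1 : x.im / 3 * x.im < x.re * x.im := by gcongr
    have h2 : Real.pi * ε ≤ Real.pi * (t / 2) := by gcongr; linarith
    nlinarith
  refine ⟨by rwa [hre], by rw [him, abs_neg, abs_of_nonneg hx0, hre]; exact hle, ?_⟩
  rw [Real.sqrt_le_left (norm_nonneg _), Complex.sq_norm, Complex.normSq_apply, hre, him]
  nlinarith

/-- The bound `3/8 = 1/3 + 1/24` admits the characteristics `±1/3` with a small perturbation and
still keeps `|Re (n + 1/2 + b)|` at least `1/8`; `1/24` is a third of that, as the slope condition
requires. -/
theorem norm_erf_sub_sign_le {c b : ℂ} (hc : 0 < c.re) (hc' : |c.im| ≤ c.re / 3) (hb : |b.re| ≤ 3 / 8)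
    (hb' : |b.im| ≤ 1 / 24) (n : ℤ) :
    ‖erf (c * ((n : ℂ) + 1 / 2 + b)) - (if 0 ≤ n then 1 else -1)‖ ≤ 64 / ‖c‖ := by
  have hc0 : 0 < ‖c‖ := norm_pos_iff.mpr (by rintro rfl; simp at hc)
  have key : ∀ y : ℂ, 1 / 8 ≤ y.re → |y.im| ≤ 1 / 24 → ‖1 - erf (c * y)‖ ≤ 64 / ‖c‖ := by
    intro y h1 h2
    refine (norm_one_sub_erf_mul_le hc hc' (by linarith) (by linarith)).trans ?_
    have h3 : 1 / 8 ≤ ‖y‖ := h1.trans (Complex.re_le_norm y)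
    rw [div_le_div_iff₀ (mul_pos hc0 (by linarith)) hc0]
    nlinarith
  have hre : ((n : ℂ) + 1 / 2 + b).re = n + 1 / 2 + b.re := by simp
  have him : ((n : ℂ) + 1 / 2 + b).im = b.im := by simp
  rw [abs_le] at hb
  split_ifs with hn
  · rw [norm_sub_rev]
    refine key _ ?_ (by rwa [him])
    have : (0 : ℝ) ≤ n := by exact_mod_cast hn
    rw [hre]; linarith
  · have := key (-((n : ℂ) + 1 / 2 + b)) ?_ (by rwa [Complex.neg_im, abs_neg, him])
    · rw [mul_neg, erf_neg] at this
      rw [← norm_neg]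
      rwa [show -(erf (c * ((n : ℂ) + 1 / 2 + b)) - -1) = -(1 - -erf (c * ((n : ℂ) + 1 / 2 + b))) by ring, norm_neg]
    · have : (n : ℝ) ≤ -1 := by exact_mod_cast (by omega : n ≤ -1)
      rw [Complex.neg_re, hre]; linarith

theorem psiFactor_mul_psiTerm (n : ℤ) (a z τ w : ℂ) :
    psiFactor τ w * psiTerm n (a, z, τ, w) = erf (psiFactor τ w * ((n : ℂ) + 1 / 2 + a)) * thetaTerm n z τ := by
  rw [erf_eq_mul_erfEven, mul_pow, psiFactor_sq, psiTerm, thetaTerm, Complex.exp_add, neg_mul]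
  ring

theorem norm_psiFactor_mul_psiCore_sub_le {τ w b : ℂ} (hτ : 0 < τ.im) (hw : 0 < w.im)
    (hc : 0 < (psiFactor τ w).re) (hc' : |(psiFactor τ w).im| ≤ (psiFactor τ w).re / 3)
    (hb : |b.re| ≤ 3 / 8) (hb' : |b.im| ≤ 1 / 24) (z : ℂ) :
    ‖psiFactor τ w * psiCore b z τ w - signTheta z τ‖ ≤ 64 / ‖psiFactor τ w‖ * ∑' n : ℤ, ‖thetaTerm n z τ‖ := by
  have hs := summable_norm_thetaTerm z hτ
  have h1 : Summable fun n : ℤ => psiTerm n (b, z, τ, w) := summable_psiTerm ⟨hτ, hw⟩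
  have h2 : Summable fun n : ℤ => (if 0 ≤ n then (1 : ℂ) else -1) * thetaTerm n z τ := by
    refine Summable.of_norm_bounded hs fun n => ?_
    split_ifs <;> simp
  rw [signTheta_eq_tsum z hτ, psiCore, mul_left_comm, ← mul_sub, norm_mul, Complex.norm_I, one_mul,
    ← tsum_mul_left, ← (h1.mul_left _).tsum_sub h2, ← tsum_mul_left]
  refine tsum_of_norm_bounded (hs.mul_left _).hasSum fun n => ?_
  rw [psiFactor_mul_psiTerm, ← sub_mul, norm_mul]
  gcongr
  exact norm_erf_sub_sign_le hc hc' hb hb' n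

/-- The norm is a monotone exponential in `Im z`, hence at most its value at one end of the strip.
-/
theorem norm_thetaTerm_le {R : ℝ} {z : ℂ} (hz : |z.im| ≤ R) (n : ℤ) (τ : ℂ) :
    ‖thetaTerm n z τ‖ ≤ ‖thetaTerm n (Complex.I * R) τ‖ + ‖thetaTerm n (-(Complex.I * R)) τ‖ := by
  simp only [thetaTerm, norm_mul, ← mul_add]
  gcongr
  have h : ∀ y : ℂ, ‖Complex.exp (2 * Real.pi * Complex.I * ((n : ℂ) + 1 / 2) * y)‖ =
      Real.exp (-(2 * Real.pi * ((n : ℝ) + 1 / 2)) * y.im) := by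
    intro y
    rw [show 2 * Real.pi * Complex.I * ((n : ℂ) + 1 / 2) * y =
      ((2 * Real.pi * ((n : ℝ) + 1 / 2) : ℝ) : ℂ) * (Complex.I * y) by push_cast; ring, Complex.norm_exp,
      Complex.re_ofReal_mul]
    simp
  rw [h, h, h]
  have hi1 : (Complex.I * (R : ℂ)).im = R := by simp
  rw [Complex.neg_im, hi1]
  set x := -(2 * Real.pi * ((n : ℝ) + 1 / 2))
  have hz' := abs_le.mp hz
  rcases le_total 0 x with hx | hx
  · have : Real.exp (x * z.im) ≤ Real.exp (x * R) := Real.exp_le_exp.mpr (by nlinarith)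
    linarith [Real.exp_pos (x * -R)]
  · have : Real.exp (x * z.im) ≤ Real.exp (x * -R) := Real.exp_le_exp.mpr (by nlinarith)
    linarith [Real.exp_pos (x * R)]

theorem continuous_thetaTerm (n : ℤ) (τ : ℂ) : Continuous fun z => thetaTerm n z τ := by
  unfold thetaTerm
  fun_prop

theorem continuousAt_signTheta {τ : ℂ} (hτ : 0 < τ.im) (z₀ : ℂ) : ContinuousAt (fun z => signTheta z τ) z₀ := by
  set R := |z₀.im| + 1
  have hopen : IsOpen {z : ℂ | |z.im| < R} := isOpen_lt (by fun_prop) continuous_const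
  have hmem : z₀ ∈ {z : ℂ | |z.im| < R} := by simp [R]
  simp only [signTheta_eq_tsum _ hτ]
  refine ContinuousOn.continuousAt (s := {z : ℂ | |z.im| < R}) ?_ (hopen.mem_nhds hmem)
  refine continuousOn_const.mul (continuousOn_tsum (fun n => ?_)
    ((summable_norm_thetaTerm (Complex.I * R) hτ).add (summable_norm_thetaTerm (-(Complex.I * R)) hτ))
    fun n z hz => ?_)
  · exact (continuous_const.mul (continuous_thetaTerm n τ)).continuousOn
  · refine le_trans (le_of_eq ?_) (norm_thetaTerm_le (le_of_lt hz) n τ)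
    split_ifs <;> simp

/-- The limit is taken jointly in `t` and `z`, the form in which locally uniform convergence is
later extracted. The error is of order `1/√t`. -/
theorem tendsto_psiFactor_mul_psiCore {τ : ℂ} (hτ : 0 < τ.im) {ε : ℝ} (hε : 0 < ε) {b y : ℂ → ℂ} {z₀ : ℂ}
    (hb : ContinuousAt b z₀) (hy : ContinuousAt y z₀) (hb1 : |(b z₀).re| < 3 / 8) (hb2 : |(b z₀).im| < 1 / 24) :
    Filter.Tendsto (fun p : ℝ × ℂ => psiFactor τ (τ + Complex.I * p.1 + ε) *
      psiCore (b p.2) (y p.2) τ (τ + Complex.I * p.1 + ε)) (Filter.atTop ×ˢ nhds z₀)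
      (nhds (signTheta (y z₀) τ)) := by
  set R := |(y z₀).im| + 1 with hR
  set M := ∑' n : ℤ, (‖thetaTerm n (Complex.I * R) τ‖ + ‖thetaTerm n (-(Complex.I * R)) τ‖) with hM
  have hsM := (summable_norm_thetaTerm (Complex.I * R) hτ).add (summable_norm_thetaTerm (-(Complex.I * R)) hτ)
  have hM0 : 0 ≤ M := tsum_nonneg fun n => by positivity
  have c1 : ∀ᶠ z in nhds z₀, |(b z).re| < 3 / 8 :=
    ContinuousAt.eventually_lt (Complex.continuous_re.continuousAt.comp hb).abs continuousAt_const hb1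
  have c2 : ∀ᶠ z in nhds z₀, |(b z).im| < 1 / 24 :=
    ContinuousAt.eventually_lt (Complex.continuous_im.continuousAt.comp hb).abs continuousAt_const hb2
  have c3 : ∀ᶠ z in nhds z₀, |(y z).im| < R :=
    ContinuousAt.eventually_lt (Complex.continuous_im.continuousAt.comp hy).abs continuousAt_const (by simp [hR])
  have hcont : Filter.Tendsto (fun p : ℝ × ℂ => signTheta (y p.2) τ) (Filter.atTop ×ˢ nhds z₀)
      (nhds (signTheta (y z₀) τ)) :=
    ((ContinuousAt.comp (f := y) (continuousAt_signTheta hτ (y z₀)) hy).tendsto).comp Filter.tendsto_snd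
  have hbound : Filter.Tendsto (fun p : ℝ × ℂ => 64 * M / Real.sqrt p.1) (Filter.atTop ×ˢ nhds z₀) (nhds 0) :=
    (Filter.Tendsto.const_div_atTop Real.tendsto_sqrt_atTop _).comp Filter.tendsto_fst
  have hdiff : Filter.Tendsto (fun p : ℝ × ℂ => psiFactor τ (τ + Complex.I * p.1 + ε) *
      psiCore (b p.2) (y p.2) τ (τ + Complex.I * p.1 + ε) - signTheta (y p.2) τ) (Filter.atTop ×ˢ nhds z₀)
      (nhds 0) := by
    refine squeeze_zero_norm' ?_ hbound
    filter_upwards [(Filter.eventually_ge_atTop (2 * ε)).prod_mk (c1.and (c2.and c3))] with p hp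
    obtain ⟨ht, h1, h2, h3⟩ := hp
    have ht0 : 0 < p.1 := by linarith
    obtain ⟨b1, b2, b3⟩ := psiFactor_bounds τ hε ht
    have hw : 0 < (τ + Complex.I * p.1 + ε).im := by simp; linarith
    refine (norm_psiFactor_mul_psiCore_sub_le hτ hw b1 b2 h1.le h2.le (y p.2)).trans ?_
    have hsum : ∑' n : ℤ, ‖thetaTerm n (y p.2) τ‖ ≤ M :=
      (summable_norm_thetaTerm _ hτ).tsum_le_tsum (fun n => norm_thetaTerm_le h3.le n τ) hsM
    have hst : 0 < Real.sqrt p.1 := Real.sqrt_pos.mpr ht0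
    calc _ ≤ 64 / Real.sqrt p.1 * M := by gcongr
      _ = _ := by ring
  have := hdiff.add hcont
  simpa using this

/-- The limit of `genFun`. -/
def genFunLim (z τ : ℂ) : ℂ :=
  (eisExp z τ * signTheta (2 * z) τ - 4 * Real.pi * z * Complex.exp (2 * Real.pi * Complex.I * τ / 8) *
    Complex.exp (-lambertSeries 0 τ) * tripleFactor (fun y => signTheta y (3 * τ)) z τ) / signTheta 0 τ

/-- The even expansion `rankSeries_eq_signTheta` divided by `rankProd` and `sincPi`. The prefactor
does not involve `z`, so it does not affect exponential Taylor coefficients. -/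
theorem unimodalGF_div_sincPi {z τ : ℂ} (h : |z.im| < τ.im) (hz : sincPi z ≠ 0) (h0 : signTheta 0 τ ≠ 0) :
    unimodalGF (Complex.exp (2 * Real.pi * Complex.I * z)) (qOf τ) / sincPi z =
      signTheta 0 τ / (2 * Complex.I * Complex.exp (2 * Real.pi * Complex.I * τ / 8) *
        Complex.exp (-lambertSeries 0 τ)) * genFunLim z τ := by
  have hr := rankProd_ne_zero h
  have e1 := unimodalGF_mul_rankProd h
  rw [rankSeries_eq_signTheta h, ← sincPi_mul] at e1
  have e2 := eisExp_mul_rankProd h hz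
  have hE := Complex.exp_ne_zero (2 * Real.pi * Complex.I * τ / 8)
  have hL := Complex.exp_ne_zero (-lambertSeries 0 τ)
  have he : eisExp z τ ≠ 0 := by
    intro h1
    rw [h1, zero_mul] at e2
    exact hL e2.symm
  rw [← e2, genFunLim, ← e2]
  generalize Complex.exp (2 * Real.pi * Complex.I * τ / 8) = E at *
  rw [← mul_left_inj' hr, div_mul_eq_mul_div, e1]
  field_simp
  linear_combination (4 * Real.pi * z * sincPi z * rankProd z τ * E * tripleFactor (fun y => signTheta y (3 * τ)) z τ) * Complex.I_sq

/-- At `z = 0` the summand with `sin (πz)` drops out, and `U(1; q)` is a nonzero multiple of the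
false theta value. -/
theorem signTheta_zero_ne_zero {τ : ℂ} (hτ : 0 < τ.im) (h : unimodalGF 1 (qOf τ) ≠ 0) : signTheta 0 τ ≠ 0 := by
  intro h0
  have e1 := unimodalGF_mul_rankProd (z := 0) (τ := τ) (by simpa using hτ)
  rw [rankSeries_eq_signTheta (by simpa using hτ)] at e1
  simp only [mul_zero, Complex.exp_zero, Complex.sin_zero, zero_mul, h0, zero_div, add_zero] at e1
  exact (mul_ne_zero h (rankProd_ne_zero (by simpa using hτ))) e1

theorem genFunLim_zero {τ : ℂ} (h0 : signTheta 0 τ ≠ 0) : genFunLim 0 τ = 1 := by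
  simp [genFunLim, eisExp_zero, h0]

theorem tendsto_genFun {τ : ℂ} (hτ : 0 < τ.im) (h0 : signTheta 0 τ ≠ 0) {ε : ℝ} (hε : 0 < ε) (v : ℂ) :
    ∀ᶠ z₀ in nhds 0, Filter.Tendsto (fun p : ℝ × ℂ => genFun p.2 v τ (τ + Complex.I * p.1 + ε))
      (Filter.atTop ×ˢ nhds z₀) (nhds (genFunLim z₀ τ)) := by
  have small : ∀ᶠ z : ℂ in nhds 0, ‖2 * z * v‖ < 1 / 24 :=
    ContinuousAt.eventually_lt (by fun_prop) continuousAt_const (by simp)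
  have h3 : 0 < (3 * τ).im := three_mul_im_pos hτ
  have hsinc : ContinuousAt sincPi 0 := (analyticAt_sincPi 0).continuousAt
  filter_upwards [small, eventually_abs_im_lt hτ, hsinc.eventually_ne sincPi_zero_ne_zero] with z₀ hz hz1 hz2
  have hzv : ‖z₀ * v‖ < 1 / 24 := by
    rw [mul_assoc, norm_mul] at hz
    norm_num at hz ⊢
    have : 0 ≤ ‖z₀‖ * ‖v‖ := by positivity
    linarith
  have hre := (Complex.abs_re_le_norm (z₀ * v)).trans_lt hzv
  have him := (Complex.abs_im_le_norm (z₀ * v)).trans_lt hzv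
  have hre2 := (Complex.abs_re_le_norm (2 * z₀ * v)).trans_lt hz
  have him2 := (Complex.abs_im_le_norm (2 * z₀ * v)).trans_lt hz
  have t1 := tendsto_psiFactor_mul_psiCore hτ hε (b := fun z => 2 * z * v) (y := fun z => 2 * z) (z₀ := z₀)
    (by fun_prop) (by fun_prop) (by linarith) him2
  have t0 := tendsto_psiFactor_mul_psiCore hτ hε (b := fun _ => 0) (y := fun _ => 0) (z₀ := z₀)
    (by fun_prop) (by fun_prop) (by norm_num) (by norm_num)
  -- As `3w = 3τ + i(3t) + 3ε`, the level-three series are covered by the same limit with `3t` and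
  -- `3ε`.
  have hmap : Filter.Tendsto (fun p : ℝ × ℂ => (3 * p.1, p.2)) (Filter.atTop ×ˢ nhds z₀)
      (Filter.atTop ×ˢ nhds z₀) :=
    (Filter.Tendsto.const_mul_atTop (by norm_num) Filter.tendsto_id).prodMap Filter.tendsto_id
  have hw : ∀ t : ℝ, 3 * τ + Complex.I * ((3 * t : ℝ) : ℂ) + ((3 * ε : ℝ) : ℂ) =
      3 * (τ + Complex.I * t + ε) := fun t => by push_cast; ring
  have tp := (tendsto_psiFactor_mul_psiCore h3 (ε := 3 * ε) (by linarith) (b := fun z => z * v + 1 / 3)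
    (y := fun z => 3 * z + τ) (z₀ := z₀) (by fun_prop) (by fun_prop)
    (by rw [abs_lt] at *; constructor <;> simp at * <;> linarith) (by simpa using him)).comp hmap
  have tm := (tendsto_psiFactor_mul_psiCore h3 (ε := 3 * ε) (by linarith) (b := fun z => z * v - 1 / 3)
    (y := fun z => 3 * z - τ) (z₀ := z₀) (by fun_prop) (by fun_prop)
    (by rw [abs_lt] at *; constructor <;> simp at * <;> linarith) (by simpa using him)).comp hmap
  simp only [Function.comp_def, hw, psiFactor_three_mul] at tp tm
  have hz' : Filter.Tendsto (fun p : ℝ × ℂ => p.2) (Filter.atTop ×ˢ nhds z₀) (nhds z₀) := Filter.tendsto_snd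
  have te : Filter.Tendsto (fun p : ℝ × ℂ => eisExp p.2 τ) (Filter.atTop ×ˢ nhds z₀) (nhds (eisExp z₀ τ)) :=
    ((analyticAt_eisExp_comp (z := fun z => z) (τ := fun _ => τ) analyticAt_id analyticAt_const hz1
      hz2).continuousAt.tendsto).comp hz'
  have tc : ∀ s : ℂ, Filter.Tendsto (fun p : ℝ × ℂ => Complex.exp (s * p.2)) (Filter.atTop ×ˢ nhds z₀)
      (nhds (Complex.exp (s * z₀))) := fun s =>
    (ContinuousAt.tendsto (f := fun z => Complex.exp (s * z)) (x := z₀) (by fun_prop)).comp hz'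
  have tT := (((tc (2 * Real.pi * Complex.I)).mul tp).neg.add ((tc (-(2 * Real.pi * Complex.I))).mul tm)).const_mul
    (Complex.I / 2 * Complex.exp (2 * Real.pi * Complex.I * τ / 8))
  -- Numerator and denominator of `genFun` are both multiplied by `psiFactor τ w`. The explicit `√3`
  -- turns this into `psiFactor (3τ) (3w)` in the second summand.
  have tF := ((te.mul t1).sub (((hz'.const_mul (4 * Real.pi : ℂ)).mul_const
    (Complex.exp (2 * Real.pi * Complex.I * τ / 8) * Complex.exp (-lambertSeries 0 τ))).mul tT)).div t0 h0
  have hlim : (eisExp z₀ τ * signTheta (2 * z₀) τ - 4 * Real.pi * z₀ *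
      (Complex.exp (2 * Real.pi * Complex.I * τ / 8) * Complex.exp (-lambertSeries 0 τ)) *
      (Complex.I / 2 * Complex.exp (2 * Real.pi * Complex.I * τ / 8) *
        (-(Complex.exp (2 * Real.pi * Complex.I * z₀) * signTheta (3 * z₀ + τ) (3 * τ)) +
          Complex.exp (-(2 * Real.pi * Complex.I) * z₀) * signTheta (3 * z₀ - τ) (3 * τ)))) / signTheta 0 τ =
      genFunLim z₀ τ := by
    rw [genFunLim, tripleFactor, neg_mul (2 * Real.pi * Complex.I)]; ring
  rw [hlim] at tF
  refine tF.congr' ?_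
  have hev : ∀ᶠ p : ℝ × ℂ in Filter.atTop ×ˢ nhds z₀, 2 * ε ≤ p.1 :=
    (Filter.eventually_ge_atTop (2 * ε)).prod_inl _
  filter_upwards [hev] with p ht
  obtain ⟨b1, -, -⟩ := psiFactor_bounds τ hε ht
  have hc : psiFactor τ (τ + Complex.I * p.1 + ε) ≠ 0 := by
    intro h; rw [h] at b1; simp at b1
  by_cases hP : psiCore 0 0 τ (τ + Complex.I * p.1 + ε) = 0
  · simp [genFun, hP]
  · rw [genFun, psiTriple, Pi.div_apply, neg_mul (2 * Real.pi * Complex.I)]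
    field_simp

theorem tendstoLocallyUniformlyOn_iteratedDeriv {ι : Type*} {p : Filter ι} {U : Set ℂ} (hU : IsOpen U) (k : ℕ) :
    ∀ {F : ι → ℂ → ℂ} {f : ℂ → ℂ}, TendstoLocallyUniformlyOn F f p U →
      (∀ᶠ n in p, DifferentiableOn ℂ (F n) U) →
        TendstoLocallyUniformlyOn (fun n => iteratedDeriv k (F n)) (iteratedDeriv k f) p U := by
  induction k with
  | zero => intro F f h _; simpa only [iteratedDeriv_zero] using h
  | succ k ih =>
    intro F f h hF
    simp only [iteratedDeriv_succ']
    exact ih (h.deriv hF hU) (hF.mono fun n hn => hn.deriv hU)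

theorem mem_slitPlane_of_dist_one_le {x : ℂ} (h : dist x 1 ≤ 1 / 2) : x ∈ Complex.slitPlane := by
  refine Or.inl ?_
  have h1 := (Complex.abs_re_le_norm (x - 1)).trans ((dist_eq_norm x 1).ge.trans h)
  have h2 := (abs_le.mp h1).1
  simp at h2
  linarith

theorem continuousAt_genFunLim {z τ : ℂ} (h : |z.im| < τ.im) (hz : sincPi z ≠ 0) :
    ContinuousAt (fun z => genFunLim z τ) z := by
  have hτ : 0 < τ.im := (abs_nonneg _).trans_lt h
  have he : ContinuousAt (fun z => eisExp z τ) z := (analyticAt_eisExp_comp (z := fun z => z) (τ := fun _ => τ)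
    analyticAt_id analyticAt_const h hz).continuousAt
  have h1 : ContinuousAt (fun z => signTheta (2 * z) τ) z :=
    ContinuousAt.comp (f := fun z => 2 * z) (continuousAt_signTheta hτ (2 * z)) (by fun_prop)
  have h2 : ContinuousAt (fun z => signTheta (3 * z + τ) (3 * τ)) z :=
    ContinuousAt.comp (f := fun z => 3 * z + τ) (continuousAt_signTheta (three_mul_im_pos hτ) (3 * z + τ))
      (by fun_prop)
  have h3 : ContinuousAt (fun z => signTheta (3 * z - τ) (3 * τ)) z :=
    ContinuousAt.comp (f := fun z => 3 * z - τ) (continuousAt_signTheta (three_mul_im_pos hτ) (3 * z - τ))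
      (by fun_prop)
  unfold genFunLim tripleFactor
  fun_prop

/-- On a neighbourhood of `0` and for large `t` the values of `genFun` stay within `1/2` of `1`, so
their logarithms are holomorphic and converge locally uniformly. By Weierstrass' theorem the
derivatives at `0` converge too. -/
theorem tendsto_uHat {k : ℕ} (hk : 1 ≤ k) {τ : ℂ} (hτ : 0 < τ.im) (hU : unimodalGF 1 (qOf τ) ≠ 0) {ε : ℝ}
    (hε : 0 < ε) :
    Filter.Tendsto (fun t : ℝ => uHat k τ (τ + Complex.I * (t : ℂ) + (ε : ℂ))) Filter.atTop (nhds (u k τ)) := by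
  have h0 := signTheta_zero_ne_zero hτ hU
  obtain ⟨F, hF⟩ : ∃ F : ℝ → ℂ → ℂ, ∀ t, F t = fun z => genFun z (invIm τ) τ (τ + Complex.I * t + ε) :=
    ⟨_, fun _ => rfl⟩
  obtain ⟨f, hf⟩ : ∃ f : ℂ → ℂ, f = fun z => genFunLim z τ := ⟨_, rfl⟩
  have hf0 : f 0 = 1 := by rw [hf]; exact genFunLim_zero h0
  have hlim : ∀ᶠ z₀ in nhds 0, Filter.Tendsto (fun p : ℝ × ℂ => F p.1 p.2) (Filter.atTop ×ˢ nhds z₀)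
      (nhds (f z₀)) := by
    simp only [hF, hf]
    exact tendsto_genFun hτ h0 hε (invIm τ)
  have hball : ∀ᶠ p : ℝ × ℂ in Filter.atTop ×ˢ nhds 0, dist (F p.1 p.2) 1 < 1 / 2 := by
    have h1 := hlim.self_of_nhds
    rw [← hf0]
    exact h1 (Metric.ball_mem_nhds _ (by norm_num))
  obtain ⟨A, hA, B, hB, hAB⟩ := Filter.eventually_prod_iff.mp hball
  have hsinc : ∀ᶠ z in nhds 0, sincPi z ≠ 0 :=
    (analyticAt_sincPi 0).continuousAt.eventually_ne sincPi_zero_ne_zero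
  obtain ⟨U, hUs', hUo, hU0⟩ := mem_nhds_iff.mp (hB.and (hlim.and ((eventually_abs_im_lt hτ).and hsinc)))
  have hUs : ∀ z ∈ U, B z ∧ Filter.Tendsto (fun p : ℝ × ℂ => F p.1 p.2) (Filter.atTop ×ˢ nhds z) (nhds (f z)) ∧
      |z.im| < τ.im ∧ sincPi z ≠ 0 := fun z hz => hUs' hz
  -- If it vanished, division by zero would make `genFun` equal to `0`, at distance `1` from `1`.
  have hP0 : ∀ t, A t → psiCore 0 0 τ (τ + Complex.I * t + ε) ≠ 0 := by
    intro t ht h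
    have h1 := hAB ht (hUs 0 hU0).1
    simp only [hF, genFun, h, div_zero, sub_zero, dist_zero_left, norm_one] at h1
    norm_num at h1
  have him : ∀ᶠ t : ℝ in Filter.atTop, 0 < (τ + Complex.I * t + ε).im := by
    filter_upwards [Filter.eventually_ge_atTop 0] with t ht
    simp; linarith
  have hfs : ∀ z ∈ U, f z ∈ Complex.slitPlane := by
    intro z hz
    obtain ⟨h1, h2, -⟩ := hUs z hz
    have hm : Filter.Tendsto (fun t : ℝ => (t, z)) Filter.atTop (Filter.atTop ×ˢ nhds z) :=
      Filter.tendsto_id.prodMk tendsto_const_nhds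
    have h3 : Filter.Tendsto (fun t => F t z) Filter.atTop (nhds (f z)) := Filter.Tendsto.comp h2 hm
    refine mem_slitPlane_of_dist_one_le (le_of_tendsto (h3.dist tendsto_const_nhds) ?_)
    filter_upwards [hA] with t ht
    exact (hAB ht h1).le
  have hTL : TendstoLocallyUniformlyOn (fun t z => Complex.log (F t z)) (fun z => Complex.log (f z))
      Filter.atTop U := by
    rw [hUo.tendstoLocallyUniformlyOn_iff_forall_tendsto]
    intro z hz
    obtain ⟨h1, h2, h3, h4⟩ := hUs z hz
    have h5 : Filter.Tendsto (fun p : ℝ × ℂ => f p.2) (Filter.atTop ×ˢ nhds z) (nhds (f z)) :=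
      by rw [hf]; exact (continuousAt_genFunLim h3 h4).tendsto.comp Filter.tendsto_snd
    exact ((h5.clog (hfs z hz)).prodMk_nhds (h2.clog (hfs z hz))).mono_right (nhds_le_uniformity _)
  have hD : ∀ᶠ t in Filter.atTop, DifferentiableOn ℂ (fun z => Complex.log (F t z)) U := by
    filter_upwards [hA, him] with t ht hw z hz
    obtain ⟨h1, -, h3, h4⟩ := hUs z hz
    have h5 : AnalyticAt ℂ (F t) z := hF t ▸ analyticAt_genFun_comp analyticAt_id analyticAt_const analyticAt_const
      analyticAt_const hτ hw h3 h4 (hP0 t ht)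
    exact (h5.differentiableAt.clog (mem_slitPlane_of_dist_one_le (hAB ht h1).le)).differentiableWithinAt
  have hconv := ((tendstoLocallyUniformlyOn_iteratedDeriv hUo k hTL hD).tendsto_at hU0).div_const
    ((2 * Real.pi * Complex.I) ^ k) |>.div_const 2
  have hu : u k τ = iteratedDeriv k (fun z => Complex.log (f z)) 0 / (2 * Real.pi * Complex.I) ^ k / 2 := by
    have hE := Complex.exp_ne_zero (2 * Real.pi * Complex.I * τ / 8)
    have hL := Complex.exp_ne_zero (-lambertSeries 0 τ)
    have h1 : (fun z => unimodalGF (Complex.exp (2 * Real.pi * Complex.I * z)) (qOf τ) / sincPi z) =ᶠ[nhds 0]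
        fun z => signTheta 0 τ / (2 * Complex.I * Complex.exp (2 * Real.pi * Complex.I * τ / 8) *
          Complex.exp (-lambertSeries 0 τ)) * f z := by
      filter_upwards [eventually_abs_im_lt hτ, hsinc] with z h1 h2
      rw [hf]
      exact unimodalGF_div_sincPi h1 h2 h0
    rw [u, expTaylorCoeff_congr h1, expTaylorCoeff_const_mul _ (div_ne_zero h0 (mul_ne_zero (mul_ne_zero
      (mul_ne_zero two_ne_zero Complex.I_ne_zero) hE) hL)), expTaylorCoeff, hf0]
    simp only [div_one]
  rw [hu]
  refine hconv.congr' ?_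
  filter_upwards [hA, him] with t ht hw
  -- The real parts differ by `ε`, so the pair lies in the domain.
  have hne : τ ≠ τ + Complex.I * t + ε := by
    intro h
    have := congrArg Complex.re h
    simp at this
    linarith
  have hdom := mem_domain_iff.mpr ⟨hτ, hw, hne, hP0 t ht⟩
  have h1 := two_mul_uHat_eq hdom hk
  rw [expTaylorCoeff, genFun_zero _ (hP0 t ht)] at h1
  simp only [div_one] at h1
  simp only [hF]
  rw [eq_comm, eq_div_iff two_ne_zero, mul_comm]
  exact h1

end QuasiCompletion

end

theorem corollary1p8 (k : ℕ) (hk : 1 ≤ k) :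
    QuasiCompletion.TransformsQuasimodular (CongruenceSubgroup.Gamma0 3) (fun _ _ _ => 1) (k : ℤ) 0
        QuasiCompletion.domain (QuasiCompletion.uHat k) ∧
      ∀ τ : ℂ, 0 < τ.im → QuasiCompletion.unimodalGF 1 (QuasiCompletion.qOf τ) ≠ 0 →
        ∀ ε : ℝ, 0 < ε →
          Filter.Tendsto (fun t : ℝ => QuasiCompletion.uHat k τ (τ + Complex.I * (t : ℂ) + (ε : ℂ)))
            Filter.atTop (nhds (QuasiCompletion.u k τ)) :=
  ⟨QuasiCompletion.transformsQuasimodular_uHat hk, fun _ hτ hU _ hε =>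
    QuasiCompletion.tendsto_uHat hk hτ hU hε⟩
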